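/- A *plane graph* is a finite connected graph with at least one edge, loops and multiple edges allowed, embedded in the oriented sphere and considered up to orientation-preserving homeomorphism of the sphere (vertices carry no labels). The boundary of each face $F$ is oriented counter-clockwise, and $\mathrm{Next}_F$ sends a vertex or an edge of the boundary walk of $F$ to the following one. The *perimeter* of $F$ is the length of its boundary walk (an edge with $F$ on both sides is counted twice). Let $a$ be an edge of a plane graph with at least two edges. The *tilting transformation* at $a$ removes $a$ and reinserts it as follows. 1. *($a$ is a leaf.)* Let $V$ be the vertex of degree $1$ of $a$, $V_1$ its other vertex, $F$ the face containing $a$; let $a_1=\mathrm{Next}_F(a)$ be the edge that follows $a$ on $F$ after $a$ has been traversed in both directions, and $V_2=\mathrm{Next}_F(V_1)$ the vertex to which $a_1$ leads from $V_1$. Reinsert $a$ as a leaf inside $F$ joining $V_2$ to $V$, so that $a$ immediately follows $a_1$ on $F$. 2. *($a$ is a loop at a vertex $V_1$ and is the whole boundary of a face $F_1$.)* Let $F_2$ be the other face incident with $a$, $a_1=\mathrm{Next}_{F_2}(a)$, $V_2=\mathrm{Next}_{F_2}(V_1)$ the vertex to which $a_1$ leads from $V_1$. Reinsert $a$ as a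 loop at $V_2$ inside $F_2$, immediately following $a_1$ on $F_2$, so that it again bounds $F_1$. 3. *(All other edges.)* Let $V_1,V_2$ be the (possibly equal) ends of $a$ and let $F_1$, resp. $F_2$, be the (possibly equal) face on whose boundary $a$ is traversed from $V_1$ to $V_2$, resp. from $V_2$ to $V_1$. For $i=1,2$ let $a_i$ be the edge preceding $a$ (in this traversal) on $F_i$, and $V_i'$ the vertex preceding $V_i$, so that $a_i$ leads from $V_i'$ to $V_i$. Reinsert $a$ as an edge joining $V_1'$ to $V_2'$ whose end at $V_i'$ lies in the corner of $F_i$ just before $a_i$; it again separates $F_1$ from $F_2$, and $a$ is adjacent to $a_i$ (immediately followed by it) on the new boundary of $F_{3-i}$. Two plane graphs are *chain equivalent* if each can be obtained from the other by a finite (possibly empty) sequence of tilting transformations. **Proposition.** Any two plane graphs with the same multiset of perimeters of faces are chain equivalent. -/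

import Mathlib

/-- A graph (loops and multiple edges allowed) cellularly embedded in a closed oriented surface,
vertex labels ignored, given by its half-edges (darts) `D`: `opp` exchanges the two halves of
each edge, and `rot` is the permutation whose cycles are the cyclic orders `π_V` of the half-edges
around the vertices `V`. -/
structure EmbeddedGraph (D : Type*) where
  rot : Equiv.Perm D
  opp : Equiv.Perm D
  opp_opp : ∀ x, opp (opp x) = x
  opp_ne : ∀ x, opp x ≠ x

namespace EmbeddedGraph

/-- The cycles of a permutation, fixed points included. -/
abbrev Cycles {D : Type*} (f : Equiv.Perm D) : Type _ :=
  Quotient (Equiv.Perm.SameCycle.setoid f)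

section Basic

variable {D : Type*} (G : EmbeddedGraph D)

/-- The dart `x`, read as its edge directed away from its own vertex, is followed on the boundary
of the face beside it by the dart `rot (opp x)`. So this permutation is `Next_F` on the
(directed) edges of every face `F`. -/
def next : Equiv.Perm D := G.rot * G.opp

abbrev Vertex : Type _ := Cycles G.rot

abbrev Edge : Type _ := Cycles G.opp

abbrev Face : Type _ := Cycles G.next

/-- The number of edges on the boundary of a face, counted with multiplicity. -/
noncomputable def perimeter (F : G.Face) : ℕ :=
  Nat.card {x : D // (Quotient.mk _ x : G.Face) = F}

open Classical in
/-- The multiset of the perimeters of all faces. -/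
noncomputable def perimeters [Fintype D] : Multiset ℕ :=
  (Finset.univ : Finset G.Face).val.map G.perimeter

/-- The underlying graph is connected: any dart can be reached from any other one. -/
def Connected : Prop :=
  ∀ x y : D, ∃ g ∈ Subgroup.closure ({G.rot, G.opp} : Set (Equiv.Perm D)), g x = y

/-- The graph is connected and its surface is the sphere (Euler's formula `V - E + F = 2`).
This forces `D` to be nonempty, i.e. there is at least one edge. -/
def IsPlane : Prop :=
  G.Connected ∧ Nat.card G.Vertex + Nat.card G.Face = Nat.card G.Edge + 2

/-- Isomorphism of embedded graphs, preserving the orientation of the surface. -/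
def Isomorphic {D' : Type*} (G : EmbeddedGraph D) (H : EmbeddedGraph D') : Prop :=
  ∃ e : D ≃ D', (∀ x, e (G.rot x) = H.rot (e x)) ∧ (∀ x, e (G.opp x) = H.opp (e x))

end Basic

section Moves

variable {D : Type*} [DecidableEq D]

/-- Take `x` out of its cycle: `x` becomes a fixed point, its predecessor is sent to its
successor. -/
def detach (f : Equiv.Perm D) (x : D) : Equiv.Perm D := Equiv.swap x (f x) * f

/-- Put the fixed point `x` of `f` immediately after `p` in the cycle of `p`. -/
def attachAfter (f : Equiv.Perm D) (p x : D) : Equiv.Perm D := f * Equiv.swap p x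

/-- Put the fixed point `x` of `f` immediately before `q` in the cycle of `q`. -/
def attachBefore (f : Equiv.Perm D) (q x : D) : Equiv.Perm D := Equiv.swap q x * f

theorem detach_self (f : Equiv.Perm D) (x : D) : detach f x x = x := by
  simp [detach]

theorem detach_pred (f : Equiv.Perm D) (x y : D) (h : f y = x) : detach f x y = f x := by
  simp [detach, h]

theorem attachAfter_left (f : Equiv.Perm D) (p x : D) (h : f x = x) :
    attachAfter f p x p = x := by
  simp [attachAfter, h]

theorem attachAfter_self (f : Equiv.Perm D) (p x : D) : attachAfter f p x x = f p := by
  simp [attachAfter]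

theorem attachBefore_self (f : Equiv.Perm D) (q x : D) (h : f x = x) :
    attachBefore f q x x = q := by
  simp [attachBefore, h]

theorem attachBefore_pred (f : Equiv.Perm D) (q x y : D) (h : f y = q) :
    attachBefore f q x y = x := by
  simp [attachBefore, h]

variable (G : EmbeddedGraph D)

/-- The same darts and edges with new cyclic orders around the vertices. -/
def withRot (r : Equiv.Perm D) : EmbeddedGraph D := { G with rot := r }

/-- The edge of `h` is a leaf whose dangling vertex carries the dart `opp h`, and it is not
the only edge. -/
def IsLeaf (h : D) : Prop := G.rot (G.opp h) = G.opp h ∧ G.rot h ≠ h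

/-- The edge of `h` is a loop which alone bounds the face of the dart `h`, and it is not the
only edge. -/
def IsBoundingLoop (h : D) : Prop := G.rot (G.opp h) = h ∧ G.rot h ≠ G.opp h

/-- The edge of `h` is neither a leaf nor a loop bounding a face: each of its two half-edges is
preceded, around its vertex, by a half-edge of another edge. -/
def IsGeneral (h : D) : Prop :=
  G.rot h ≠ h ∧ G.rot (G.opp h) ≠ G.opp h ∧ G.rot h ≠ G.opp h ∧ G.rot (G.opp h) ≠ h

/-- Type 1. The dart of the leaf `a` at `V₁` is `h`, and the edge `a₁ = Next_F(a)` is left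
along the dart `G.rot h = Next_F (opp h)`, from `V₁` to `V₂ = Next_F(V₁)`. The edge `a` is taken
off and hung at `V₂` immediately after `a₁`, so that now `a = Next_F(a₁)`. -/
def shiftLeaf (h : D) : EmbeddedGraph D :=
  G.withRot (attachAfter (detach G.rot h) (G.opp (G.rot h)) h)

/-- Type 2. The loop `a` at `V₁` bounds the face `F₁` of `h`; on its other side is the face `F₂`
of `opp h`, with `a₁ = Next_{F₂}(a)` given by the dart `G.rot h = Next_{F₂} (opp h)`, from `V₁` to
`V₂`. The loop is taken off and put at `V₂`, inside `F₂`, immediately after `a₁`, and `h` bounds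
`F₁` again. -/
def shiftLoop (h : D) : EmbeddedGraph D :=
  G.withRot
    (attachAfter
      (attachAfter (detach (detach G.rot h) (G.opp h)) (G.opp (G.rot h)) (G.opp h))
      (G.opp h) h)

/-- Type 3. The edge `a` has darts `h` at `V₁` (face `F₁`) and `opp h` at `V₂` (face `F₂`), and
`aᵢ = Next_{Fᵢ}⁻¹(a)` is given by the dart `G.next.symm h`, resp. `G.next.symm (opp h)`,
from `Vᵢ'` to `Vᵢ`. The edge `a` is taken off, and `h` (resp. `opp h`) is put at `V₁'` (resp.
`V₂'`) immediately before that dart. Then `h` is still beside `F₁` and `opp h` beside `F₂`,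
and `a₁`, `a₂` come next to `a` on `F₂`, `F₁` respectively. -/
def shiftEdge (h : D) : EmbeddedGraph D :=
  G.withRot
    (attachBefore
      (attachBefore (detach (detach G.rot h) (G.opp h)) (G.next.symm h) h)
      (G.next.symm (G.opp h)) (G.opp h))

/-- `H` is the result of a tilting transformation (of type 1, 2 or 3) of `G`. -/
inductive Tilting (G : EmbeddedGraph D) : EmbeddedGraph D → Prop
  | leaf (h : D) : G.IsLeaf h → Tilting G (G.shiftLeaf h)
  | loop (h : D) : G.IsBoundingLoop h → Tilting G (G.shiftLoop h)
  | general (h : D) : G.IsGeneral h → Tilting G (G.shiftEdge h)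

/-- `H` is obtained, up to isomorphism, from `G` by a finite sequence of tilting
transformations. -/
def ObtainableFrom {D' : Type*} (H : EmbeddedGraph D') (G : EmbeddedGraph D) : Prop :=
  ∃ G' : EmbeddedGraph D, Relation.ReflTransGen Tilting G G' ∧ G'.Isomorphic H

/-- Each of the two graphs is obtained from the other by tilting transformations. -/
def ChainEquivalent {D' : Type*} [DecidableEq D'] (G : EmbeddedGraph D)
    (H : EmbeddedGraph D') : Prop :=
  H.ObtainableFrom G ∧ G.ObtainableFrom H

end Moves

end EmbeddedGraph

/-! A graph is handled through the pair (`next`, `opp`), the cycles of `next` being the faces. Every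
tilting fixes `opp` and conjugates `next` by an explicit permutation (`shiftEdge_eq`,
`shiftLeaf_eq`, `shiftLoop_eq`). Tilting at a fixed dart is an injective self-map of a finite set of
graphs, so tiltings can be undone by chains of tiltings (`Tilting.reverse`). Two graphs with equal
perimeters have conjugate `next`; after a relabelling they have the same `next`, and
`obtainable_of_next_eq` joins them by induction on the number of darts.

If all perimeters are at most 2, `next` and `opp` are involutions generating a transitive dihedral
action, and Euler's formula leaves a single graph up to isomorphism
(`isomorphic_of_next_involutive`). If there is one face, the graphs are trees; a rotation of the
face gives them a common leaf, which is removed. Otherwise let a ≥ b be the largest perimeters of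
two different faces, so that a ≥ 3. Turning edges along a path in the dual graph makes these faces
adjacent (`exists_adjacent`), and a relabelling inside them lets both graphs share an edge between
them. Deleting that edge merges the two faces into one of perimeter a + b - 2, strictly larger than
every other perimeter.

By induction a chain joins the smaller graphs, and it has to be lifted. The deleted edge is a
diagonal of the merged face (a bounding loop if b = 1), and its own tiltings rotate it inside that
face (`insertEdge_of_sameCycle`). Before each tilting of the smaller graph the diagonal is rotated
away from the two places that this tilting uses; the tilting then commutes with the insertion
(`TiltingOff`). Counting chords shows that this can fail only in faces with at most four darts.
There, either the configuration cannot occur, or the tilting does not change the smaller graph, or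
the face is a square containing a leaf, which needs a separate move (`carries_leaf_square`). At the
end of the chain the diagonal still lies in the unique largest face, so it can be rotated to the
required place. -/

namespace EmbeddedGraph

open Equiv Equiv.Perm

variable {D : Type*}

/-! ### Tiltings as conjugations of `next` -/

theorem apply_inv_self (f : Perm D) (x : D) : f (f⁻¹ x) = x := f.apply_symm_apply x

theorem inv_apply_self (f : Perm D) (x : D) : f⁻¹ (f x) = x := f.symm_apply_apply x

@[ext]
theorem ext_next {G H : EmbeddedGraph D} (hn : G.next = H.next) (ho : G.opp = H.opp) : G = H := by
  have hr : G.rot = H.rot := by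
    have := hn
    unfold next at this
    rw [ho] at this
    exact mul_right_cancel this
  cases G; cases H; simp_all

@[simp]
theorem opp_mul_opp (G : EmbeddedGraph D) : G.opp * G.opp = 1 := by
  ext x; simp [G.opp_opp]

@[simp]
theorem opp_opp' (G : EmbeddedGraph D) (x : D) : G.opp (G.opp x) = x := G.opp_opp x

theorem rot_eq (G : EmbeddedGraph D) : G.rot = G.next * G.opp := by
  simp [next, mul_assoc]

theorem rot_apply (G : EmbeddedGraph D) (x : D) : G.rot x = G.next (G.opp x) := by
  simp [next]

/-- The same darts and edges with a new permutation `Next`. -/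
def withNext (G : EmbeddedGraph D) (f : Perm D) : EmbeddedGraph D := G.withRot (f * G.opp)

@[simp]
theorem withNext_next (G : EmbeddedGraph D) (f : Perm D) : (G.withNext f).next = f := by
  have h := G.opp_mul_opp
  show f * G.opp * G.opp = f
  rw [mul_assoc, h, mul_one]

@[simp]
theorem withNext_opp (G : EmbeddedGraph D) (f : Perm D) : (G.withNext f).opp = G.opp := rfl

theorem withNext_withNext (G : EmbeddedGraph D) (f g : Perm D) :
    (G.withNext f).withNext g = G.withNext g := rfl

@[simp]
theorem withNext_self (G : EmbeddedGraph D) : G.withNext G.next = G := by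
  ext1 <;> simp

theorem isLeaf_iff (G : EmbeddedGraph D) (h : D) :
    G.IsLeaf h ↔ G.next h = G.opp h ∧ G.next (G.opp h) ≠ h := by
  simp [IsLeaf, rot_apply]

theorem isBoundingLoop_iff (G : EmbeddedGraph D) (h : D) :
    G.IsBoundingLoop h ↔ G.next h = h ∧ G.next (G.opp h) ≠ G.opp h := by
  simp [IsBoundingLoop, rot_apply]

theorem isGeneral_iff (G : EmbeddedGraph D) (h : D) :
    G.IsGeneral h ↔ G.next (G.opp h) ≠ h ∧ G.next h ≠ G.opp h ∧ G.next (G.opp h) ≠ G.opp h ∧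
      G.next h ≠ h := by
  simp [IsGeneral, rot_apply]

section Formulas

variable [DecidableEq D]

/-- The permutation by which the tilting of an edge with darts `h`, `o` that is neither a leaf nor
a bounding loop conjugates `f = Next`. -/
def edgeConj (f : Perm D) (h o : D) : Perm D :=
  swap (f⁻¹ o) o * swap (f⁻¹ h) h * swap h o

/-- The permutation by which the tilting of a leaf conjugates `f = Next`. -/
def leafConj (f : Perm D) (h o : D) : Perm D := swap h (f o) * swap (f o) o

/-- The permutation by which the tilting of a bounding loop conjugates `f = Next`. -/
def loopConj (f : Perm D) (o : D) : Perm D := swap o (f o)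

/-- Two diagonals of a polygon that differ by a rotation correspond to conjugate permutations. -/
theorem conj_insert_edge (f : Perm D) {h o w u : D} (hf : f h = o) (fo : f o = h)
    (hu : u ≠ h) (uo : u ≠ o) (hw : w ≠ h) (wo : w ≠ o) :
    (swap (f⁻¹ u) o * swap (f⁻¹ w) h * swap h o) * (swap u o * swap w h * f) *
      (swap (f⁻¹ u) o * swap (f⁻¹ w) h * swap h o)⁻¹ = swap (f⁻¹ u) o * swap (f⁻¹ w) h * f := by
  rw [mul_inv_eq_iff_eq_mul]
  have e1 : swap h o * swap u o = swap u h * swap h o := by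
    rw [mul_swap_eq_swap_mul, swap_apply_right, swap_apply_of_ne_of_ne hu uo]
  have e2 : swap h o * swap w h = swap w o * swap h o := by
    rw [mul_swap_eq_swap_mul, swap_apply_left, swap_apply_of_ne_of_ne hw wo]
  have e3 : f * (swap (f⁻¹ u) o * swap (f⁻¹ w) h * swap h o) =
      swap u h * swap w o * swap h o * f := by
    rw [← mul_assoc, ← mul_assoc, mul_swap_eq_swap_mul f, fo, mul_assoc (swap _ h),
      mul_swap_eq_swap_mul f, hf, ← mul_assoc, mul_assoc _ f, mul_swap_eq_swap_mul f, hf, fo]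
    simp [mul_assoc, swap_comm o h]
  calc _ = swap (f⁻¹ u) o * swap (f⁻¹ w) h * ((swap h o * swap u o) * swap w h * f) := by
        simp only [mul_assoc]
    _ = swap (f⁻¹ u) o * swap (f⁻¹ w) h * (swap u h * (swap h o * swap w h) * f) := by
        rw [e1]; simp only [mul_assoc]
    _ = swap (f⁻¹ u) o * swap (f⁻¹ w) h * (f * (swap (f⁻¹ u) o * swap (f⁻¹ w) h * swap h o)) := by
        rw [e2, e3]; simp only [mul_assoc]
    _ = _ := by simp only [mul_assoc]

/-- With the edge cut out, `next` becomes `ψ`, in which `h` and its opposite form a 2-cycle. The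
graph is `ψ` with a diagonal inserted before `f h` and `f o`, the tilted graph is `ψ` with the
diagonal inserted one step earlier, and `conj_insert_edge` says that these two differ by a
conjugation. -/
theorem shiftEdge_eq (G : EmbeddedGraph D) (h : D) (hg : G.IsGeneral h) :
    G.shiftEdge h = G.withNext (edgeConj G.next h (G.opp h) * G.next *
      (edgeConj G.next h (G.opp h))⁻¹) := by
  rw [isGeneral_iff] at hg
  obtain ⟨h1, h2, h3, h4⟩ := hg
  have hoh := G.opp_ne h
  set o := G.opp h with ho
  set f := G.next with hf
  set ψ : Perm D := swap o (f h) * swap h (f o) * f with hψ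
  have huw : f h ≠ f o := fun e => hoh (f.injective e).symm
  have k1 : ψ h = o := by
    simp [hψ, swap_apply_of_ne_of_ne h4 huw]
  have k2 : ψ o = h := by
    simp [hψ, swap_apply_of_ne_of_ne hoh.symm h4.symm]
  have k3 : ψ⁻¹ (f o) = f⁻¹ h := by
    rw [Perm.inv_eq_iff_eq]
    simp [hψ, swap_apply_of_ne_of_ne h3 huw.symm]
  have k4 : ψ⁻¹ (f h) = f⁻¹ o := by
    rw [Perm.inv_eq_iff_eq]
    simp [hψ, swap_apply_of_ne_of_ne hoh h3.symm]
  have k5 : f = swap (f h) o * swap (f o) h * ψ := by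
    have hc : swap (f h) o * swap (f o) h = swap (f o) h * swap (f h) o := by
      rw [mul_swap_eq_swap_mul, swap_apply_of_ne_of_ne huw.symm h3,
        swap_apply_of_ne_of_ne h4.symm hoh.symm]
    rw [hψ, hc, swap_comm o, swap_comm h]
    simp [mul_assoc]
  have key := conj_insert_edge ψ k1 k2 h4 h2 h1 h3
  rw [k3, k4, ← k5] at key
  unfold edgeConj
  rw [key]
  have hr : f o = G.rot h := by simp [hf, ho, rot_apply]
  have hr' : f h = G.rot o := by simp [hf, ho, rot_apply]
  unfold shiftEdge withNext
  congr 1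
  unfold attachBefore detach
  rw [← ho, ← hf, hψ, Perm.mul_apply (swap h (G.rot h)) G.rot o, ← hr', ← hr,
    swap_apply_of_ne_of_ne h4 huw, show G.rot = f * G.opp from G.rot_eq]
  simp [mul_assoc, Perm.inv_def]

/-- In the word of the face, the tilting turns `h, o, f o` into `f o, h, o`; this is the renaming
`leafConj` of three letters. -/
theorem shiftLeaf_eq (G : EmbeddedGraph D) (h : D) (hg : G.IsLeaf h) :
    G.shiftLeaf h = G.withNext (leafConj G.next h (G.opp h) * G.next *
      (leafConj G.next h (G.opp h))⁻¹) := by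
  rw [isLeaf_iff] at hg
  obtain ⟨h1, h2⟩ := hg
  have hoh := G.opp_ne h
  have hr : G.rot h = G.next (G.opp h) := G.rot_apply h
  unfold shiftLeaf withNext
  congr 1
  unfold attachAfter detach
  rw [hr, show G.rot = G.next * G.opp from G.rot_eq]
  set o := G.opp h with ho
  set f := G.next with hf
  unfold leafConj
  set s := f o with hs
  have e1 : f * G.opp * swap (G.opp s) h = f * swap s o * G.opp := by
    rw [mul_assoc, mul_swap_eq_swap_mul]; simp [mul_assoc, ho]
  have hso : s ≠ o := by
    intro e
    apply hoh
    exact f.injective (by rw [h1, ← hs, e])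
  have e2 : swap s o * f * swap s o * swap h s = f * swap s o := by
    have : swap s o * swap h s = swap h o * swap s o := by
      rw [mul_swap_eq_swap_mul, swap_apply_left, swap_apply_of_ne_of_ne h2.symm hoh.symm]
    rw [mul_assoc, this, ← mul_assoc, mul_assoc (swap s o), mul_swap_eq_swap_mul f, h1, ← hs,
      swap_comm o s]
    simp [← mul_assoc]
  rw [mul_assoc (swap h s), mul_assoc (swap h s), ← mul_assoc, ← mul_assoc, mul_inv_rev, swap_inv,
    swap_inv]
  calc swap h s * f * G.opp * swap (G.opp s) h = swap h s * (f * G.opp * swap (G.opp s) h) := by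
        simp only [mul_assoc]
    _ = swap h s * (swap s o * f * swap s o * swap h s) * G.opp := by
        rw [e1, e2]; simp only [mul_assoc]
    _ = _ := by simp only [mul_assoc]

/-- The dart `h` is a face by itself and stays one. In the other face the loop and its successor
trade places, which is the renaming by one transposition. -/
theorem shiftLoop_eq (G : EmbeddedGraph D) (h : D) (hg : G.IsBoundingLoop h) :
    G.shiftLoop h = G.withNext (loopConj G.next (G.opp h) * G.next *
      (loopConj G.next (G.opp h))⁻¹) := by
  rw [isBoundingLoop_iff] at hg
  obtain ⟨h1, h2⟩ := hg
  have hoh := G.opp_ne h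
  have hr : G.rot h = G.next (G.opp h) := G.rot_apply h
  unfold shiftLoop withNext
  congr 1
  unfold attachAfter detach
  have hr' : G.rot (G.opp h) = h := by simp [rot_apply, h1]
  rw [Perm.mul_apply, hr', hr, swap_apply_left, show G.rot = G.next * G.opp from G.rot_eq]
  set o := G.opp h with ho
  set f := G.next with hf
  unfold loopConj
  set s := f o with hs
  have hsh : s ≠ h := by
    intro e
    exact hoh (f.injective (by rw [h1, ← hs, e]))
  have e1 : G.opp * swap (G.opp s) o = swap s h * G.opp := by
    rw [mul_swap_eq_swap_mul]; simp [ho]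
  have e2 : G.opp * swap o h = swap h o * G.opp := by
    rw [mul_swap_eq_swap_mul]; simp [ho]
  have e3 : swap h s * f = f * swap h o := by
    rw [mul_swap_eq_swap_mul, h1]
  have e4 : swap h o * swap s h * swap h o = swap s o := by
    rw [mul_swap_eq_swap_mul (swap h o), swap_apply_left, swap_apply_of_ne_of_ne hsh h2, mul_assoc,
      swap_mul_self, mul_one]
  calc _ = swap o s * (swap h s * f) * (G.opp * swap (G.opp s) o) * swap o h := by
        simp only [mul_assoc]
    _ = swap o s * f * (swap h o * swap s h * swap h o) * G.opp := by
        rw [e3, e1, mul_assoc _ (swap s h * _), mul_assoc (swap s h), e2]; simp only [mul_assoc]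
    _ = _ := by rw [e4, swap_inv, swap_comm s o]

end Formulas

end EmbeddedGraph

/-! ### Isomorphisms and relabellings -/

namespace EmbeddedGraph

open Equiv Equiv.Perm

section Isomorphisms

variable {D D' D'' : Type*}

theorem isomorphic_iff {G : EmbeddedGraph D} {H : EmbeddedGraph D'} :
    G.Isomorphic H ↔
      ∃ e : D ≃ D', (∀ x, e (G.next x) = H.next (e x)) ∧ (∀ x, e (G.opp x) = H.opp (e x)) := by
  constructor
  · rintro ⟨e, h1, h2⟩
    exact ⟨e, fun x => by simp [next, h1, h2], h2⟩
  · rintro ⟨e, h1, h2⟩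
    exact ⟨e, fun x => by rw [rot_apply, rot_apply, h1, h2], h2⟩

theorem Isomorphic.refl (G : EmbeddedGraph D) : G.Isomorphic G :=
  ⟨Equiv.refl D, fun _ => rfl, fun _ => rfl⟩

theorem Isomorphic.symm {G : EmbeddedGraph D} {H : EmbeddedGraph D'} (h : G.Isomorphic H) :
    H.Isomorphic G := by
  obtain ⟨e, h1, h2⟩ := h
  exact ⟨e.symm, fun x => by rw [Equiv.symm_apply_eq, h1, e.apply_symm_apply],
    fun x => by rw [Equiv.symm_apply_eq, h2, e.apply_symm_apply]⟩

theorem Isomorphic.trans {G : EmbeddedGraph D} {H : EmbeddedGraph D'} {K : EmbeddedGraph D''}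
    (h : G.Isomorphic H) (k : H.Isomorphic K) : G.Isomorphic K := by
  obtain ⟨e, h1, h2⟩ := h
  obtain ⟨e', h1', h2'⟩ := k
  exact ⟨e.trans e', fun x => by simp [h1, h1'], fun x => by simp [h2, h2']⟩

/-- The image of an embedded graph under a bijection of the sets of darts. -/
def map (G : EmbeddedGraph D) (e : D ≃ D') : EmbeddedGraph D' where
  rot := e.permCongr G.rot
  opp := e.permCongr G.opp
  opp_opp x := by simp [Equiv.permCongr_apply]
  opp_ne x h := G.opp_ne (e.symm x) (e.injective (by simpa [Equiv.permCongr_apply] using h))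

theorem isomorphic_map (G : EmbeddedGraph D) (e : D ≃ D') : G.Isomorphic (G.map e) :=
  ⟨e, fun x => by simp [map], fun x => by simp [map]⟩

/-- Conjugation of `Next` by a permutation of the darts. -/
def conjNext (G : EmbeddedGraph D) (s : Perm D) : EmbeddedGraph D :=
  G.withNext (s * G.next * s⁻¹)

@[simp]
theorem conjNext_next (G : EmbeddedGraph D) (s : Perm D) :
    (G.conjNext s).next = s * G.next * s⁻¹ := by simp [conjNext]

@[simp]
theorem conjNext_opp (G : EmbeddedGraph D) (s : Perm D) : (G.conjNext s).opp = G.opp := rfl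

end Isomorphisms

/-! ### Reversibility of tiltings -/

section Tilting

variable {D : Type*} [DecidableEq D]

theorem tilting_edge (G : EmbeddedGraph D) (h : D) (h1 : G.next (G.opp h) ≠ h)
    (h2 : G.next h ≠ G.opp h) (h3 : G.next (G.opp h) ≠ G.opp h) (h4 : G.next h ≠ h) :
    Tilting G (G.conjNext (edgeConj G.next h (G.opp h))) := by
  have hg : G.IsGeneral h := (isGeneral_iff G h).2 ⟨h1, h2, h3, h4⟩
  have := Tilting.general h hg
  rwa [shiftEdge_eq G h hg] at this

theorem tilting_leaf (G : EmbeddedGraph D) (h : D) (h1 : G.next h = G.opp h)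
    (h2 : G.next (G.opp h) ≠ h) :
    Tilting G (G.conjNext (leafConj G.next h (G.opp h))) := by
  have hg : G.IsLeaf h := (isLeaf_iff G h).2 ⟨h1, h2⟩
  have := Tilting.leaf h hg
  rwa [shiftLeaf_eq G h hg] at this

theorem tilting_loop (G : EmbeddedGraph D) (h : D) (h1 : G.next h = h)
    (h2 : G.next (G.opp h) ≠ G.opp h) :
    Tilting G (G.conjNext (loopConj G.next (G.opp h))) := by
  have hg : G.IsBoundingLoop h := (isBoundingLoop_iff G h).2 ⟨h1, h2⟩
  have := Tilting.loop h hg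
  rwa [shiftLoop_eq G h hg] at this

theorem Tilting.elim {G H : EmbeddedGraph D} (ht : Tilting G H) {p : EmbeddedGraph D → Prop}
    (edge : ∀ h, G.next (G.opp h) ≠ h → G.next h ≠ G.opp h → G.next (G.opp h) ≠ G.opp h →
      G.next h ≠ h → p (G.conjNext (edgeConj G.next h (G.opp h))))
    (leaf : ∀ h, G.next h = G.opp h → G.next (G.opp h) ≠ h →
      p (G.conjNext (leafConj G.next h (G.opp h))))
    (loop : ∀ h, G.next h = h → G.next (G.opp h) ≠ G.opp h →
      p (G.conjNext (loopConj G.next (G.opp h)))) : p H := by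
  cases ht with
  | leaf h hg =>
    rw [shiftLeaf_eq G h hg]
    rw [isLeaf_iff] at hg
    exact leaf h hg.1 hg.2
  | loop h hg =>
    rw [shiftLoop_eq G h hg]
    rw [isBoundingLoop_iff] at hg
    exact loop h hg.1 hg.2
  | general h hg =>
    rw [shiftEdge_eq G h hg]
    rw [isGeneral_iff] at hg
    exact edge h hg.1 hg.2.1 hg.2.2.1 hg.2.2.2

/-- In face words: `f⁻¹ h, h` becomes `h, f⁻¹ o`, and `f⁻¹ o, o` becomes `o, f⁻¹ h`. The edge moves
back one place on each side and the two preceding darts change faces. -/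
theorem edgeConj_facts {f : Perm D} {h o : D} (hoh : o ≠ h) (h1 : f o ≠ h) (h2 : f h ≠ o)
    (h3 : f o ≠ o) (h4 : f h ≠ h) :
    edgeConj f h o h = f⁻¹ o ∧ edgeConj f h o o = f⁻¹ h ∧ edgeConj f h o (f⁻¹ h) = h ∧
      edgeConj f h o (f⁻¹ o) = o := by
  have a1 : f⁻¹ h ≠ h := fun e => h4 (by rw [Perm.inv_eq_iff_eq] at e; exact e.symm)
  have a2 : f⁻¹ h ≠ o := fun e => h1 (by rw [Perm.inv_eq_iff_eq] at e; exact e.symm)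
  have a3 : f⁻¹ o ≠ h := fun e => h2 (by rw [Perm.inv_eq_iff_eq] at e; exact e.symm)
  have a4 : f⁻¹ o ≠ o := fun e => h3 (by rw [Perm.inv_eq_iff_eq] at e; exact e.symm)
  have a5 : f⁻¹ h ≠ f⁻¹ o := fun e => hoh (f⁻¹.injective e).symm
  simp only [edgeConj, Perm.mul_apply]
  refine ⟨?_, ?_, ?_, ?_⟩
  · rw [swap_apply_left, swap_apply_of_ne_of_ne a2.symm hoh, swap_apply_right]
  · rw [swap_apply_right, swap_apply_right, swap_apply_of_ne_of_ne a5 a2]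
  · rw [swap_apply_of_ne_of_ne a1 a2, swap_apply_left, swap_apply_of_ne_of_ne a3.symm hoh.symm]
  · rw [swap_apply_of_ne_of_ne a3 a4, swap_apply_of_ne_of_ne a5.symm a3, swap_apply_left]

theorem edgeConj_apply_of_ne {f : Perm D} {h o x : D} (h1 : x ≠ h) (h2 : x ≠ o)
    (h3 : x ≠ f⁻¹ h) (h4 : x ≠ f⁻¹ o) : edgeConj f h o x = x := by
  simp only [edgeConj, Perm.mul_apply]
  rw [swap_apply_of_ne_of_ne h1 h2, swap_apply_of_ne_of_ne h3 h1, swap_apply_of_ne_of_ne h4 h2]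

theorem leafConj_facts {f : Perm D} {h o : D} (hoh : o ≠ h) (h1 : f h = o) (h2 : f o ≠ h) :
    leafConj f h o h = f o ∧ leafConj f h o (f o) = o ∧ leafConj f h o o = h := by
  have a : f o ≠ o := fun e => hoh (f.injective (by rw [h1, e]))
  simp only [leafConj, Perm.mul_apply]
  refine ⟨?_, ?_, ?_⟩
  · rw [swap_apply_of_ne_of_ne h2.symm hoh.symm, swap_apply_left]
  · rw [swap_apply_left, swap_apply_of_ne_of_ne hoh a.symm]
  · rw [swap_apply_right, swap_apply_right]

theorem leafConj_apply_of_ne {f : Perm D} {h o x : D} (h1 : x ≠ h) (h2 : x ≠ o)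
    (h3 : x ≠ f o) : leafConj f h o x = x := by
  simp only [leafConj, Perm.mul_apply]
  rw [swap_apply_of_ne_of_ne h3 h2, swap_apply_of_ne_of_ne h1 h3]

theorem loopConj_apply_of_ne {f : Perm D} {o x : D} (h2 : x ≠ o)
    (h3 : x ≠ f o) : loopConj f o x = x := by
  simp only [loopConj]
  rw [swap_apply_of_ne_of_ne h2 h3]

/-- A family of moves given by an injective map of a finite set to itself is reversible. -/
theorem reflTransGen_of_injOn {α : Type*} [Finite α] {r : α → α → Prop} (p : α → Prop) (f : α → α)
    (hp : ∀ a, p a → p (f a)) (hi : ∀ a b, p a → p b → f a = f b → a = b)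
    (hr : ∀ a, p a → r a (f a)) {a : α} (ha : p a) : Relation.ReflTransGen r (f a) a := by
  let g : {a // p a} → {a // p a} := fun a => ⟨f a, hp a a.2⟩
  have hg : Function.Injective g := fun x y h =>
    Subtype.ext (hi x y x.2 y.2 (congrArg Subtype.val h))
  have key : ∀ (n : ℕ) (b : {a // p a}), Relation.ReflTransGen r b.1 (g^[n] b).1 := by
    intro n
    induction n with
    | zero => exact fun b => Relation.ReflTransGen.refl
    | succ n ih =>
      intro b
      rw [Function.iterate_succ_apply]
      exact Relation.ReflTransGen.head (hr b b.2) (ih (g b))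
  obtain ⟨n, hn, hx⟩ := hg.mem_periodicPts ⟨a, ha⟩
  obtain ⟨n, rfl⟩ := Nat.exists_eq_succ_of_ne_zero hn.ne'
  have h1 := key n (g ⟨a, ha⟩)
  rw [← Function.iterate_succ_apply, hx.eq] at h1
  exact h1

instance [Finite D] : Finite (EmbeddedGraph D) :=
  Finite.of_injective (fun G : EmbeddedGraph D => (G.rot, G.opp)) (by
    rintro ⟨r, o, _, _⟩ ⟨r', o', _, _⟩ h
    simp_all)

/-- For a fixed dart `h`, the tilting at `h` maps the finite set of graphs in which `h` has a given
type into itself, and the old graph can be read off the new one. An injective self-map of a finite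
set is undone by one of its iterates. -/
theorem Tilting.reverse [Finite D] {G H : EmbeddedGraph D} (ht : Tilting G H) :
    Relation.ReflTransGen Tilting H G := by
  revert ht
  intro ht
  apply ht.elim (p := fun H => Relation.ReflTransGen Tilting H G)
  · intro h h1 h2 h3 h4
    refine reflTransGen_of_injOn (fun K : EmbeddedGraph D => K.next (K.opp h) ≠ h ∧
      K.next h ≠ K.opp h ∧ K.next (K.opp h) ≠ K.opp h ∧ K.next h ≠ h)
      (fun K => K.conjNext (edgeConj K.next h (K.opp h))) ?_ ?_ ?_ ⟨h1, h2, h3, h4⟩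
    · rintro K ⟨h1, h2, h3, h4⟩
      have hoh := K.opp_ne h
      obtain ⟨f1, f2, f3, f4⟩ := edgeConj_facts hoh h1 h2 h3 h4
      have g1 : (edgeConj K.next h (K.opp h))⁻¹ h = K.next⁻¹ h := by
        rw [Perm.inv_eq_iff_eq, f3]
      have g2 : (edgeConj K.next h (K.opp h))⁻¹ (K.opp h) = K.next⁻¹ (K.opp h) := by
        rw [Perm.inv_eq_iff_eq, f4]
      simp only [conjNext_next, conjNext_opp, Perm.mul_apply, g1, g2, apply_inv_self, f1, f2,
        ne_eq, Perm.inv_eq_iff_eq]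
      exact ⟨fun e => h4 e.symm, fun e => h3 e.symm, fun e => h1 e.symm, fun e => h2 e.symm⟩
    · rintro K L ⟨h1, h2, h3, h4⟩ ⟨k1, k2, k3, k4⟩ he
      have ho : K.opp = L.opp := by
        have := congrArg EmbeddedGraph.opp he
        exact this
      have hn := congrArg EmbeddedGraph.next he
      rw [← ho] at k1 k2 k3 hn
      have hoh := K.opp_ne h
      obtain ⟨f1, f2, f3, f4⟩ := edgeConj_facts hoh h1 h2 h3 h4
      obtain ⟨f1', f2', f3', f4'⟩ := edgeConj_facts hoh k1 k2 k3 k4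
      have g1 : (edgeConj K.next h (K.opp h))⁻¹ h = K.next⁻¹ h := by
        rw [Perm.inv_eq_iff_eq, f3]
      have g2 : (edgeConj K.next h (K.opp h))⁻¹ (K.opp h) = K.next⁻¹ (K.opp h) := by
        rw [Perm.inv_eq_iff_eq, f4]
      have g1' : (edgeConj L.next h (K.opp h))⁻¹ h = L.next⁻¹ h := by
        rw [Perm.inv_eq_iff_eq, f3']
      have g2' : (edgeConj L.next h (K.opp h))⁻¹ (K.opp h) = L.next⁻¹ (K.opp h) := by
        rw [Perm.inv_eq_iff_eq, f4']
      simp only [conjNext_next] at hn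
      -- The new `next` sends `h` and its opposite to the old predecessors of the opposite and of
      -- `h`. These two darts determine `edgeConj`, hence the old graph.
      have e1 := congrArg (fun f : Perm D => f h) hn
      have e2 := congrArg (fun f : Perm D => f (K.opp h)) hn
      simp only [Perm.mul_apply, g1, g2, g1', g2', apply_inv_self, f1, f2, f1', f2'] at e1 e2
      have e3 : edgeConj K.next h (K.opp h) = edgeConj L.next h (K.opp h) := by
        simp only [edgeConj, e1, e2]
      rw [e3] at hn
      exact ext_next (by simpa using hn) ho
    · rintro K ⟨h1, h2, h3, h4⟩
      exact tilting_edge K h h1 h2 h3 h4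
  · intro h h1 h2
    refine reflTransGen_of_injOn (fun K : EmbeddedGraph D => K.next h = K.opp h ∧
      K.next (K.opp h) ≠ h)
      (fun K => K.conjNext (leafConj K.next h (K.opp h))) ?_ ?_ ?_ ⟨h1, h2⟩
    · rintro K ⟨h1, h2⟩
      obtain ⟨f1, f2, f3⟩ := leafConj_facts (K.opp_ne h) h1 h2
      have g1 : (leafConj K.next h (K.opp h))⁻¹ h = K.opp h := by
        rw [Perm.inv_eq_iff_eq, f3]
      have g2 : (leafConj K.next h (K.opp h))⁻¹ (K.opp h) = K.next (K.opp h) := by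
        rw [Perm.inv_eq_iff_eq, f2]
      simp only [conjNext_next, conjNext_opp, Perm.mul_apply, g1, g2, f2, true_and]
      intro e
      rw [← Perm.eq_inv_iff_eq, g1] at e
      have := K.next.injective (e.trans h1.symm)
      exact h2 this
    · rintro K L ⟨h1, h2⟩ ⟨k1, k2⟩ he
      have ho : K.opp = L.opp := by
        have := congrArg EmbeddedGraph.opp he
        exact this
      have hn := congrArg EmbeddedGraph.next he
      rw [← ho] at k1 k2 hn
      obtain ⟨f1, f2, f3⟩ := leafConj_facts (K.opp_ne h) h1 h2
      obtain ⟨f1', f2', f3'⟩ := leafConj_facts (K.opp_ne h) k1 k2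
      simp only [conjNext_next] at hn
      -- The old successor of the dangling end is the dart that the new `next` sends to `h`, and it
      -- determines `leafConj`.
      have e1 : (leafConj K.next h (K.opp h) * K.next * (leafConj K.next h (K.opp h))⁻¹)
          (K.next (K.opp h)) = h := by
        have : (leafConj K.next h (K.opp h))⁻¹ (K.next (K.opp h)) = h := by
          rw [Perm.inv_eq_iff_eq, f1]
        simp only [Perm.mul_apply, this, h1, f3]
      have e2 : (leafConj L.next h (K.opp h) * L.next * (leafConj L.next h (K.opp h))⁻¹)
          (L.next (K.opp h)) = h := by
        have : (leafConj L.next h (K.opp h))⁻¹ (L.next (K.opp h)) = h := by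
          rw [Perm.inv_eq_iff_eq, f1']
        simp only [Perm.mul_apply, this, k1, f3']
      rw [hn] at e1
      have e4 := Equiv.injective _ (e1.trans e2.symm)
      have e3 : leafConj K.next h (K.opp h) = leafConj L.next h (K.opp h) := by
        simp only [leafConj, e4]
      rw [e3] at hn
      exact ext_next (by simpa using hn) ho
    · rintro K ⟨h1, h2⟩
      exact tilting_leaf K h h1 h2
  · intro h h1 h2
    refine reflTransGen_of_injOn (fun K : EmbeddedGraph D => K.next h = h ∧
      K.next (K.opp h) ≠ K.opp h)
      (fun K => K.conjNext (loopConj K.next (K.opp h))) ?_ ?_ ?_ ⟨h1, h2⟩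
    · rintro K ⟨h1, h2⟩
      have hs : K.next (K.opp h) ≠ h := fun e => K.opp_ne h (K.next.injective (e.trans h1.symm))
      have g1 : (loopConj K.next (K.opp h)) h = h :=
        loopConj_apply_of_ne (K.opp_ne h).symm hs.symm
      have g2 : (loopConj K.next (K.opp h))⁻¹ h = h := by
        rw [Perm.inv_eq_iff_eq, g1]
      simp only [conjNext_next, conjNext_opp, Perm.mul_apply, g1, g2, h1, true_and]
      simp only [loopConj, swap_inv, swap_apply_left]
      intro e
      rw [swap_apply_eq_iff, swap_apply_left] at e
      exact h2 (K.next.injective e)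
    · rintro K L ⟨h1, h2⟩ ⟨k1, k2⟩ he
      have ho : K.opp = L.opp := by
        have := congrArg EmbeddedGraph.opp he
        exact this
      have hn := congrArg EmbeddedGraph.next he
      rw [← ho] at k2 hn
      simp only [conjNext_next] at hn
      have e1 : (loopConj K.next (K.opp h) * K.next * (loopConj K.next (K.opp h))⁻¹)
          (K.next (K.opp h)) = K.opp h := by
        simp [loopConj]
      have e2 : (loopConj L.next (K.opp h) * L.next * (loopConj L.next (K.opp h))⁻¹)
          (L.next (K.opp h)) = K.opp h := by
        simp [loopConj]
      rw [hn] at e1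
      have e4 := Equiv.injective _ (e1.trans e2.symm)
      have e3 : loopConj K.next (K.opp h) = loopConj L.next (K.opp h) := by
        simp only [loopConj, e4]
      rw [e3] at hn
      exact ext_next (by simpa using hn) ho
    · rintro K ⟨h1, h2⟩
      exact tilting_loop K h h1 h2

theorem reflTransGen_tilting_symm [Finite D] {G H : EmbeddedGraph D}
    (h : Relation.ReflTransGen Tilting G H) : Relation.ReflTransGen Tilting H G := by
  induction h with
  | refl => exact Relation.ReflTransGen.refl
  | tail _ h ih => exact h.reverse.trans ih

end Tilting

/-! ### Obtainability is an equivalence relation -/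

section Obtainable

variable {D D' D'' : Type*} [DecidableEq D] [DecidableEq D'] [DecidableEq D'']

omit [DecidableEq D] [DecidableEq D'] in
theorem isomorphic_conjNext {G : EmbeddedGraph D} {H : EmbeddedGraph D'} (e : D ≃ D')
    (h1 : ∀ x, e (G.next x) = H.next (e x)) (h2 : ∀ x, e (G.opp x) = H.opp (e x))
    {s : Perm D} {t : Perm D'} (hs : ∀ x, e (s x) = t (e x)) :
    (G.conjNext s).Isomorphic (H.conjNext t) := by
  refine isomorphic_iff.2 ⟨e, fun x => ?_, fun x => by simp [h2]⟩
  obtain ⟨y, rfl⟩ := s.surjective x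
  simp [hs, h1]

theorem apply_swap_apply (e : D ≃ D') (a b x : D) :
    e (swap a b x) = swap (e a) (e b) (e x) := by
  simp only [swap_apply_def, e.injective.eq_iff]
  split_ifs <;> rfl

theorem Tilting.of_isomorphic {G : EmbeddedGraph D} {H H' : EmbeddedGraph D'}
    (hi : G.Isomorphic H) (ht : Tilting H H') : ∃ G', Tilting G G' ∧ G'.Isomorphic H' := by
  obtain ⟨e, h1, h2⟩ := isomorphic_iff.1 hi
  have h3 : ∀ x, e (G.next⁻¹ x) = H.next⁻¹ (e x) := fun x => by
    rw [Perm.eq_inv_iff_eq, ← h1, apply_inv_self]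
  have hsw := apply_swap_apply e
  apply ht.elim (p := fun H' => ∃ G', Tilting G G' ∧ G'.Isomorphic H')
  · intro h
    obtain ⟨h, rfl⟩ := e.surjective h
    rw [← h2, ← h1, ← h1]
    simp only [ne_eq, e.injective.eq_iff]
    intro a b c d
    exact ⟨_, tilting_edge G h a b c d, isomorphic_conjNext e h1 h2 fun x => by
      simp only [edgeConj, Perm.mul_apply, hsw, h3]⟩
  · intro h
    obtain ⟨h, rfl⟩ := e.surjective h
    rw [← h2, ← h1, ← h1]
    simp only [ne_eq, e.injective.eq_iff]
    intro a b
    exact ⟨_, tilting_leaf G h a b, isomorphic_conjNext e h1 h2 fun x => by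
      simp only [leafConj, Perm.mul_apply, hsw, h1]⟩
  · intro h
    obtain ⟨h, rfl⟩ := e.surjective h
    rw [← h2, ← h1, ← h1]
    simp only [ne_eq, e.injective.eq_iff]
    intro a b
    exact ⟨_, tilting_loop G h a b, isomorphic_conjNext e h1 h2 fun x => by
      simp only [loopConj, hsw, h1]⟩

theorem reflTransGen_tilting_of_isomorphic {G : EmbeddedGraph D} {H H' : EmbeddedGraph D'}
    (hi : G.Isomorphic H) (ht : Relation.ReflTransGen Tilting H H') :
    ∃ G', Relation.ReflTransGen Tilting G G' ∧ G'.Isomorphic H' := by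
  induction ht with
  | refl => exact ⟨G, Relation.ReflTransGen.refl, hi⟩
  | tail _ h ih =>
    obtain ⟨K, hK, hi'⟩ := ih
    obtain ⟨L, hL, hi''⟩ := h.of_isomorphic hi'
    exact ⟨L, hK.tail hL, hi''⟩

omit [DecidableEq D'] [DecidableEq D''] in
theorem Isomorphic.obtainable {G : EmbeddedGraph D} {H : EmbeddedGraph D'} (h : G.Isomorphic H) :
    H.ObtainableFrom G := ⟨G, Relation.ReflTransGen.refl, h⟩

theorem Tilting.obtainable {G H : EmbeddedGraph D} (h : Tilting G H) :
    H.ObtainableFrom G := ⟨H, Relation.ReflTransGen.single h, Isomorphic.refl H⟩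

theorem ObtainableFrom.refl (G : EmbeddedGraph D) : G.ObtainableFrom G :=
  (Isomorphic.refl G).obtainable

omit [DecidableEq D''] in
theorem ObtainableFrom.trans {G : EmbeddedGraph D} {H : EmbeddedGraph D'} {K : EmbeddedGraph D''}
    (h1 : H.ObtainableFrom G) (h2 : K.ObtainableFrom H) : K.ObtainableFrom G := by
  obtain ⟨G', hG, iG⟩ := h1
  obtain ⟨H', hH, iH⟩ := h2
  obtain ⟨G'', hG', iG'⟩ := reflTransGen_tilting_of_isomorphic iG hH
  exact ⟨G'', hG.trans hG', iG'.trans iH⟩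

theorem ObtainableFrom.symm [Finite D] {G : EmbeddedGraph D} {H : EmbeddedGraph D'}
    (h : H.ObtainableFrom G) : G.ObtainableFrom H := by
  obtain ⟨G', hG, iG⟩ := h
  exact reflTransGen_tilting_of_isomorphic iG.symm (reflTransGen_tilting_symm hG)

end Obtainable

end EmbeddedGraph

/-! ### Isolated edges and rotation of an inserted diagonal -/

namespace EmbeddedGraph

open Equiv Equiv.Perm Function

variable {D : Type*}

/-- The edge of `h` is a connected component with a single face. -/
def IsIsolated (K : EmbeddedGraph D) (h : D) : Prop :=
  K.next h = K.opp h ∧ K.next (K.opp h) = h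

/-- The dart `x` does not belong to the edge of `h`. -/
def Off (K : EmbeddedGraph D) (h x : D) : Prop := x ≠ h ∧ x ≠ K.opp h

theorem Off.opp {K : EmbeddedGraph D} {h x : D} (hx : K.Off h x) : K.Off h (K.opp x) :=
  ⟨fun e => hx.2 (by rw [← e, K.opp_opp]), fun e => hx.1 (K.opp.injective e)⟩

theorem IsIsolated.off_next_iff {K : EmbeddedGraph D} {h x : D} (hK : K.IsIsolated h) :
    K.Off h (K.next x) ↔ K.Off h x := by
  obtain ⟨h1, h2⟩ := hK
  unfold Off
  nth_rewrite 1 [← h2]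
  rw [← h1, K.next.injective.ne_iff, K.next.injective.ne_iff, h1]
  exact and_comm

theorem IsIsolated.off_inv_iff {K : EmbeddedGraph D} {h x : D} (hK : K.IsIsolated h) :
    K.Off h (K.next⁻¹ x) ↔ K.Off h x := by
  rw [← hK.off_next_iff, apply_inv_self]

theorem IsIsolated.off_pow_iff {K : EmbeddedGraph D} {h x : D} (hK : K.IsIsolated h) (n : ℕ) :
    K.Off h ((K.next ^ n) x) ↔ K.Off h x := by
  induction n with
  | zero => rfl
  | succ n ih => rw [pow_succ', Perm.mul_apply, hK.off_next_iff, ih]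

section

variable [DecidableEq D]

/-- Draw the isolated edge of `h` as a diagonal of the face of `u`, so that the side of `h` takes
the `k` darts from `u` on. -/
def insertEdge (K : EmbeddedGraph D) (h : D) (k : ℕ) (u : D) : EmbeddedGraph D :=
  K.withNext (swap u (K.opp h) * swap ((K.next ^ k) u) h * K.next)

/-- Hang the isolated edge of `h` as a leaf before `u`. -/
def insertLeaf (K : EmbeddedGraph D) (h u : D) : EmbeddedGraph D :=
  K.withNext (swap u h * K.next)

variable {K : EmbeddedGraph D} {h : D}

/-- Distinct ends make the diagonal an edge of type 3, and `conj_insert_edge` computes its tilting: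
both ends recede by one dart. -/
theorem insertEdge_rotate_back (hK : K.IsIsolated h) (k : ℕ) {u : D} (hu : K.Off h u)
    (hku : (K.next ^ k) u ≠ u) :
    Tilting (K.insertEdge h k u) (K.insertEdge h k (K.next⁻¹ u)) := by
  have hw := (hK.off_pow_iff k).2 hu
  have hoh := K.opp_ne h
  have hs : (K.next ^ k) (K.next⁻¹ u) = K.next⁻¹ ((K.next ^ k) u) := by
    rw [← Perm.mul_apply, ← Perm.mul_apply, ((Commute.refl K.next).pow_left k).inv_right.eq]
  obtain ⟨h1, h2⟩ := hK
  have key := conj_insert_edge K.next h1 h2 hu.1 hu.2 hw.1 hw.2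
  unfold insertEdge
  rw [hs]
  set w := (K.next ^ k) u with hwd
  set o := K.opp h with ho
  set f : Perm D := swap u o * swap w h * K.next with hf
  have f1 : f h = u := by
    simp only [hf, Perm.mul_apply]
    rw [h1, swap_apply_of_ne_of_ne hw.2.symm hoh, swap_apply_right]
  have f2 : f o = w := by
    simp only [hf, Perm.mul_apply]
    rw [h2, swap_apply_right, swap_apply_of_ne_of_ne hku hw.2]
  have f3 : f⁻¹ h = K.next⁻¹ w := by
    rw [Perm.inv_eq_iff_eq]
    simp only [hf, Perm.mul_apply]
    rw [apply_inv_self, swap_apply_left, swap_apply_of_ne_of_ne hu.1.symm hoh.symm]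
  have f4 : f⁻¹ o = K.next⁻¹ u := by
    rw [Perm.inv_eq_iff_eq]
    simp only [hf, Perm.mul_apply]
    rw [apply_inv_self, swap_apply_of_ne_of_ne hku.symm hu.1, swap_apply_left]
  have := tilting_edge (K.withNext f) h (by simpa [← ho, f2] using hw.1)
    (by simpa [← ho, f1] using hu.2) (by simpa [← ho, f2] using hw.2) (by simpa [f1] using hu.1)
  unfold conjNext edgeConj at this
  simp only [withNext_next, withNext_opp, ← ho, f3, f4] at this
  rw [hf, key] at this
  exact this

/-- If both ends are inserted before the same dart, `K.opp h` becomes a fixed point of `next`. The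
edge is then a bounding loop, to which type 2 applies with the opposite dart in the role of `h`;
this moves it forwards. -/
theorem insertEdge_rotate_loop (hK : K.IsIsolated h) (k : ℕ) {u : D} (hu : K.Off h u)
    (hku : (K.next ^ k) u = u) :
    Tilting (K.insertEdge h k u) (K.insertEdge h k (K.next u)) := by
  have hoh := K.opp_ne h
  have hs : (K.next ^ k) (K.next u) = K.next u := by
    rw [← Perm.mul_apply, ((Commute.refl K.next).pow_left k).eq, Perm.mul_apply, hku]
  have hv := hK.off_next_iff.2 hu
  obtain ⟨h1, h2⟩ := hK
  unfold insertEdge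
  rw [hs, hku]
  set o := K.opp h with ho
  have hho : K.opp o = h := K.opp_opp h
  set f : Perm D := swap u o * swap u h * K.next with hf
  have f1 : f h = u := by
    simp only [hf, Perm.mul_apply]
    rw [h1, swap_apply_of_ne_of_ne hu.2.symm hoh, swap_apply_right]
  have f2 : f o = o := by
    simp only [hf, Perm.mul_apply]
    rw [h2, swap_apply_right, swap_apply_left]
  have := tilting_loop (K.withNext f) o (by simpa using f2)
    (by simpa [hho, f1] using hu.1)
  unfold conjNext loopConj at this
  simp only [withNext_next, withNext_opp, hho, f1] at this
  convert this using 1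
  rw [withNext_withNext]
  congr 1
  rw [eq_mul_inv_iff_mul_eq, mul_assoc, mul_swap_eq_swap_mul K.next, h1, hf, swap_comm o]
  have e1 : swap h u * (swap u o * swap u h) = swap h o := by
    rw [← mul_assoc, mul_swap_eq_swap_mul (swap h u), swap_apply_right,
      swap_apply_of_ne_of_ne hoh hu.2.symm, mul_assoc, swap_comm h u, swap_mul_self, mul_one]
  have e2 : swap (K.next u) o * swap (K.next u) h * swap (K.next u) o = swap h o := by
    rw [mul_swap_eq_swap_mul (swap (K.next u) o), swap_apply_left,
      swap_apply_of_ne_of_ne hv.1.symm hoh.symm, mul_assoc, swap_mul_self, mul_one, swap_comm]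
  rw [← mul_assoc, ← mul_assoc (swap h u), e1, e2]

/-- One step of rotation suffices. The two types of tilting rotate in opposite senses, and
reversibility turns the backward step into a forward one. -/
theorem insertEdge_of_sameCycle [Finite D] (hK : K.IsIsolated h) (k : ℕ) {u v : D}
    (hu : K.Off h u) (huv : K.next.SameCycle u v) :
    (K.insertEdge h k v).ObtainableFrom (K.insertEdge h k u) := by
  have step : ∀ u, K.Off h u →
      (K.insertEdge h k (K.next u)).ObtainableFrom (K.insertEdge h k u) := by
    intro u hu
    by_cases hku : (K.next ^ k) u = u
    · exact (insertEdge_rotate_loop hK k hu hku).obtainable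
    · have := insertEdge_rotate_back hK k (hK.off_next_iff.2 hu) (fun e => hku (by
        rw [← Perm.mul_apply, ((Commute.refl K.next).pow_left k).eq, Perm.mul_apply] at e
        exact K.next.injective e))
      rw [inv_apply_self] at this
      exact this.obtainable.symm
  obtain ⟨i, -, -, rfl⟩ := huv.exists_pow_eq'
  clear huv
  induction i with
  | zero => exact ObtainableFrom.refl _
  | succ n ih =>
    rw [pow_succ', Perm.mul_apply]
    exact ih.trans (step _ ((hK.off_pow_iff n).2 hu))

end

end EmbeddedGraph

/-! ### Tiltings that do not interfere with the inserted edge -/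

namespace EmbeddedGraph

open Equiv Equiv.Perm Function

variable {D : Type*} [DecidableEq D] {K : EmbeddedGraph D} {h : D}

@[simp]
theorem insertEdge_opp (k : ℕ) (u : D) : (K.insertEdge h k u).opp = K.opp := rfl

@[simp]
theorem insertLeaf_opp (u : D) : (K.insertLeaf h u).opp = K.opp := rfl

theorem insertEdge_next (k : ℕ) (u : D) : (K.insertEdge h k u).next =
    swap u (K.opp h) * swap ((K.next ^ k) u) h * K.next := withNext_next _ _

theorem insertLeaf_next (u : D) : (K.insertLeaf h u).next = swap u h * K.next :=
  withNext_next _ _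

theorem insertEdge_next_apply {k : ℕ} {u x y : D} (hx : K.next x = y) (hy : K.Off h y)
    (h1 : y ≠ u) (h2 : y ≠ (K.next ^ k) u) : (K.insertEdge h k u).next x = y := by
  rw [insertEdge_next, Perm.mul_apply, Perm.mul_apply, hx, swap_apply_of_ne_of_ne h2 hy.1,
    swap_apply_of_ne_of_ne h1 hy.2]

theorem insertLeaf_next_apply {u x y : D} (hx : K.next x = y) (hy : K.Off h y)
    (h1 : y ≠ u) : (K.insertLeaf h u).next x = y := by
  rw [insertLeaf_next, Perm.mul_apply, hx, swap_apply_of_ne_of_ne h1 hy.1]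

theorem insertEdge_conjNext {s : Perm D} (k : ℕ) (u : D) (h1 : s h = h)
    (h2 : s (K.opp h) = K.opp h) :
    (K.insertEdge h k u).conjNext s = (K.conjNext s).insertEdge h k (s u) := by
  ext1
  · rw [conjNext_next, insertEdge_next, insertEdge_next, conjNext_next, conjNext_opp,
      conj_pow, Perm.mul_apply _ s⁻¹, inv_apply_self, Perm.mul_apply, mul_inv_eq_iff_eq_mul,
      ← mul_assoc, ← mul_assoc, mul_swap_eq_swap_mul s, mul_assoc _ s, mul_swap_eq_swap_mul s,
      h1, h2]
    simp only [mul_assoc, inv_mul_cancel, mul_one]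
  · rfl

theorem insertLeaf_conjNext {s : Perm D} (u : D) (h1 : s h = h) :
    (K.insertLeaf h u).conjNext s = (K.conjNext s).insertLeaf h (s u) := by
  ext1
  · rw [conjNext_next, insertLeaf_next, insertLeaf_next, conjNext_next, mul_inv_eq_iff_eq_mul,
      ← mul_assoc, mul_swap_eq_swap_mul s, h1]
    simp only [mul_assoc, inv_mul_cancel, mul_one]
  · rfl

/-- A tilting of the component away from the isolated edge of `h`, together with the darts before
which that edge must not be attached. -/
structure TiltingOff (K : EmbeddedGraph D) (h : D) (s : Perm D) (a b : D) : Prop where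
  fix_left : s h = h
  fix_right : s (K.opp h) = K.opp h
  edge : ∀ k u, K.Off h u → u ≠ a → u ≠ b → (K.next ^ k) u ≠ a → (K.next ^ k) u ≠ b →
    Tilting (K.insertEdge h k u) ((K.conjNext s).insertEdge h k (s u))
  leaf : ∀ u, K.Off h u → u ≠ a → u ≠ b →
    Tilting (K.insertLeaf h u) ((K.conjNext s).insertLeaf h (s u))

/-- The conjugating permutation depends only on the predecessors of `g` and `K.opp g`. Inserting an
edge alters a predecessor only at the darts before which its ends are placed, so these two darts are
the only ones to avoid. -/
theorem tiltingOff_edge (hK : K.IsIsolated h) {g : D} (hg : K.Off h g)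
    (h1 : K.next (K.opp g) ≠ g) (h2 : K.next g ≠ K.opp g) (h3 : K.next (K.opp g) ≠ K.opp g)
    (h4 : K.next g ≠ g) :
    K.TiltingOff h (edgeConj K.next g (K.opp g)) g (K.opp g) := by
  have b1 := hK.off_inv_iff.2 hg
  have b2 := hK.off_inv_iff.2 hg.opp
  have fl : edgeConj K.next g (K.opp g) h = h :=
    edgeConj_apply_of_ne hg.1.symm hg.opp.1.symm b1.1.symm b2.1.symm
  have fr : edgeConj K.next g (K.opp g) (K.opp h) = K.opp h :=
    edgeConj_apply_of_ne hg.2.symm hg.opp.2.symm b1.2.symm b2.2.symm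
  have key : ∀ L : EmbeddedGraph D, L.opp = K.opp → L.next⁻¹ g = K.next⁻¹ g →
      L.next⁻¹ (K.opp g) = K.next⁻¹ (K.opp g) →
      Tilting L (L.conjNext (edgeConj K.next g (K.opp g))) := by
    intro L e1 e2 e3
    have aux : ∀ x y, y = g ∨ y = K.opp g → K.next x ≠ y → L.next x ≠ y := by
      rintro x y (rfl | rfl) hne e
      · rw [← Perm.eq_inv_iff_eq, e2, Perm.eq_inv_iff_eq] at e
        exact hne e
      · rw [← Perm.eq_inv_iff_eq, e3, Perm.eq_inv_iff_eq] at e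
        exact hne e
    have := tilting_edge L g (by rw [e1]; exact aux _ _ (.inl rfl) h1)
      (by rw [e1]; exact aux _ _ (.inr rfl) h2) (by rw [e1]; exact aux _ _ (.inr rfl) h3)
      (aux _ _ (.inl rfl) h4)
    unfold edgeConj at this ⊢
    rwa [e1, e2, e3] at this
  refine ⟨fl, fr, ?_, ?_⟩
  · intro k u hu a1 a2 a3 a4
    rw [← insertEdge_conjNext k u fl fr]
    apply key
    · rfl
    · rw [Perm.inv_eq_iff_eq, insertEdge_next_apply (apply_inv_self _ _) hg a1.symm a3.symm]
    · rw [Perm.inv_eq_iff_eq, insertEdge_next_apply (apply_inv_self _ _) hg.opp a2.symm a4.symm]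
  · intro u hu a1 a2
    rw [← insertLeaf_conjNext u fl]
    apply key
    · rfl
    · rw [Perm.inv_eq_iff_eq, insertLeaf_next_apply (apply_inv_self _ _) hg a1.symm]
    · rw [Perm.inv_eq_iff_eq, insertLeaf_next_apply (apply_inv_self _ _) hg.opp a2.symm]

/-- Here the conjugating permutation depends on the successors of `g` and `K.opp g`. They change
only if something is inserted before one of these two successors. -/
theorem tiltingOff_leaf (hK : K.IsIsolated h) {g : D} (hg : K.Off h g)
    (h1 : K.next g = K.opp g) (h2 : K.next (K.opp g) ≠ g) :
    K.TiltingOff h (leafConj K.next g (K.opp g)) (K.opp g) (K.next (K.opp g)) := by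
  have b1 := hK.off_next_iff.2 hg.opp
  have fl : leafConj K.next g (K.opp g) h = h :=
    leafConj_apply_of_ne hg.1.symm hg.opp.1.symm b1.1.symm
  have fr : leafConj K.next g (K.opp g) (K.opp h) = K.opp h :=
    leafConj_apply_of_ne hg.2.symm hg.opp.2.symm b1.2.symm
  have key : ∀ L : EmbeddedGraph D, L.opp = K.opp → L.next g = K.opp g →
      L.next (K.opp g) = K.next (K.opp g) →
      Tilting L (L.conjNext (leafConj K.next g (K.opp g))) := by
    intro L e1 e2 e3
    have := tilting_leaf L g (by rw [e1, e2]) (by rw [e1, e3]; exact h2)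
    unfold leafConj at this ⊢
    rwa [e1, e3] at this
  refine ⟨fl, fr, ?_, ?_⟩
  · intro k u hu a1 a2 a3 a4
    rw [← insertEdge_conjNext k u fl fr]
    apply key
    · rfl
    · exact insertEdge_next_apply h1 hg.opp a1.symm a3.symm
    · exact insertEdge_next_apply rfl b1 a2.symm a4.symm
  · intro u hu a1 a2
    rw [← insertLeaf_conjNext u fl]
    apply key
    · rfl
    · exact insertLeaf_next_apply h1 hg.opp a1.symm
    · exact insertLeaf_next_apply rfl b1 a2.symm

theorem tiltingOff_loop (hK : K.IsIsolated h) {g : D} (hg : K.Off h g)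
    (h1 : K.next g = g) (h2 : K.next (K.opp g) ≠ K.opp g) :
    K.TiltingOff h (loopConj K.next (K.opp g)) g (K.next (K.opp g)) := by
  have b1 := hK.off_next_iff.2 hg.opp
  have fl : loopConj K.next (K.opp g) h = h :=
    loopConj_apply_of_ne hg.opp.1.symm b1.1.symm
  have fr : loopConj K.next (K.opp g) (K.opp h) = K.opp h :=
    loopConj_apply_of_ne hg.opp.2.symm b1.2.symm
  have key : ∀ L : EmbeddedGraph D, L.opp = K.opp → L.next g = g →
      L.next (K.opp g) = K.next (K.opp g) →
      Tilting L (L.conjNext (loopConj K.next (K.opp g))) := by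
    intro L e1 e2 e3
    have := tilting_loop L g e2 (by rw [e1, e3]; exact h2)
    unfold loopConj at this ⊢
    rwa [e1, e3] at this
  refine ⟨fl, fr, ?_, ?_⟩
  · intro k u hu a1 a2 a3 a4
    rw [← insertEdge_conjNext k u fl fr]
    apply key
    · rfl
    · exact insertEdge_next_apply h1 hg a1.symm a3.symm
    · exact insertEdge_next_apply rfl b1 a2.symm a4.symm
  · intro u hu a1 a2
    rw [← insertLeaf_conjNext u fl]
    apply key
    · rfl
    · exact insertLeaf_next_apply h1 hg a1.symm
    · exact insertLeaf_next_apply rfl b1 a2.symm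

omit [DecidableEq D] in
theorem minimalPeriod_conj (f s : Perm D) (x : D) :
    minimalPeriod (s * f * s⁻¹ : Perm D) (s x) = minimalPeriod f x := by
  have hc : Semiconj s f (s * f * s⁻¹ : Perm D) := fun y => by simp
  apply Nat.dvd_antisymm
  · exact ((isPeriodicPt_minimalPeriod f x).map hc).minimalPeriod_dvd
  · have hc' : Semiconj (s⁻¹ : Perm D) (s * f * s⁻¹ : Perm D) f := fun y => by simp
    have := ((isPeriodicPt_minimalPeriod (s * f * s⁻¹ : Perm D) (s x)).map hc').minimalPeriod_dvd
    rwa [inv_apply_self] at this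

omit [DecidableEq D] in
theorem SameCycle.minimalPeriod_eq [Finite D] {f : Perm D} {x y : D} (hxy : f.SameCycle x y) :
    minimalPeriod f y = minimalPeriod f x := by
  obtain ⟨i, rfl⟩ := hxy.exists_nat_pow_eq
  have := minimalPeriod_conj f (f ^ i) x
  rwa [((Commute.refl f).pow_left i).eq, mul_assoc, mul_inv_cancel, mul_one] at this

omit [DecidableEq D] in
/-- If every chord of length `k` of an `m`-cycle has an end at `a` or `b`, then `m` is small. -/
theorem small_of_chords_hit [Finite D] {f : Perm D} {u a b : D} {k m : ℕ}
    (hm : minimalPeriod f u = m) (hk : 2 ≤ k) (hkm : k ≤ m) (hmk : m ≤ 2 * k)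
    (hbad : ∀ v, f.SameCycle u v → v = a ∨ v = b ∨ (f ^ k) v = a ∨ (f ^ k) v = b) :
    (m = 2 ∧ k = 2) ∨ (m = 3 ∧ k = 2) ∨ (m = 4 ∧ k = 2) ∨ (m = 4 ∧ k = 3) := by
  classical
  have hinj : Set.InjOn (fun i => f^[i] u) (Finset.range m : Set ℕ) := by
    intro i hi j hj
    simp only [Finset.coe_range, Set.mem_Iio] at hi hj
    subst hm
    exact fun e => iterate_injOn_Iio_minimalPeriod hi hj e
  have hcard := Finset.card_image_of_injOn hinj
  rw [Finset.card_range] at hcard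
  have hsame : ∀ i, f.SameCycle u (f^[i] u) := fun i => by
    rw [Equiv.Perm.iterate_eq_pow]
    exact ⟨i, by simp⟩
  rcases hkm.eq_or_lt with rfl | hlt
  -- A chord of full length has coinciding ends, so the whole cycle lies in `{a, b}`.
  · have : (Finset.range k).image (fun i => f^[i] u) ⊆ {a, b} := by
      intro v hv
      obtain ⟨i, -, rfl⟩ := Finset.mem_image.1 hv
      have hp : (f ^ k) (f^[i] u) = f^[i] u := by
        rw [← Equiv.Perm.iterate_eq_pow, ← iterate_add_apply, add_comm, iterate_add_apply, ← hm,
          iterate_minimalPeriod]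
      have := hbad _ (hsame i)
      rw [hp] at this
      simp only [Finset.mem_insert, Finset.mem_singleton]
      tauto
    have := (Finset.card_le_card this).trans Finset.card_le_two
    omega
  -- Each of `a`, `b` is an end of at most two chords of length `k`: the one that starts there and
  -- the one that finishes there. As there are `m` chords, `m ≤ 4`.
  · have : (Finset.range m).image (fun i => f^[i] u) ⊆
        {a, b, (f ^ k)⁻¹ a, (f ^ k)⁻¹ b} := by
      intro v hv
      obtain ⟨i, -, rfl⟩ := Finset.mem_image.1 hv
      have := hbad _ (hsame i)
      simp only [Finset.mem_insert, Finset.mem_singleton, Perm.eq_inv_iff_eq]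
      tauto
    have := (Finset.card_le_card this).trans Finset.card_le_four
    omega

end EmbeddedGraph

/-! ### Carrying a diagonal across one tilting -/

namespace EmbeddedGraph

open Equiv Equiv.Perm Function

variable {D : Type*} [DecidableEq D] [Finite D] {K : EmbeddedGraph D} {h : D}

/-- A diagonal of the face of `u` in `K` can be carried to a diagonal of a face of `K'` of the same
size. -/
def Carries (K K' : EmbeddedGraph D) (h : D) (k : ℕ) (u : D) : Prop :=
  ∃ u', K'.Off h u' ∧ minimalPeriod K'.next u' = minimalPeriod K.next u ∧
    (K'.insertEdge h k u').ObtainableFrom (K.insertEdge h k u)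

omit [Finite D] in
theorem Carries.of_eq {K' : EmbeddedGraph D} {k : ℕ} {u : D} (hu : K.Off h u) (he : K' = K) :
    Carries K K' h k u := by
  subst he
  exact ⟨u, hu, rfl, ObtainableFrom.refl _⟩

/-- The diagonal is first rotated from `u` to a place `v` that avoids both forbidden darts; there
the tilting of `K` is a tilting of the graph with the diagonal. -/
theorem TiltingOff.carries (hK : K.IsIsolated h) {s : Perm D} {a b : D}
    (ht : K.TiltingOff h s a b) {k : ℕ} {u v : D} (hu : K.Off h u) (huv : K.next.SameCycle u v)
    (h1 : v ≠ a) (h2 : v ≠ b) (h3 : (K.next ^ k) v ≠ a) (h4 : (K.next ^ k) v ≠ b) :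
    Carries K (K.conjNext s) h k u := by
  have hv : K.Off h v := by
    obtain ⟨i, rfl⟩ := huv.exists_nat_pow_eq
    exact (hK.off_pow_iff i).2 hu
  refine ⟨s v, ⟨?_, ?_⟩, ?_, ?_⟩
  · intro e
    exact hv.1 (s.injective (e.trans ht.fix_left.symm))
  · intro e
    exact hv.2 (s.injective (e.trans ht.fix_right.symm))
  · rw [conjNext_next, minimalPeriod_conj, SameCycle.minimalPeriod_eq huv]
  · exact (insertEdge_of_sameCycle hK k hu huv).trans (ht.edge k v hv h1 h2 h3 h4).obtainable

-- The predicate `p` marks the forbidden darts. The four small cases are unrolled into statements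
-- about `u`, `f u`, `f (f u)`, …, ready for propositional reasoning.
omit [DecidableEq D] in
theorem small_cycle_cases {f : Perm D} {u a b : D} {k m : ℕ} {p : D → Prop}
    (hp : ∀ x, p x → x = a ∨ x = b)
    (hm : minimalPeriod f u = m) (hk : 2 ≤ k) (hkm : k ≤ m) (hmk : m ≤ 2 * k)
    (hbad : ∀ v, f.SameCycle u v → p v ∨ p ((f ^ k) v)) :
    (m = 2 ∧ k = 2 ∧ f (f u) = u ∧ f u ≠ u ∧ p u ∧ p (f u)) ∨
    (m = 3 ∧ k = 2 ∧ f (f (f u)) = u ∧ f u ≠ u ∧ f (f u) ≠ u ∧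
      (p u ∨ p (f (f u))) ∧ (p (f u) ∨ p u) ∧ (p (f (f u)) ∨ p (f u))) ∨
    (m = 4 ∧ k = 2 ∧ f (f (f (f u))) = u ∧ f u ≠ u ∧ f (f u) ≠ u ∧ f (f (f u)) ≠ u ∧
      (p u ∨ p (f (f u))) ∧ (p (f u) ∨ p (f (f (f u))))) ∨
    (m = 4 ∧ k = 3 ∧ f (f (f (f u))) = u ∧ f u ≠ u ∧ f (f u) ≠ u ∧ f (f (f u)) ≠ u ∧
      (p u ∨ p (f (f (f u)))) ∧ (p (f u) ∨ p u) ∧ (p (f (f u)) ∨ p (f u)) ∧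
      (p (f (f (f u))) ∨ p (f (f u)))) := by
  have hs := small_of_chords_hit (a := a) (b := b) hm hk hkm hmk (fun v hv => by
    rcases hbad v hv with h | h
    · rcases hp _ h with h | h
      · exact .inl h
      · exact .inr (.inl h)
    · exact .inr (.inr (hp _ h)))
  have hper : f^[m] u = u := hm ▸ iterate_minimalPeriod
  have hne : ∀ i, 0 < i → i < m → f^[i] u ≠ u := fun i h0 h1 e =>
    not_isPeriodicPt_of_pos_of_lt_minimalPeriod h0.ne' (hm ▸ h1) e
  have b0 := hbad u (SameCycle.refl f u)
  have b1 := hbad (f u) (sameCycle_apply_right.2 (SameCycle.refl f u))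
  have b2 := hbad (f (f u)) (sameCycle_apply_right.2 (sameCycle_apply_right.2 (SameCycle.refl f u)))
  have b3 := hbad (f (f (f u))) (sameCycle_apply_right.2 (sameCycle_apply_right.2
    (sameCycle_apply_right.2 (SameCycle.refl f u))))
  rcases hs with ⟨rfl, rfl⟩ | ⟨rfl, rfl⟩ | ⟨rfl, rfl⟩ | ⟨rfl, rfl⟩
  · have n1 := hne 1 (by norm_num) (by norm_num)
    simp only [iterate_succ, iterate_zero, comp_apply, id_eq] at hper n1
    simp only [pow_succ, pow_zero, one_mul, Perm.mul_apply, hper, or_self] at b0 b1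
    exact .inl ⟨rfl, rfl, hper, n1, b0, b1⟩
  · have n1 := hne 1 (by norm_num) (by norm_num)
    have n2 := hne 2 (by norm_num) (by norm_num)
    simp only [iterate_succ, iterate_zero, comp_apply, id_eq] at hper n1 n2
    simp only [pow_succ, pow_zero, one_mul, Perm.mul_apply, hper] at b0 b1 b2
    exact .inr (.inl ⟨rfl, rfl, hper, n1, n2, b0, b1, b2⟩)
  · have n1 := hne 1 (by norm_num) (by norm_num)
    have n2 := hne 2 (by norm_num) (by norm_num)
    have n3 := hne 3 (by norm_num) (by norm_num)
    simp only [iterate_succ, iterate_zero, comp_apply, id_eq] at hper n1 n2 n3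
    simp only [pow_succ, pow_zero, one_mul, Perm.mul_apply, hper] at b0 b1 b2 b3
    exact .inr (.inr (.inl ⟨rfl, rfl, hper, n1, n2, n3, b0, b1⟩))
  · have n1 := hne 1 (by norm_num) (by norm_num)
    have n2 := hne 2 (by norm_num) (by norm_num)
    have n3 := hne 3 (by norm_num) (by norm_num)
    simp only [iterate_succ, iterate_zero, comp_apply, id_eq] at hper n1 n2 n3
    simp only [pow_succ, pow_zero, one_mul, Perm.mul_apply, hper] at b0 b1 b2 b3
    exact .inr (.inr (.inr ⟨rfl, rfl, hper, n1, n2, n3, b0, b1, b2, b3⟩))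

omit [DecidableEq D] [Finite D] in
theorem conjNext_of_commute {s : Perm D} (hs : ∀ x, s (K.next x) = K.next (s x)) :
    K.conjNext s = K := by
  ext1
  · rw [conjNext_next, mul_inv_eq_iff_eq_mul]
    ext x
    exact hs x
  · rfl

-- On the 4-cycle `g, f g, o, f o` this permutation coincides with `f`, and elsewhere it is the
-- identity. Such a tilting changes nothing.
omit [Finite D] in
theorem edgeConj_of_square {f : Perm D} {g o : D} (hog : o ≠ g) (h1 : f (f g) = o)
    (h2 : f (f o) = g) (h3 : f g ≠ g) (h4 : f g ≠ o) (h5 : f o ≠ g) (h6 : f o ≠ o) (x : D) :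
    edgeConj f g o (f x) = f (edgeConj f g o x) := by
  obtain ⟨e1, e2, e3, e4⟩ := edgeConj_facts hog h5 h4 h6 h3
  have i1 : f⁻¹ g = f o := by rw [Perm.inv_eq_iff_eq, h2]
  have i2 : f⁻¹ o = f g := by rw [Perm.inv_eq_iff_eq, h1]
  have key : ∀ y, y ≠ g → y ≠ o → y ≠ f g → y ≠ f o → edgeConj f g o y = y :=
    fun y a b c d => edgeConj_apply_of_ne a b (i1 ▸ d) (i2 ▸ c)
  rw [i1] at e2 e3
  rw [i2] at e1 e4
  by_cases a : x = g
  · subst a; rw [e1, h1, e4]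
  by_cases b : x = o
  · subst b; rw [e2, h2, e3]
  by_cases c : x = f g
  · subst c; rw [h1, e2, e4]
  by_cases d : x = f o
  · subst d; rw [h2, e1, e3]
  rw [key x a b c d, key (f x)]
  · rw [← h2]; exact fun e => d (f.injective e)
  · rw [← h1]; exact fun e => c (f.injective e)
  · exact fun e => a (f.injective e)
  · exact fun e => b (f.injective e)

-- On the 3-cycle `g, o, f o` this permutation coincides with `f⁻¹`, and elsewhere it is the
-- identity.
omit [Finite D] in
theorem leafConj_of_triangle {f : Perm D} {g o : D} (hog : o ≠ g) (h1 : f g = o)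
    (h2 : f (f o) = g) (h3 : f o ≠ g) (x : D) :
    leafConj f g o (f x) = f (leafConj f g o x) := by
  obtain ⟨e1, e2, e3⟩ := leafConj_facts hog h1 h3
  have key : ∀ y, y ≠ g → y ≠ o → y ≠ f o → leafConj f g o y = y :=
    fun y a b c => leafConj_apply_of_ne a b c
  by_cases a : x = g
  · subst a; rw [e1, h1, e3, h2]
  by_cases b : x = o
  · subst b; rw [e2, e3, h1]
  by_cases c : x = f o
  · subst c; rw [h2, e1, e2]
  rw [key x a b c, key (f x)]
  · rw [← h2]; exact fun e => c (f.injective e)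
  · rw [← h1]; exact fun e => a (f.injective e)
  · exact fun e => b (f.injective e)

/-- If no position of the diagonal is free, the face has at most four darts. An edge of type 3 never
has two of its darts consecutive on a face, and this excludes every small case except the square
with `g` and its opposite at opposite places, where the tilting acts trivially. -/
theorem carries_edge (hK : K.IsIsolated h) {g : D} (hg : K.Off h g)
    (h1 : K.next (K.opp g) ≠ g) (h2 : K.next g ≠ K.opp g) (h3 : K.next (K.opp g) ≠ K.opp g)
    (h4 : K.next g ≠ g) {k m : ℕ} {u : D} (hu : K.Off h u) (hm : minimalPeriod K.next u = m)
    (hk : 2 ≤ k) (hkm : k ≤ m) (hmk : m ≤ 2 * k) :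
    Carries K (K.conjNext (edgeConj K.next g (K.opp g))) h k u := by
  by_cases hbad : ∀ v, K.next.SameCycle u v → (v = g ∨ v = K.opp g) ∨
      ((K.next ^ k) v = g ∨ (K.next ^ k) v = K.opp g)
  · have hog := K.opp_ne g
    set o := K.opp g
    set f := K.next
    have comm : f (f g) = o → f (f o) = g → Carries K (K.conjNext (edgeConj f g o)) h k u :=
      fun a b => Carries.of_eq hu (conjNext_of_commute
        (edgeConj_of_square hog a b h4 h2 h1 h3))
    have hnc : ∀ x, x = g ∨ x = o → ¬ (f x = g ∨ f x = o) := by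
      rintro x (rfl | rfl) (e | e)
      exacts [h4 e, h2 e, h1 e, h3 e]
    have comm' : ∀ x, (x = g ∨ x = o) → (f (f x) = g ∨ f (f x) = o) → f (f x) ≠ x →
        f (f (f (f x))) = x → Carries K (K.conjNext (edgeConj f g o)) h k u := by
      rintro x (rfl | rfl) (e | e) n p
      · exact absurd e n
      · exact comm e (by rw [← e, p])
      · exact comm (by rw [← e, p]) e
      · exact absurd e n
    obtain ⟨p, hp⟩ : ∃ p : D → Prop, p = fun x => x = g ∨ x = o := ⟨_, rfl⟩
    have hp' : ∀ x, p x → x = g ∨ x = o := fun x hx => by rw [hp] at hx; exact hx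
    have hnc' : ∀ x, p x → ¬ p (f x) := by rw [hp]; exact hnc
    rcases small_cycle_cases hp' hm hk hkm hmk (by rw [hp]; exact hbad) with
      ⟨-, -, c⟩ | ⟨-, -, c⟩ | ⟨-, -, c⟩ | ⟨-, -, c⟩
    · exact absurd c.2.2.2 (hnc' u c.2.2.1)
    · obtain ⟨q, -, -, c0, c1, c2⟩ := c
      have a0 := hnc' u
      have a1 := hnc' (f u)
      have a2 := hnc' (f (f u))
      rw [q] at a2
      tauto
    · obtain ⟨q, -, -, -, c0, c1⟩ := c
      have a0 := hnc' u
      have a1 := hnc' (f u)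
      have a2 := hnc' (f (f u))
      have a3 := hnc' (f (f (f u)))
      rw [q] at a3
      tauto
    · obtain ⟨q, n1, n2, n3, c0, c1, c2, c3⟩ := c
      have a0 := hnc' u
      have a1 := hnc' (f u)
      have a2 := hnc' (f (f u))
      have a3 := hnc' (f (f (f u)))
      rw [q] at a3
      have n4 : f (f (f u)) ≠ f u := fun e => n2 (f.injective e)
      by_cases hpu : p u
      · exact comm' u (hp' _ hpu) (hp' _ (c2.resolve_right (a0 hpu))) n2 q
      · exact comm' (f u) (hp' _ (c1.resolve_right hpu)) (hp' _ (c0.resolve_left hpu)) n4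
          (by rw [q])
  · push Not at hbad
    obtain ⟨v, hv, ⟨a1, a2⟩, a3, a4⟩ := hbad
    exact (tiltingOff_edge hK hg h1 h2 h3 h4).carries hK hu hv a1 a2 a3 a4

/-- The dart `g` is alone in its face, so it does not occur in a face with at least two darts. The
single forbidden dart that remains cannot be hit by all chords. -/
theorem carries_loop (hK : K.IsIsolated h) {g : D} (hg : K.Off h g)
    (h1 : K.next g = g) (h2 : K.next (K.opp g) ≠ K.opp g)
    {k m : ℕ} {u : D} (hu : K.Off h u) (hm : minimalPeriod K.next u = m)
    (hk : 2 ≤ k) (hkm : k ≤ m) (hmk : m ≤ 2 * k) :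
    Carries K (K.conjNext (loopConj K.next (K.opp g))) h k u := by
  by_cases hbad : ∀ v, K.next.SameCycle u v → (v = g ∨ v = K.next (K.opp g)) ∨
      ((K.next ^ k) v = g ∨ (K.next ^ k) v = K.next (K.opp g))
  · exfalso
    set t := K.next (K.opp g)
    set f := K.next
    have hne : ∀ v, f.SameCycle u v → v ≠ g := by
      rintro v hv rfl
      have e1 := SameCycle.minimalPeriod_eq hv
      have e2 : minimalPeriod f v = 1 := minimalPeriod_eq_one_iff_isFixedPt.2 h1
      omega
    have hbad' : ∀ v, f.SameCycle u v → v = t ∨ (f ^ k) v = t := by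
      intro v hv
      have e1 := hne v hv
      have e2 := hne ((f ^ k) v) (sameCycle_pow_right.2 hv)
      have := hbad v hv
      tauto
    obtain ⟨p, hp⟩ : ∃ p : D → Prop, p = fun x => x = t := ⟨_, rfl⟩
    have hp' : ∀ x, p x → x = t := fun x hx => by rw [hp] at hx; exact hx
    have huniq : ∀ x y, p x → p y → x = y := fun x y hx hy => (hp' x hx).trans (hp' y hy).symm
    rcases small_cycle_cases (p := p) (a := t) (b := t) (fun x hx => .inl (hp' x hx)) hm hk hkm hmk
      (by rw [hp]; exact hbad') with
      ⟨-, -, c⟩ | ⟨-, -, c⟩ | ⟨-, -, c⟩ | ⟨-, -, c⟩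
    · exact c.2.1 (huniq _ _ c.2.2.2 c.2.2.1)
    · obtain ⟨q, n1, n2, c0, c1, c2⟩ := c
      rcases c0 with c0 | c0
      · rcases c2 with c2 | c2
        · exact n2 (huniq _ _ c2 c0)
        · exact n1 (huniq _ _ c2 c0)
      · rcases c1 with c1 | c1
        · exact n1 (f.injective (huniq _ _ c0 c1))
        · exact n2 (huniq _ _ c0 c1)
    · obtain ⟨q, n1, n2, n3, c0, c1⟩ := c
      rcases c0 with c0 | c0 <;> rcases c1 with c1 | c1
      · exact n1 (huniq _ _ c1 c0)
      · exact n3 (huniq _ _ c1 c0)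
      · exact n1 (f.injective (huniq _ _ c0 c1))
      · exact n1 (f.injective (f.injective (huniq _ _ c1 c0)))
    · obtain ⟨q, n1, n2, n3, c0, c1, c2, c3⟩ := c
      rcases c0 with c0 | c0 <;> rcases c2 with c2 | c2
      · exact n2 (huniq _ _ c2 c0)
      · exact n1 (huniq _ _ c2 c0)
      · exact n1 (f.injective (f.injective (huniq _ _ c0 c2)))
      · exact n2 (f.injective (huniq _ _ c0 c2))
  · push Not at hbad
    obtain ⟨v, hv, ⟨a1, a2⟩, a3, a4⟩ := hbad
    exact (tiltingOff_loop hK hg h1 h2).carries hK hu hv a1 a2 a3 a4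

/-- The face is the square `g, opp g, t, r`, and the diagonal `h` of length 2 cuts it into two
triangles with the leaf edge `g` between them. Tilting `g` as an edge of type 3, then exchanging the
names of the edges `g` and `h`, yields the square `g, opp g, r, t` of the tilted graph with the
diagonal `h` in it. -/
theorem carries_leaf_square (hK : K.IsIsolated h) {g t r u : D} (hg : K.Off h g)
    (h1 : K.next g = K.opp g) (h2 : K.next (K.opp g) = t) (h3 : K.next t = r)
    (h4 : K.next r = g) (htg : t ≠ g) (hrg : r ≠ K.opp g) (hu : K.Off h u)
    (hug : K.next.SameCycle u (K.opp g)) :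
    Carries K (K.conjNext (leafConj K.next g (K.opp g))) h 2 u := by
  have hgo := K.opp_ne g
  have hhj := K.opp_ne h
  have og := hg.opp
  have ot := h2 ▸ hK.off_next_iff.2 og
  have or := h3 ▸ hK.off_next_iff.2 ot
  obtain ⟨k1, k2⟩ := id hK
  have e1 := insertEdge_of_sameCycle hK 2 hu hug
  obtain ⟨s1, s2, s3⟩ := leafConj_facts hgo h1 (h2 ▸ htg)
  have fl : ∀ x, x ≠ g → x ≠ K.opp g → x ≠ t → leafConj K.next g (K.opp g) x = x :=
    fun x a b c => leafConj_apply_of_ne a b (h2 ▸ c)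
  set L := K.conjNext (leafConj K.next g (K.opp g)) with hL
  set F := K.insertEdge h 2 (K.opp g) with hF
  have hFn : F.next = swap (K.opp g) (K.opp h) * swap r h * K.next := by
    rw [hF, insertEdge_next]
    simp only [pow_succ, pow_zero, one_mul, Perm.mul_apply, h2, h3]
  have n1 : r ≠ g := fun e => hgo (by rw [← h1, ← e, h4, e])
  have n2 : t ≠ K.opp g := fun e => hgo (K.next.injective (by rw [h2, h1, e]))
  have n3 : r ≠ t := fun e => n2 (K.next.injective (by rw [h3, h2, e]))
  obtain ⟨og1, og2⟩ := hg
  obtain ⟨oo1, oo2⟩ := og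
  obtain ⟨ot1, ot2⟩ := ot
  obtain ⟨or1, or2⟩ := or
  have hLn : L.next = leafConj K.next g (K.opp g) * K.next * (leafConj K.next g (K.opp g))⁻¹ := by
    rw [hL, conjNext_next]
  have hs1 : (leafConj K.next g (K.opp g))⁻¹ g = K.opp g := by rw [Perm.inv_eq_iff_eq, s3]
  have hs2 : (leafConj K.next g (K.opp g))⁻¹ (K.opp g) = t := by
    rw [Perm.inv_eq_iff_eq, ← h2, s2]
  have hs3 : (leafConj K.next g (K.opp g))⁻¹ t = g := by rw [Perm.inv_eq_iff_eq, s1, h2]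
  have hs4 : ∀ x, x ≠ g → x ≠ K.opp g → x ≠ t → (leafConj K.next g (K.opp g))⁻¹ x = x :=
    fun x a b c => by rw [Perm.inv_eq_iff_eq, fl x a b c]
  have l1 : L.next g = K.opp g := by
    rw [hLn, Perm.mul_apply, Perm.mul_apply, hs1, h2, ← h2, s2]
  have l2 : L.next (K.opp g) = r := by
    rw [hLn, Perm.mul_apply, Perm.mul_apply, hs2, h3, fl r n1 hrg n3]
  have l3 : L.next r = t := by
    rw [hLn, Perm.mul_apply, Perm.mul_apply, hs4 r n1 hrg n3, h4, s1, h2]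
  have l4 : L.next t = g := by
    rw [hLn, Perm.mul_apply, Perm.mul_apply, hs3, h1, s3]
  have l5 : ∀ x, x ≠ g → x ≠ K.opp g → x ≠ t → x ≠ r → L.next x = K.next x := by
    intro x a b c d
    rw [hLn, Perm.mul_apply, Perm.mul_apply, hs4 x a b c, fl]
    · rw [← h4]; exact fun e => d (K.next.injective e)
    · rw [← h1]; exact fun e => a (K.next.injective e)
    · rw [← h2]; exact fun e => b (K.next.injective e)
  have f1 : F.next h = K.opp g := by
    rw [hFn, Perm.mul_apply, Perm.mul_apply, k1, swap_apply_of_ne_of_ne or2.symm hhj,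
      swap_apply_right]
  have f2 : F.next (K.opp g) = t := by
    rw [hFn, Perm.mul_apply, Perm.mul_apply, h2, swap_apply_of_ne_of_ne n3.symm ot1,
      swap_apply_of_ne_of_ne n2 ot2]
  have f3 : F.next t = h := by
    rw [hFn, Perm.mul_apply, Perm.mul_apply, h3, swap_apply_left,
      swap_apply_of_ne_of_ne oo1.symm hhj.symm]
  have f4 : F.next (K.opp h) = r := by
    rw [hFn, Perm.mul_apply, Perm.mul_apply, k2, swap_apply_right, swap_apply_of_ne_of_ne hrg or2]
  have f5 : F.next r = g := by
    rw [hFn, Perm.mul_apply, Perm.mul_apply, h4, swap_apply_of_ne_of_ne n1.symm og1,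
      swap_apply_of_ne_of_ne hgo.symm og2]
  have f6 : F.next g = K.opp h := by
    rw [hFn, Perm.mul_apply, Perm.mul_apply, h1, swap_apply_of_ne_of_ne hrg.symm oo1,
      swap_apply_left]
  have f7 : ∀ x, x ≠ h → x ≠ g → x ≠ t → x ≠ K.opp h → F.next x = K.next x := by
    intro x a b c d
    have a' : K.next x ≠ K.opp h := by rw [← k1]; exact fun e => a (K.next.injective e)
    have b' : K.next x ≠ K.opp g := by rw [← h1]; exact fun e => b (K.next.injective e)
    have c' : K.next x ≠ r := by rw [← h3]; exact fun e => c (K.next.injective e)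
    have d' : K.next x ≠ h := fun e => d (K.next.injective (e.trans k2.symm))
    rw [hFn, Perm.mul_apply, Perm.mul_apply, swap_apply_of_ne_of_ne c' d',
      swap_apply_of_ne_of_ne b' a']
  have ht : Tilting F (F.conjNext (edgeConj F.next g (K.opp g))) := by
    have hFo : F.opp = K.opp := rfl
    refine tilting_edge F g ?_ ?_ ?_ ?_
    · rw [hFo, f2]; exact htg
    · rw [hFo, f6]; exact oo2.symm
    · rw [hFo, f2]; exact n2
    · rw [f6]; exact og2.symm
  obtain ⟨c1, c2, c3, c4⟩ := edgeConj_facts (f := F.next) hgo (by rw [f2]; exact htg)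
    (by rw [f6]; exact oo2.symm) (by rw [f2]; exact n2) (by rw [f6]; exact og2.symm)
  have i1 : F.next⁻¹ g = r := by rw [Perm.inv_eq_iff_eq, f5]
  have i2 : F.next⁻¹ (K.opp g) = h := by rw [Perm.inv_eq_iff_eq, f1]
  rw [i2] at c1 c4
  rw [i1] at c2 c3
  have c5 : ∀ x, x ≠ g → x ≠ K.opp g → x ≠ r → x ≠ h → edgeConj F.next g (K.opp g) x = x :=
    fun x a b c d => edgeConj_apply_of_ne a b (i1 ▸ c) (i2 ▸ d)
  set S := edgeConj F.next g (K.opp g)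
  have N : (L.insertEdge h 2 g).next = swap g (K.opp h) * swap r h * L.next := by
    rw [insertEdge_next]
    simp only [pow_succ, pow_zero, one_mul, Perm.mul_apply, l1, l2]
    rfl
  set M := (L.insertEdge h 2 g).next
  have hLh : L.next h = K.opp h := by
    rw [l5 h og1.symm oo1.symm ot1.symm or1.symm, k1]
  have hLj : L.next (K.opp h) = h := by
    rw [l5 _ og2.symm oo2.symm ot2.symm or2.symm, k2]
  have m1 : M h = g := by
    rw [N, Perm.mul_apply, Perm.mul_apply, hLh, swap_apply_of_ne_of_ne or2.symm hhj,
      swap_apply_right]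
  have m2 : M (K.opp h) = r := by
    rw [N, Perm.mul_apply, Perm.mul_apply, hLj, swap_apply_right, swap_apply_of_ne_of_ne n1 or2]
  have m3 : M g = K.opp g := by
    rw [N, Perm.mul_apply, Perm.mul_apply, l1, swap_apply_of_ne_of_ne hrg.symm oo1,
      swap_apply_of_ne_of_ne hgo oo2]
  have m4 : M (K.opp g) = h := by
    rw [N, Perm.mul_apply, Perm.mul_apply, l2, swap_apply_left,
      swap_apply_of_ne_of_ne og1.symm hhj.symm]
  have m5 : M r = t := by
    rw [N, Perm.mul_apply, Perm.mul_apply, l3, swap_apply_of_ne_of_ne n3.symm ot1,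
      swap_apply_of_ne_of_ne htg ot2]
  have m6 : M t = K.opp h := by
    rw [N, Perm.mul_apply, Perm.mul_apply, l4, swap_apply_of_ne_of_ne n1.symm og1,
      swap_apply_left]
  have m7 : ∀ x, x ≠ h → x ≠ K.opp h → x ≠ g → x ≠ K.opp g → x ≠ r → x ≠ t → M x = K.next x := by
    intro x a b c d e f
    have a' : K.next x ≠ K.opp h := by rw [← k1]; exact fun e => a (K.next.injective e)
    have b' : K.next x ≠ g := fun e' => e (K.next.injective (e'.trans h4.symm))
    have c' : K.next x ≠ r := by rw [← h3]; exact fun e => f (K.next.injective e)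
    have d' : K.next x ≠ h := fun e => b (K.next.injective (e.trans k2.symm))
    rw [N, Perm.mul_apply, Perm.mul_apply, l5 x c d f e, swap_apply_of_ne_of_ne c' d',
      swap_apply_of_ne_of_ne b' a']
  have hnu : swap g h * swap (K.opp g) (K.opp h) = swap (K.opp g) (K.opp h) * swap g h := by
    rw [mul_swap_eq_swap_mul (swap g h), swap_apply_of_ne_of_ne hgo oo1,
      swap_apply_of_ne_of_ne og2.symm hhj]
  -- This exchanges the names of the two edges; it commutes with `opp`.
  set ν : Perm D := swap g h * swap (K.opp g) (K.opp h) with hν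
  have v1 : ν g = h := by
    rw [hν, Perm.mul_apply, swap_apply_of_ne_of_ne hgo.symm og2, swap_apply_left]
  have v2 : ν h = g := by
    rw [hν, Perm.mul_apply, swap_apply_of_ne_of_ne oo1.symm hhj.symm, swap_apply_right]
  have v3 : ν (K.opp g) = K.opp h := by
    rw [hν, Perm.mul_apply, swap_apply_left, swap_apply_of_ne_of_ne og2.symm hhj]
  have v4 : ν (K.opp h) = K.opp g := by
    rw [hν, Perm.mul_apply, swap_apply_right, swap_apply_of_ne_of_ne hgo oo1]
  have v5 : ∀ x, x ≠ g → x ≠ h → x ≠ K.opp g → x ≠ K.opp h → ν x = x := fun x a b c d => by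
    rw [hν, Perm.mul_apply, swap_apply_of_ne_of_ne c d, swap_apply_of_ne_of_ne a b]
  have c6 := c5 t htg n2 n3.symm ot1
  have c7 := c5 (K.opp h) og2.symm oo2.symm or2.symm hhj
  have vt := v5 t htg ot1 n2 ot2
  have vr := v5 r n1 or1 hrg or2
  have hiso : (F.conjNext S).Isomorphic (L.insertEdge h 2 g) := by
    refine isomorphic_iff.2 ⟨ν, fun x => ?_, fun x => ?_⟩
    · obtain ⟨y, rfl⟩ := S.surjective x
      rw [conjNext_next, Perm.mul_apply, Perm.mul_apply, inv_apply_self]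
      show ν (S (F.next y)) = M (ν (S y))
      by_cases y1 : y = g
      · subst y1; rw [f6, c7, v4, c1, v2, m3.symm]
      by_cases y2 : y = K.opp g
      · subst y2; rw [f2, c6, vt, c2, vr, m5]
      by_cases y3 : y = r
      · subst y3; rw [f5, c1, v2, c3, v1, m1]
      by_cases y4 : y = h
      · subst y4; rw [f1, c2, vr, c4, v3, m2]
      by_cases y5 : y = t
      · subst y5; rw [f3, c4, v3, c6, vt, m6]
      by_cases y6 : y = K.opp h
      · subst y6; rw [f4, c3, v1, c7, v4, m4]
      have a1 : K.next y ≠ K.opp h := by rw [← k1]; exact fun e => y4 (K.next.injective e)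
      have a2 : K.next y ≠ g := fun e => y3 (K.next.injective (e.trans h4.symm))
      have a3 : K.next y ≠ r := by rw [← h3]; exact fun e => y5 (K.next.injective e)
      have a4 : K.next y ≠ h := fun e => y6 (K.next.injective (e.trans k2.symm))
      have a5 : K.next y ≠ K.opp g := by rw [← h1]; exact fun e => y1 (K.next.injective e)
      rw [f7 y y4 y1 y5 y6, c5 y y1 y2 y3 y4, c5 _ a2 a5 a3 a4, v5 _ a2 a4 a5 a1,
        v5 y y1 y4 y2 y6, m7 y y4 y6 y1 y2 y3 y5]
    · show ν (K.opp x) = K.opp (ν x)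
      rw [← Perm.mul_apply, ← Perm.mul_apply]
      congr 1
      rw [hν, ← mul_assoc K.opp, mul_swap_eq_swap_mul K.opp, mul_assoc (swap (K.opp g) _) K.opp,
        mul_swap_eq_swap_mul K.opp, K.opp_opp, K.opp_opp, ← mul_assoc, ← hnu]
  refine ⟨g, ⟨og1, og2⟩, ?_, (e1.trans ht.obtainable).trans hiso.obtainable⟩
  have := minimalPeriod_conj K.next (leafConj K.next g (K.opp g)) (K.opp g)
  rwa [s3, ← hLn, SameCycle.minimalPeriod_eq hug] at this

/-- The forbidden darts are the two successors of `g`. If they block every diagonal, the face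
contains `g` and is a triangle, where the tilting acts trivially, or a square with `k = 2`; the
other small cases contradict the position of the forbidden darts relative to `g`. -/
theorem carries_leaf (hK : K.IsIsolated h) {g : D} (hg : K.Off h g)
    (h1 : K.next g = K.opp g) (h2 : K.next (K.opp g) ≠ g) {k m : ℕ} {u : D} (hu : K.Off h u)
    (hm : minimalPeriod K.next u = m) (hk : 2 ≤ k) (hkm : k ≤ m) (hmk : m ≤ 2 * k) :
    Carries K (K.conjNext (leafConj K.next g (K.opp g))) h k u := by
  by_cases hbad : ∀ v, K.next.SameCycle u v → (v = K.opp g ∨ v = K.next (K.opp g)) ∨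
      ((K.next ^ k) v = K.opp g ∨ (K.next ^ k) v = K.next (K.opp g))
  · have hog := K.opp_ne g
    have hsq := @carries_leaf_square D _ _ K h hK g (K.next (K.opp g)) (K.next (K.next (K.opp g)))
      u hg h1 rfl rfl
    set o := K.opp g
    set f := K.next
    obtain ⟨p, hp⟩ : ∃ p : D → Prop, p = fun x => x = o ∨ x = f o := ⟨_, rfl⟩
    have hp' : ∀ x, p x → x = o ∨ x = f o := fun x hx => by rw [hp] at hx; exact hx
    have hpg : ¬ p g := fun e => (hp' g e).elim hog.symm h2.symm
    have hog' : f o ≠ o := fun e => hog (f.injective (h1.trans e.symm)).symm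
    have hback : ∀ x, p x → f.SameCycle u x → f.SameCycle u g := by
      intro x hx hux
      rcases hp' x hx with rfl | rfl
      · rw [← h1] at hux; exact sameCycle_apply_right.1 hux
      · rw [← h1] at hux; exact sameCycle_apply_right.1 (sameCycle_apply_right.1 hux)
    have hug : f.SameCycle u g := by
      have := hbad u (SameCycle.refl f u)
      have : p u ∨ p ((f ^ k) u) := by rw [hp]; exact this
      rcases this with e | e
      · exact hback _ e (SameCycle.refl f u)
      · exact hback _ e (sameCycle_pow_right.2 (SameCycle.refl f u))
    -- The cycle is read from `g` rather than from `u`, which fixes the places of the forbidden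
    -- darts in it.
    have hmg := (SameCycle.minimalPeriod_eq hug).trans hm
    have hbad' : ∀ v, f.SameCycle g v → p v ∨ p ((f ^ k) v) := by
      rw [hp]
      exact fun v hv => hbad v (hug.trans hv)
    rcases small_cycle_cases hp' hmg hk hkm hmk hbad' with
      ⟨-, -, c⟩ | ⟨-, -, c⟩ | ⟨-, rfl, c⟩ | ⟨-, -, c⟩
    · exact absurd c.2.2.1 hpg
    · exact Carries.of_eq hu (conjNext_of_commute
        (leafConj_of_triangle hog h1 (by rw [← h1]; exact c.1) h2))
    · obtain ⟨q, n1, n2, n3, -⟩ := c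
      rw [h1] at q n1 n2 n3
      refine hsq q h2 (fun e => ?_) hu (h1 ▸ sameCycle_apply_right.2 hug)
      rw [e] at q
      exact h2 q
    · obtain ⟨q, n1, n2, n3, c0, -⟩ := c
      rcases c0 with c0 | c0
      · exact absurd c0 hpg
      · rw [h1] at q c0 n3
        rcases hp' _ c0 with e | e
        · rw [e] at q; exact absurd q h2
        · exact absurd (f.injective e) hog'
  · push Not at hbad
    obtain ⟨v, hv, ⟨a1, a2⟩, a3, a4⟩ := hbad
    exact (tiltingOff_leaf hK hg h1 h2).carries hK hu hv a1 a2 a3 a4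

end EmbeddedGraph

/-! ### Carrying a leaf -/

namespace EmbeddedGraph

open Equiv Equiv.Perm Function

section Leaf

variable {D : Type*} [DecidableEq D] {K : EmbeddedGraph D} {h : D}

theorem insertLeaf_rotate (hK : K.IsIsolated h) {u : D} (hu : K.Off h u) :
    Tilting (K.insertLeaf h u) (K.insertLeaf h (K.next u)) := by
  have hoh := K.opp_ne h
  have hv := hK.off_next_iff.2 hu
  obtain ⟨h1, h2⟩ := hK
  have hLo : (K.insertLeaf h u).opp h = K.opp h := rfl
  set o := K.opp h
  have f1 : (K.insertLeaf h u).next h = o := by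
    rw [insertLeaf_next, Perm.mul_apply, h1, swap_apply_of_ne_of_ne hu.2.symm hoh]
  have f2 : (K.insertLeaf h u).next o = u := by
    rw [insertLeaf_next, Perm.mul_apply, h2, swap_apply_right]
  have := tilting_leaf (K.insertLeaf h u) h (by rw [hLo, f1]) (by rw [hLo, f2]; exact hu.1)
  convert this using 1
  ext1
  · rw [conjNext_next, hLo, leafConj, f2, insertLeaf_next, insertLeaf_next,
      eq_mul_inv_iff_mul_eq, mul_assoc, ← mul_assoc K.next, mul_swap_eq_swap_mul K.next, h1,
      mul_assoc (swap o (K.next u)), mul_swap_eq_swap_mul K.next, h2]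
    have e1 : swap h u * swap u o * swap u h = swap h o := by
      rw [mul_swap_eq_swap_mul (swap h u), swap_apply_right,
        swap_apply_of_ne_of_ne hoh hu.2.symm, mul_assoc, swap_comm h u, swap_mul_self, mul_one]
    have e2 : swap (K.next u) h * swap o (K.next u) * swap (K.next u) h = swap h o := by
      rw [mul_swap_eq_swap_mul (swap (K.next u) h), swap_apply_left,
        swap_apply_of_ne_of_ne hv.2.symm hoh, mul_assoc, swap_mul_self, mul_one, swap_comm]
    rw [← mul_assoc, ← mul_assoc, ← mul_assoc (swap h u * swap u o), e1, e2]
  · rfl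

theorem insertLeaf_of_sameCycle [Finite D] (hK : K.IsIsolated h) {u v : D}
    (hu : K.Off h u) (huv : K.next.SameCycle u v) :
    (K.insertLeaf h v).ObtainableFrom (K.insertLeaf h u) := by
  obtain ⟨i, -, -, rfl⟩ := huv.exists_pow_eq'
  clear huv
  induction i with
  | zero => exact ObtainableFrom.refl _
  | succ n ih =>
    rw [pow_succ', Perm.mul_apply]
    exact ih.trans (insertLeaf_rotate hK ((hK.off_pow_iff n).2 hu)).obtainable

/-- A leaf in the only face of `K` can be carried to a leaf of `K'`. -/
def CarriesLeaf (K K' : EmbeddedGraph D) (h u : D) : Prop :=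
  ∃ u', K'.Off h u' ∧ (K'.insertLeaf h u').ObtainableFrom (K.insertLeaf h u)

theorem TiltingOff.carriesLeaf [Finite D] (hK : K.IsIsolated h) {s : Perm D} {a b : D}
    (ht : K.TiltingOff h s a b) {u v : D} (hu : K.Off h u) (huv : K.next.SameCycle u v)
    (h1 : v ≠ a) (h2 : v ≠ b) : CarriesLeaf K (K.conjNext s) h u := by
  have hv : K.Off h v := by
    obtain ⟨i, rfl⟩ := huv.exists_nat_pow_eq
    exact (hK.off_pow_iff i).2 hu
  exact ⟨s v, ⟨fun e => hv.1 (s.injective (e.trans ht.fix_left.symm)),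
    fun e => hv.2 (s.injective (e.trans ht.fix_right.symm))⟩,
    (insertLeaf_of_sameCycle hK hu huv).trans (ht.leaf v hv h1 h2).obtainable⟩

end Leaf

/-! ### Lifting chains of tiltings from the graph without the edge -/

section Extend

variable {D : Type*}

/-- The darts different from `h` and `o`. -/
abbrev Rest (h o : D) : Type _ := {x : D // x ≠ h ∧ x ≠ o}

variable [DecidableEq D] (B : EmbeddedGraph D) {h o : D}

/-- Add the isolated edge with darts `h`, `o`. -/
def extend (f : Perm (Rest h o)) : EmbeddedGraph D := B.withNext (ofSubtype f * swap h o)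

variable {B}

@[simp]
theorem extend_opp (f : Perm (Rest h o)) : (B.extend f).opp = B.opp := rfl

theorem extend_next (f : Perm (Rest h o)) : (B.extend f).next = ofSubtype f * swap h o :=
  withNext_next _ _

theorem extend_next_apply (f : Perm (Rest h o)) (x : Rest h o) :
    (B.extend f).next x = f x := by
  rw [extend_next, Perm.mul_apply, swap_apply_of_ne_of_ne x.2.1 x.2.2, ofSubtype_apply_coe]

theorem extend_inv_apply (f : Perm (Rest h o)) (x : Rest h o) :
    (B.extend f).next⁻¹ x = (f⁻¹ x : Rest h o) := by
  rw [Perm.inv_eq_iff_eq, extend_next_apply, apply_inv_self]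

theorem extend_next_left (f : Perm (Rest h o)) : (B.extend f).next h = o := by
  rw [extend_next, Perm.mul_apply, swap_apply_left, ofSubtype_apply_of_not_mem]
  simp

theorem extend_next_right (f : Perm (Rest h o)) : (B.extend f).next o = h := by
  rw [extend_next, Perm.mul_apply, swap_apply_right, ofSubtype_apply_of_not_mem]
  simp

theorem extend_isIsolated (hB : B.opp h = o) (f : Perm (Rest h o)) : (B.extend f).IsIsolated h := by
  subst hB
  exact ⟨extend_next_left f, extend_next_right f⟩

omit [DecidableEq D] in
theorem off_coe (hB : B.opp h = o) (x : Rest h o) : B.Off h x := by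
  subst hB
  exact x.2

theorem extend_conjNext (hho : h ≠ o) (f s : Perm (Rest h o)) {s' : Perm D}
    (hs : ∀ x : Rest h o, s' x = s x)
    (h1 : s' h = h) (h2 : s' o = o) : (B.extend f).conjNext s' = B.extend (s * f * s⁻¹) := by
  ext x
  · rw [conjNext_next, Perm.mul_apply, Perm.mul_apply]
    obtain ⟨y, rfl⟩ := s'.surjective x
    rw [inv_apply_self]
    by_cases a : y = h
    · subst a; rw [extend_next_left, h2, h1, extend_next_left]
    by_cases b : y = o
    · subst b; rw [extend_next_right, h2, h1, extend_next_right]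
    lift y to Rest h o using ⟨a, b⟩
    rw [extend_next_apply, hs, hs, extend_next_apply, Perm.mul_apply, Perm.mul_apply,
      inv_apply_self]
  · rfl

theorem swap_coe (a b x : Rest h o) :
    swap (a : D) (b : D) (x : D) = (swap a b x : Rest h o) := by
  simp only [swap_apply_def, Subtype.ext_iff]
  split_ifs <;> rfl

/-- A tilting of a graph without the edge `h`, `o`, seen as a tilting away from an isolated edge. -/
theorem Tilting.elim_extend {K K' : EmbeddedGraph (Rest h o)} (ht : Tilting K K')
    (hB : B.opp h = o) (hK : ∀ x, (K.opp x : D) = B.opp x)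
    {p : EmbeddedGraph D → EmbeddedGraph D → Prop}
    (edge : ∀ L : EmbeddedGraph D, L = B.extend K.next → ∀ g, L.IsIsolated h → L.Off h g →
      L.next (L.opp g) ≠ g → L.next g ≠ L.opp g → L.next (L.opp g) ≠ L.opp g →
      L.next g ≠ g → p L (L.conjNext (edgeConj L.next g (L.opp g))))
    (leaf : ∀ L : EmbeddedGraph D, L = B.extend K.next → ∀ g, L.IsIsolated h → L.Off h g →
      L.next g = L.opp g → L.next (L.opp g) ≠ g →
      p L (L.conjNext (leafConj L.next g (L.opp g))))
    (loop : ∀ L : EmbeddedGraph D, L = B.extend K.next → ∀ g, L.IsIsolated h → L.Off h g →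
      L.next g = g → L.next (L.opp g) ≠ L.opp g →
      p L (L.conjNext (loopConj L.next (L.opp g)))) :
    p (B.extend K.next) (B.extend K'.next) := by
  have hho : h ≠ o := by rw [← hB]; exact (B.opp_ne h).symm
  have hiso := extend_isIsolated hB K.next
  apply ht.elim (p := fun K' => p (B.extend K.next) (B.extend K'.next))
  · intro g h1 h2 h3 h4
    have off : B.Off h g := off_coe hB g
    have o1 := off_coe hB (K.next⁻¹ g)
    have o2 := off_coe hB (K.next⁻¹ (K.opp g))
    have := edge (B.extend K.next) rfl g hiso off
    rw [extend_opp, ← hK, extend_next_apply, extend_next_apply] at this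
    simp only [ne_eq, ← Subtype.ext_iff] at this
    have := this h1 h2 h3 h4
    rw [extend_conjNext hho] at this
    · rw [conjNext_next]; exact this
    · intro x
      simp only [edgeConj, Perm.mul_apply, extend_inv_apply, swap_coe]
    · have off' := off.opp
      rw [← hK] at off'
      apply edgeConj_apply_of_ne off.1.symm off'.1.symm
      · rw [extend_inv_apply]; exact o1.1.symm
      · rw [extend_inv_apply]; exact o2.1.symm
    · have off' := off.opp
      rw [← hK] at off'
      rw [Off, hB] at off off' o1 o2
      apply edgeConj_apply_of_ne off.2.symm off'.2.symm
      · rw [extend_inv_apply]; exact o1.2.symm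
      · rw [extend_inv_apply]; exact o2.2.symm
  · intro g h1 h2
    have off : B.Off h g := off_coe hB g
    have o1 := off_coe hB (K.next (K.opp g))
    have := leaf (B.extend K.next) rfl g hiso off
    rw [extend_opp, ← hK, extend_next_apply, extend_next_apply] at this
    simp only [ne_eq, ← Subtype.ext_iff] at this
    have := this h1 h2
    have off' := off.opp
    rw [← hK] at off'
    rw [extend_conjNext hho] at this
    · rw [conjNext_next]; exact this
    · intro x
      simp only [leafConj, Perm.mul_apply, extend_next_apply, swap_coe]
    · apply leafConj_apply_of_ne off.1.symm off'.1.symm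
      rw [extend_next_apply]; exact o1.1.symm
    · rw [Off, hB] at off off' o1
      apply leafConj_apply_of_ne off.2.symm off'.2.symm
      rw [extend_next_apply]; exact o1.2.symm
  · intro g h1 h2
    have off : B.Off h g := off_coe hB g
    have o1 := off_coe hB (K.next (K.opp g))
    have := loop (B.extend K.next) rfl g hiso off
    rw [extend_opp, ← hK, extend_next_apply, extend_next_apply] at this
    simp only [ne_eq, ← Subtype.ext_iff] at this
    have := this h1 h2
    have off' := off.opp
    rw [← hK] at off'
    rw [extend_conjNext hho] at this
    · rw [conjNext_next]; exact this
    · intro x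
      simp only [loopConj, extend_next_apply, swap_coe]
    · apply loopConj_apply_of_ne off'.1.symm
      rw [extend_next_apply]; exact o1.1.symm
    · rw [Off, hB] at off off' o1
      apply loopConj_apply_of_ne off'.2.symm
      rw [extend_next_apply]; exact o1.2.symm

theorem minimalPeriod_extend (f : Perm (Rest h o)) (x : Rest h o) :
    minimalPeriod (B.extend f).next x = minimalPeriod f x :=
  minimalPeriod_eq_minimalPeriod_iff.2 fun n => by
    have : ∀ n, (B.extend f).next^[n] x = (f^[n] x : Rest h o) := by
      intro n
      induction n with
      | zero => rfl
      | succ n ih => rw [iterate_succ_apply', ih, extend_next_apply, iterate_succ_apply']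
    rw [IsPeriodicPt, IsFixedPt, this, ← Subtype.ext_iff]
    rfl

/-- The perimeter `m` of the face containing the diagonal is preserved along the chain, so the
bounds `2 ≤ k ≤ m ≤ 2 * k` needed by the one-step lemmas persist. -/
theorem reflTransGen_carries [Finite D] {K K' : EmbeddedGraph (Rest h o)}
    (ht : Relation.ReflTransGen Tilting K K')
    (hB : B.opp h = o) (hK : ∀ x, (K.opp x : D) = B.opp x) {k m : ℕ}
    (hk : 2 ≤ k) (hkm : k ≤ m) (hmk : m ≤ 2 * k) {u : Rest h o} (hu : minimalPeriod K.next u = m) :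
    K'.opp = K.opp ∧ ∃ u' : Rest h o, minimalPeriod K'.next u' = m ∧
      ((B.extend K'.next).insertEdge h k u').ObtainableFrom ((B.extend K.next).insertEdge h k u) := by
  induction ht with
  | refl => exact ⟨rfl, u, hu, ObtainableFrom.refl _⟩
  | @tail K' K'' _ ht ih =>
    obtain ⟨ho, u', hm, hu'⟩ := ih
    refine ⟨?_, ?_⟩
    · rw [← ho]
      exact ht.elim (p := fun K'' => K''.opp = K'.opp) (fun _ _ _ _ _ => rfl) (fun _ _ _ => rfl)
        (fun _ _ _ => rfl)
    · have hoff : (B.extend K'.next).Off h u' := off_coe (B := B.extend K'.next) hB u'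
      have hper := (minimalPeriod_extend (B := B) K'.next u').trans hm
      have := ht.elim_extend (B := B) hB (by rw [ho]; exact hK)
        (p := fun L L' => L.Off h (u' : D) → minimalPeriod L.next (u' : D) = m →
          Carries L L' h k u')
        (fun L _ g hL hg h1 h2 h3 h4 a b => carries_edge hL hg h1 h2 h3 h4 a b hk hkm hmk)
        (fun L _ g hL hg h1 h2 a b => carries_leaf hL hg h1 h2 a b hk hkm hmk)
        (fun L _ g hL hg h1 h2 a b => carries_loop hL hg h1 h2 a b hk hkm hmk) hoff hper
      obtain ⟨v, hv, hvm, hvo⟩ := this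
      rw [Off, extend_opp, hB] at hv
      lift v to Rest h o using hv
      rw [minimalPeriod_extend, minimalPeriod_extend, hm] at hvm
      exact ⟨v, hvm, hu'.trans hvo⟩

theorem reflTransGen_carriesLeaf [Finite D] {K K' : EmbeddedGraph (Rest h o)}
    (ht : Relation.ReflTransGen Tilting K K')
    (hB : B.opp h = o) (hK : ∀ x, (K.opp x : D) = B.opp x)
    (hc : ∀ x y, K.next.SameCycle x y) (u : Rest h o) :
    K'.opp = K.opp ∧ (∀ x y, K'.next.SameCycle x y) ∧ ∃ u' : Rest h o,
      ((B.extend K'.next).insertLeaf h u').ObtainableFrom ((B.extend K.next).insertLeaf h u) := by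
  induction ht with
  | refl => exact ⟨rfl, hc, u, ObtainableFrom.refl _⟩
  | @tail K' K'' _ ht ih =>
    obtain ⟨ho, hc', u', hu'⟩ := ih
    refine ⟨?_, ?_, ?_⟩
    · rw [← ho]
      exact ht.elim (p := fun K'' => K''.opp = K'.opp) (fun _ _ _ _ _ => rfl) (fun _ _ _ => rfl)
        (fun _ _ _ => rfl)
    · have aux : ∀ s x y, (K'.conjNext s).next.SameCycle x y := by
        intro s x y
        rw [conjNext_next, sameCycle_conj]
        exact hc' _ _
      exact ht.elim (p := fun K'' => ∀ x y, K''.next.SameCycle x y) (fun _ _ _ _ _ => aux _)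
        (fun _ _ _ => aux _) (fun _ _ _ => aux _)
    · have hoff : (B.extend K'.next).Off h u' := off_coe (B := B.extend K'.next) hB u'
      have hsame : ∀ x y, (B.extend K'.next).Off h x → (B.extend K'.next).Off h y →
          (B.extend K'.next).next.SameCycle x y := by
        intro x y hx hy
        rw [Off, extend_opp, hB] at hx hy
        lift x to Rest h o using hx
        lift y to Rest h o using hy
        obtain ⟨i, rfl⟩ := (hc' x y).exists_nat_pow_eq
        refine ⟨i, ?_⟩
        rw [zpow_natCast]
        induction i with
        | zero => rfl
        | succ n ih => rw [pow_succ', Perm.mul_apply, ih, extend_next_apply, pow_succ',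
            Perm.mul_apply]
      have := ht.elim_extend (B := B) hB (by rw [ho]; exact hK)
        (p := fun L L' => L.Off h (u' : D) → (∀ x y, L.Off h x → L.Off h y → L.next.SameCycle x y) →
          CarriesLeaf L L' h u')
        -- With a single face the leaf can be moved to any dart: `L.next g` is free for a tilting of
        -- type 3 and `g` itself for a leaf. A bounding loop would be a second face.
        (fun L _ g hL hg h1 h2 h3 h4 a b => (tiltingOff_edge hL hg h1 h2 h3 h4).carriesLeaf hL a
          (b _ _ a (hL.off_next_iff.2 hg)) h4 h2)
        (fun L _ g hL hg h1 h2 a b => (tiltingOff_leaf hL hg h1 h2).carriesLeaf hL a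
          (b _ _ a hg) (L.opp_ne g).symm h2.symm)
        (fun L _ g hL hg h1 h2 a b => absurd ((b _ _ hg hg.opp).eq_of_left h1) (L.opp_ne g).symm)
        hoff hsame
      obtain ⟨v, hv, hvo⟩ := this
      rw [Off, extend_opp, hB] at hv
      lift v to Rest h o using hv
      exact ⟨v, hu'.trans hvo⟩

end Extend

end EmbeddedGraph

/-! ### Cycles of a permutation multiplied by a transposition -/

namespace EmbeddedGraph

open Equiv Equiv.Perm Function

section Cycles

variable {D : Type*} [Finite D]

theorem SameCycle.rel {f : Perm D} {r : D → D → Prop} (hr : Equivalence r)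
    (h : ∀ x, r x (f x)) {x y : D} (hxy : f.SameCycle x y) : r x y := by
  obtain ⟨i, rfl⟩ := hxy.exists_nat_pow_eq
  clear hxy
  induction i with
  | zero => exact hr.refl x
  | succ n ih => rw [pow_succ', Perm.mul_apply]; exact hr.trans ih (h _)

omit [Finite D] in
theorem sameCycle_equivalence (f : Perm D) : Equivalence f.SameCycle :=
  ⟨SameCycle.refl f, SameCycle.symm, SameCycle.trans⟩

variable [DecidableEq D]

/-- Starting from `b`, the product follows `f` until the step that would return to `b`; that step is
diverted to `a`. -/
theorem sameCycle_swap_mul_self {f : Perm D} {a b : D} (hab : ¬ f.SameCycle a b) :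
    (swap a b * f).SameCycle b a := by
  have hn := minimalPeriod_pos_of_mem_periodicPts (f.injective.mem_periodicPts b)
  have key : ∀ j, j < minimalPeriod f b → (swap a b * f).SameCycle b ((f ^ j) b) := by
    intro j
    induction j with
    | zero => exact fun _ => SameCycle.refl _ _
    | succ j ih =>
      intro hj
      refine (ih (by omega)).trans ?_
      refine ⟨1, ?_⟩
      rw [zpow_one, Perm.mul_apply, ← Perm.mul_apply f, ← pow_succ', swap_apply_of_ne_of_ne]
      · intro e
        exact hab (SameCycle.symm ⟨(j + 1 : ℕ), by rw [zpow_natCast, e]⟩)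
      · intro e
        exact not_isPeriodicPt_of_pos_of_lt_minimalPeriod (Nat.succ_ne_zero j) hj
          (by rw [IsPeriodicPt, IsFixedPt, iterate_eq_pow, e])
  refine (key (minimalPeriod f b - 1) (by omega)).trans ⟨1, ?_⟩
  have hp : (f ^ minimalPeriod f b) b = b := by
    rw [← iterate_eq_pow, iterate_minimalPeriod]
  rw [zpow_one, Perm.mul_apply, ← Perm.mul_apply f, ← pow_succ', Nat.sub_add_cancel hn, hp,
    swap_apply_right]

theorem SameCycle.swap_mul {f : Perm D} {a b x y : D} (hab : ¬ f.SameCycle a b)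
    (hxy : f.SameCycle x y) : (swap a b * f).SameCycle x y := by
  refine SameCycle.rel (sameCycle_equivalence _) (fun x => ?_) hxy
  have h0 : (swap a b * f).SameCycle x ((swap a b * f) x) :=
    sameCycle_apply_right.2 (SameCycle.refl _ _)
  have h1 := sameCycle_swap_mul_self hab
  rw [Perm.mul_apply] at h0
  by_cases ha : f x = a
  · rw [ha, swap_apply_left] at h0
    exact ha ▸ h0.trans h1
  by_cases hb : f x = b
  · rw [hb, swap_apply_right] at h0
    exact hb ▸ h0.trans h1.symm
  · rwa [swap_apply_of_ne_of_ne ha hb] at h0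

/-- Gluing the classes of `a` and `b` gives an equivalence relation under which each element is
related to its image by the product. -/
theorem SameCycle.of_swap_mul {f : Perm D} {a b x y : D}
    (hxy : (swap a b * f).SameCycle x y) : f.SameCycle x y ∨
      ((f.SameCycle x a ∨ f.SameCycle x b) ∧ (f.SameCycle y a ∨ f.SameCycle y b)) := by
  refine SameCycle.rel (r := fun x y => f.SameCycle x y ∨
      ((f.SameCycle x a ∨ f.SameCycle x b) ∧ (f.SameCycle y a ∨ f.SameCycle y b)))
    ⟨fun x => .inl (SameCycle.refl f x), ?_, ?_⟩ (fun x => ?_) hxy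
  · rintro x y (h | ⟨h1, h2⟩)
    · exact .inl h.symm
    · exact .inr ⟨h2, h1⟩
  · rintro x y z (h | ⟨h1, h2⟩) (k | ⟨k1, k2⟩)
    · exact .inl (h.trans k)
    · exact .inr ⟨k1.imp h.trans h.trans, k2⟩
    · exact .inr ⟨h1, h2.imp k.symm.trans k.symm.trans⟩
    · exact .inr ⟨h1, k2⟩
  · have h0 : f.SameCycle x (f x) := sameCycle_apply_right.2 (SameCycle.refl _ _)
    rw [Perm.mul_apply]
    by_cases ha : f x = a
    · rw [ha, swap_apply_left]
      exact .inr ⟨.inl (ha ▸ h0), .inr (SameCycle.refl _ _)⟩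
    by_cases hb : f x = b
    · rw [hb, swap_apply_right]
      exact .inr ⟨.inr (hb ▸ h0), .inl (SameCycle.refl _ _)⟩
    · rw [swap_apply_of_ne_of_ne ha hb]
      exact .inl h0

/-- Multiplying by a transposition of elements of different cycles joins the two cycles. -/
theorem card_cycles_swap_mul {f : Perm D} {a b : D} (hab : ¬ f.SameCycle a b) :
    Nat.card (Cycles (swap a b * f)) + 1 = Nat.card (Cycles f) := by
  classical
  let A : Cycles f := Quotient.mk _ a
  have hA : ∀ x, (Quotient.mk _ x : Cycles f) ≠ A ↔ ¬ f.SameCycle x a := fun x => by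
    rw [ne_eq, Quotient.eq]; rfl
  -- The cycles of `f` map onto those of the product, and only the cycles of `a` and `b` are
  -- identified; without the cycle of `a` the map is bijective.
  let q : Cycles f → Cycles (swap a b * f) :=
    Quotient.map id (fun x y (h : f.SameCycle x y) => SameCycle.swap_mul hab h)
  have hbij : Bijective (fun F : {F : Cycles f // F ≠ A} => q F.1) := by
    constructor
    · rintro ⟨F, hF⟩ ⟨G, hG⟩ h
      induction F using Quotient.inductionOn with | _ x => ?_
      induction G using Quotient.inductionOn with | _ y => ?_
      rw [hA] at hF hG
      have h' : (swap a b * f).SameCycle x y := Quotient.exact h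
      apply Subtype.ext
      apply Quotient.sound
      rcases SameCycle.of_swap_mul h' with h' | ⟨h1, h2⟩
      · exact h'
      · exact (h1.resolve_left hF).trans (h2.resolve_left hG).symm
    · intro G
      induction G using Quotient.inductionOn with | _ y => ?_
      by_cases hy : f.SameCycle y a
      · refine ⟨⟨Quotient.mk _ b, (hA b).2 fun h => hab h.symm⟩, ?_⟩
        exact Quotient.sound ((sameCycle_swap_mul_self hab).trans (SameCycle.swap_mul hab hy).symm)
      · exact ⟨⟨Quotient.mk _ y, (hA y).2 hy⟩, rfl⟩
  rw [← Nat.card_eq_of_bijective _ hbij, ← Finite.card_option]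
  exact Nat.card_congr (Equiv.optionSubtypeNe A)

end Cycles

/-! ### Counting cycles on the darts of a smaller graph -/

section Count

variable {D : Type*} [Finite D]

theorem two_mul_card_cycles_le {f : Perm D} (hf : ∀ x, f x ≠ x) :
    2 * Nat.card (Cycles f) ≤ Nat.card D := by
  let g : Cycles f ⊕ Cycles f → D := Sum.elim Quotient.out (fun F => f F.out)
  have key : ∀ F : Cycles f, (Quotient.mk _ (f F.out) : Cycles f) = F := fun F => by
    conv_rhs => rw [← Quotient.out_eq F]
    exact Quotient.sound (sameCycle_apply_left.2 (SameCycle.refl _ _))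
  have hg : Injective g := by
    rintro (F | F) (G | G) h
    · exact congrArg _ (Quotient.out_inj.1 h)
    · exfalso
      have h' : F.out = f G.out := h
      have := congrArg (fun x => (Quotient.mk _ x : Cycles f)) h'
      simp only [Quotient.out_eq, key] at this
      subst this
      exact hf _ h'.symm
    · exfalso
      have h' : f F.out = G.out := h
      have := congrArg (fun x => (Quotient.mk _ x : Cycles f)) h'
      simp only [Quotient.out_eq, key] at this
      subst this
      exact hf _ h'
    · exact congrArg _ (Quotient.out_inj.1 (f.injective h))
  have := Nat.card_le_card_of_injective g hg
  rw [Nat.card_sum] at this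
  omega

theorem two_mul_card_cycles_eq {f : Perm D} (hf : ∀ x, f x ≠ x) (h2 : ∀ x, f (f x) = x) :
    2 * Nat.card (Cycles f) = Nat.card D := by
  apply le_antisymm (two_mul_card_cycles_le hf)
  let g : Cycles f ⊕ Cycles f → D := Sum.elim Quotient.out (fun F => f F.out)
  have hg : Surjective g := by
    intro x
    have h : f.SameCycle (Quotient.mk _ x : Cycles f).out x :=
      Quotient.exact (Quotient.out_eq (Quotient.mk _ x : Cycles f))
    have h' : x = (Quotient.mk _ x : Cycles f).out ∨ x = f (Quotient.mk _ x : Cycles f).out := by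
      obtain ⟨i, hi⟩ := h.exists_nat_pow_eq
      generalize (Quotient.mk _ x : Cycles f).out = y at hi
      subst hi
      clear h
      induction i with
      | zero => exact .inl rfl
      | succ n ih =>
        rw [pow_succ', Perm.mul_apply]
        rcases ih with ih | ih
        · rw [ih]; exact .inr rfl
        · rw [ih]; exact .inl (h2 y)
    rcases h' with h' | h'
    · exact ⟨.inl _, h'.symm⟩
    · exact ⟨.inr _, h'.symm⟩
  have := Nat.card_le_card_of_surjective g hg
  rw [Nat.card_sum] at this
  omega

theorem sameCycle_subtypePerm {p : D → Prop} {f : Perm D} (hp : ∀ x, p (f x) ↔ p x)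
    (x y : {x // p x}) : (f.subtypePerm hp).SameCycle x y ↔ f.SameCycle x y := by
  have key : ∀ n : ℕ, (((f.subtypePerm hp) ^ n) x : D) = (f ^ n) x := by
    intro n
    induction n with
    | zero => rfl
    | succ n ih =>
      rw [pow_succ', pow_succ', Perm.mul_apply, Perm.mul_apply, ← ih, Perm.subtypePerm_apply]
  constructor
  · intro h
    obtain ⟨i, rfl⟩ := h.exists_nat_pow_eq
    exact ⟨i, by rw [zpow_natCast, key]⟩
  · intro h
    obtain ⟨i, hi⟩ := h.exists_nat_pow_eq
    exact ⟨i, by rw [zpow_natCast]; exact Subtype.ext ((key i).trans hi)⟩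

theorem card_cycles_subtypePerm {p : D → Prop} {f : Perm D} (hp : ∀ x, p (f x) ↔ p x)
    (hp' : ∀ x, ¬ p (f x) ↔ ¬ p x) :
    Nat.card (Cycles f) =
      Nat.card (Cycles (f.subtypePerm hp)) +
        Nat.card (Cycles (f.subtypePerm (p := fun x => ¬ p x) hp')) := by
  classical
  rw [← Nat.card_sum]
  symm
  let g : Cycles (f.subtypePerm hp) ⊕ Cycles (f.subtypePerm (p := fun x => ¬ p x) hp') → Cycles f :=
    Sum.elim (Quotient.map Subtype.val (fun x y h => (sameCycle_subtypePerm hp x y).1 h))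
      (Quotient.map Subtype.val (fun x y h => (sameCycle_subtypePerm (p := fun x => ¬ p x) hp' x y).1 h))
  have hs : ∀ x y, f.SameCycle x y → (p x ↔ p y) := fun x y h =>
    SameCycle.rel (r := fun x y => p x ↔ p y) ⟨fun _ => Iff.rfl, Iff.symm, Iff.trans⟩
      (fun x => (hp x).symm) h
  refine Nat.card_eq_of_bijective g ⟨?_, ?_⟩
  · rintro (F | F) (G | G) h
    all_goals
      induction F using Quotient.inductionOn with | _ x => ?_
      induction G using Quotient.inductionOn with | _ y => ?_
      have h' : f.SameCycle x y := Quotient.exact h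
    · exact congrArg _ (Quotient.sound ((sameCycle_subtypePerm hp x y).2 h'))
    · exact absurd ((hs _ _ h').1 x.2) y.2
    · exact absurd ((hs _ _ h').2 y.2) x.2
    · exact congrArg _ (Quotient.sound ((sameCycle_subtypePerm (p := fun x => ¬ p x) hp' x y).2 h'))
  · intro F
    induction F using Quotient.inductionOn with | _ x => ?_
    by_cases hx : p x
    · exact ⟨.inl (Quotient.mk _ ⟨x, hx⟩), rfl⟩
    · exact ⟨.inr (Quotient.mk _ ⟨x, hx⟩), rfl⟩

theorem card_cycles_rest_of_swap {h o : D} {f : Perm D} (h1 : f h = o) (h2 : f o = h)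
    (hp : ∀ x, (f x ≠ h ∧ f x ≠ o) ↔ (x ≠ h ∧ x ≠ o)) :
    Nat.card (Cycles f) = Nat.card (Cycles (f.subtypePerm hp : Perm (Rest h o))) + 1 := by
  rw [card_cycles_subtypePerm (p := fun x => x ≠ h ∧ x ≠ o) hp (fun x => not_congr (hp x))]
  congr 1
  rw [Nat.card_eq_one_iff_unique]
  refine ⟨⟨fun F G => ?_⟩, ⟨Quotient.mk _ ⟨h, by simp⟩⟩⟩
  induction F using Quotient.inductionOn with | _ x => ?_
  induction G using Quotient.inductionOn with | _ y => ?_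
  apply Quotient.sound
  refine (sameCycle_subtypePerm (p := fun x => ¬ (x ≠ h ∧ x ≠ o)) _ x y).2 ?_
  have aux : ∀ x : {x : D // ¬ (x ≠ h ∧ x ≠ o)}, f.SameCycle h x := by
    rintro ⟨x, hx⟩
    have : x = h ∨ x = o := by tauto
    rcases this with rfl | rfl
    · exact SameCycle.refl _ _
    · exact ⟨1, by simpa using h1⟩
  exact (aux x).symm.trans (aux y)

theorem card_cycles_rest_of_fixed {h o : D} {f : Perm D} (hho : h ≠ o) (h1 : f h = h)
    (h2 : f o = o) (hp : ∀ x, (f x ≠ h ∧ f x ≠ o) ↔ (x ≠ h ∧ x ≠ o)) :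
    Nat.card (Cycles f) = Nat.card (Cycles (f.subtypePerm hp : Perm (Rest h o))) + 2 := by
  rw [card_cycles_subtypePerm (p := fun x => x ≠ h ∧ x ≠ o) hp (fun x => not_congr (hp x))]
  congr 1
  have e : f.subtypePerm (p := fun x => ¬ (x ≠ h ∧ x ≠ o)) (fun x => not_congr (hp x)) = 1 := by
    ext ⟨x, hx⟩
    have : x = h ∨ x = o := by tauto
    rcases this with rfl | rfl
    · exact h1
    · exact h2
  rw [e]
  have hq : Bijective (fun b : Bool => (Quotient.mk _ (bif b then ⟨h, by simp⟩ else ⟨o, by simp⟩) :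
      Cycles (1 : Perm {x : D // ¬ (x ≠ h ∧ x ≠ o)}))) := by
    constructor
    · intro b c hbc
      have := sameCycle_one.1 (Quotient.exact hbc)
      cases b <;> cases c <;> simp_all
    · intro F
      induction F using Quotient.inductionOn with | _ x => ?_
      obtain ⟨x, hx⟩ := x
      have : x = h ∨ x = o := by tauto
      rcases this with rfl | rfl
      · exact ⟨true, rfl⟩
      · exact ⟨false, rfl⟩
  rw [← Nat.card_eq_of_bijective _ hq]
  simp

end Count

end EmbeddedGraph

/-! ### Connectedness and planarity after removing an edge -/

namespace EmbeddedGraph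

open Equiv Equiv.Perm Function

section Connected

variable {D : Type*}

/-- Quantifying over invariant equivalence relations avoids words in the generators: connectedness
can then be transferred by pulling a relation back along a map of darts. -/
theorem connected_iff (G : EmbeddedGraph D) : G.Connected ↔
    ∀ r : D → D → Prop, Equivalence r → (∀ x, r x (G.next x)) → (∀ x, r x (G.opp x)) →
      ∀ x y, r x y := by
  constructor
  · intro hG r hr h1 h2 x y
    obtain ⟨g, hg, rfl⟩ := hG x y
    induction hg using Subgroup.closure_induction generalizing x with
    | mem g hg =>
      rcases hg with rfl | rfl
      · rw [rot_apply]
        exact hr.trans (h2 x) (h1 _)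
      · exact h2 x
    | one => exact hr.refl x
    | mul g k _ _ ihg ihk => exact hr.trans (ihk x) (ihg _)
    | inv g _ ih =>
      have := ih (g⁻¹ x)
      rw [apply_inv_self] at this
      exact hr.symm this
  · intro hG
    have ho : G.opp ∈ Subgroup.closure ({G.rot, G.opp} : Set (Perm D)) :=
      Subgroup.subset_closure (by simp)
    have hr : G.rot ∈ Subgroup.closure ({G.rot, G.opp} : Set (Perm D)) :=
      Subgroup.subset_closure (by simp)
    refine hG _ ⟨fun x => ⟨1, one_mem _, rfl⟩, ?_, ?_⟩ (fun x => ⟨_, mul_mem hr ho, rfl⟩)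
      (fun x => ⟨_, ho, rfl⟩)
    · rintro x y ⟨g, hg, rfl⟩
      exact ⟨g⁻¹, inv_mem hg, inv_apply_self g x⟩
    · rintro x y z ⟨g, hg, rfl⟩ ⟨k, hk, rfl⟩
      exact ⟨k * g, mul_mem hk hg, rfl⟩

end Connected

section Core

variable {D : Type*} {B : EmbeddedGraph D} {h o : D}

theorem IsIsolated.rot_left (hB : B.IsIsolated h) : B.rot h = h := by rw [rot_apply, hB.2]

theorem IsIsolated.rot_right (hB : B.IsIsolated h) (ho : B.opp h = o) : B.rot o = o := by
  rw [rot_apply, ← ho, B.opp_opp, hB.1]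

theorem off_eq (ho : B.opp h = o) (x : D) : B.Off h x ↔ x ≠ h ∧ x ≠ o := by rw [Off, ho]

theorem Off.opp_iff {x : D} : B.Off h (B.opp x) ↔ B.Off h x :=
  ⟨fun hx => by simpa using hx.opp, Off.opp⟩

/-- The graph without its isolated edge. -/
def core (hB : B.IsIsolated h) (ho : B.opp h = o) : EmbeddedGraph (Rest h o) where
  rot := B.rot.subtypePerm (fun x => by
    simp only [← off_eq ho, rot_apply, hB.off_next_iff, Off.opp_iff])
  opp := B.opp.subtypePerm (fun x => by simp only [← off_eq ho, Off.opp_iff])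
  opp_opp x := by simp
  opp_ne x e := B.opp_ne x (congrArg Subtype.val e)

theorem core_opp (hB : B.IsIsolated h) (ho : B.opp h = o) (x : Rest h o) :
    ((core hB ho).opp x : D) = B.opp x := rfl

theorem core_next (hB : B.IsIsolated h) (ho : B.opp h = o) : (core hB ho).next =
    B.next.subtypePerm (fun x => by simp only [← off_eq ho, hB.off_next_iff]) := rfl

theorem core_next_apply (hB : B.IsIsolated h) (ho : B.opp h = o) (x : Rest h o) :
    ((core hB ho).next x : D) = B.next x := rfl

theorem card_vertex_core [Finite D] (hB : B.IsIsolated h) (ho : B.opp h = o) :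
    Nat.card (Cycles B.rot) = Nat.card (core hB ho).Vertex + 2 :=
  card_cycles_rest_of_fixed (fun e => B.opp_ne h (ho.trans e.symm)) hB.rot_left (hB.rot_right ho)
    fun x => by simp only [← off_eq ho, rot_apply, hB.off_next_iff, Off.opp_iff]

theorem card_face_core [Finite D] (hB : B.IsIsolated h) (ho : B.opp h = o) :
    Nat.card (Cycles B.next) = Nat.card (core hB ho).Face + 1 :=
  card_cycles_rest_of_swap (by rw [hB.1, ho]) (by rw [← ho, hB.2])
    fun x => by simp only [← off_eq ho, hB.off_next_iff]

theorem card_edge_core [Finite D] (hB : B.IsIsolated h) (ho : B.opp h = o) :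
    Nat.card (Cycles B.opp) = Nat.card (core hB ho).Edge + 1 :=
  card_cycles_rest_of_swap ho (by rw [← ho, B.opp_opp])
    fun x => by simp only [← off_eq ho, Off.opp_iff]

theorem IsIsolated.not_sameCycle [Finite D] (hB : B.IsIsolated h) {u x : D} (hu : B.Off h u)
    (hx : ¬ B.Off h x) : ¬ B.next.SameCycle u x := by
  intro hs
  obtain ⟨i, rfl⟩ := hs.exists_nat_pow_eq
  exact hx ((hB.off_pow_iff i).2 hu)

variable [DecidableEq D]

theorem extend_core (hB : B.IsIsolated h) (ho : B.opp h = o) :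
    B.extend (core hB ho).next = B := by
  ext x
  · by_cases a : x = h
    · subst a; rw [extend_next_left, hB.1, ho]
    by_cases b : x = o
    · subst b; rw [extend_next_right, ← ho, hB.2]
    lift x to Rest h o using ⟨a, b⟩
    rw [extend_next_apply, core_next_apply]
  · rfl

/-- The map `π` collapses the removed edge to the dart `u`. `G.next` differs from `B.next` only
within the face of `u` and the removed edge, so a relation on the core pulls back along `π` to one
invariant under `G`. -/
theorem connected_core {G : EmbeddedGraph D} (hB : B.IsIsolated h) (ho : B.opp h = o)
    (hG : G.Connected) (hGo : G.opp = B.opp) {u : D} (hu : B.Off h u)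
    (hn : ∀ x, G.next x = B.next x ∨
      (B.next.SameCycle u (B.next x) ∨ ¬ B.Off h (B.next x)) ∧
      (B.next.SameCycle u (G.next x) ∨ ¬ B.Off h (G.next x))) [Finite D] :
    (core hB ho).Connected := by
  rw [connected_iff] at hG ⊢
  intro r hr h1 h2 x y
  classical
  have hu' : u ≠ h ∧ u ≠ o := (off_eq ho u).1 hu
  let π : D → Rest h o := fun x => if hx : x ≠ h ∧ x ≠ o then ⟨x, hx⟩ else ⟨u, hu'⟩
  have hπ : ∀ (x : D) (hx : x ≠ h ∧ x ≠ o), π x = ⟨x, hx⟩ := fun x hx => dif_pos hx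
  have hπ' : ∀ (x : D), ¬ (x ≠ h ∧ x ≠ o) → π x = ⟨u, hu'⟩ := fun x hx => dif_neg hx
  have step : ∀ x, r (π x) (π (B.next x)) := by
    intro x
    by_cases hx : x ≠ h ∧ x ≠ o
    · have hy : B.next x ≠ h ∧ B.next x ≠ o := by
        rw [← off_eq ho] at hx ⊢
        exact hB.off_next_iff.2 hx
      rw [hπ _ hx, hπ _ hy]
      exact h1 ⟨x, hx⟩
    · have hy : ¬ (B.next x ≠ h ∧ B.next x ≠ o) := by
        rw [← off_eq ho] at hx ⊢
        rwa [hB.off_next_iff]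
      rw [hπ' _ hx, hπ' _ hy]
      exact hr.refl _
  have cyc : ∀ x, B.next.SameCycle u x ∨ ¬ B.Off h x → r ⟨u, hu'⟩ (π x) := by
    rintro x (hx | hx)
    · rw [← hπ u hu']
      exact SameCycle.rel (r := fun x y => r (π x) (π y))
        ⟨fun _ => hr.refl _, hr.symm, hr.trans⟩ step hx
    · rw [off_eq ho] at hx
      rw [hπ' x hx]
      exact hr.refl _
  have := hG (fun x y => r (π x) (π y)) ⟨fun _ => hr.refl _, hr.symm, hr.trans⟩ ?_ ?_ x y
  · rwa [hπ _ x.2, hπ _ y.2] at this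
  · intro x
    rcases hn x with e | ⟨e1, e2⟩
    · simp only [e]
      exact step x
    · exact hr.trans (step x) (hr.trans (hr.symm (cyc _ e1)) (cyc _ e2))
  · intro x
    simp only [hGo]
    by_cases hx : x ≠ h ∧ x ≠ o
    · have hy : B.opp x ≠ h ∧ B.opp x ≠ o := by
        rw [← off_eq ho] at hx ⊢
        exact hx.opp
      rw [hπ _ hx, hπ _ hy]
      exact h2 ⟨x, hx⟩
    · have hy : ¬ (B.opp x ≠ h ∧ B.opp x ≠ o) := by
        rw [← off_eq ho] at hx ⊢
        rwa [Off.opp_iff]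
      rw [hπ' _ hx, hπ' _ hy]
      exact hr.refl _

/-- Each end of the diagonal absorbs one isolated vertex, so the core has as many vertices as the
graph. Since `u` and `o` are in different faces, the diagonal splits a face, so the core has one
face less, and also one edge less. -/
theorem isPlane_core_of_insertEdge [Finite D] (hB : B.IsIsolated h) (ho : B.opp h = o) {k : ℕ}
    {u : D} (hu : B.Off h u) (hG : (B.insertEdge h k u).IsPlane)
    (huo : ¬ (B.insertEdge h k u).next.SameCycle u o) : (core hB ho).IsPlane := by
  have hho : h ≠ o := fun e => B.opp_ne h (ho.trans e.symm)
  have hw := (hB.off_pow_iff k).2 hu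
  have huw : B.next.SameCycle u ((B.next ^ k) u) := ⟨k, by rw [zpow_natCast]⟩
  have hnext : (B.insertEdge h k u).next = swap u o * swap ((B.next ^ k) u) h * B.next := by
    rw [insertEdge_next, ho]
  obtain ⟨hc, he⟩ := hG
  have hu' := (off_eq ho u).1 hu
  have hw' := (off_eq ho _).1 hw
  set w := (B.next ^ k) u with hwd
  have hh : ¬ B.Off h h := fun e => e.1 rfl
  have hoff : ¬ B.Off h o := fun e => e.2 ho.symm
  refine ⟨connected_core hB ho hc rfl hu (fun x => ?_), ?_⟩
  · rw [hnext, Perm.mul_apply, Perm.mul_apply]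
    by_cases a : B.next x = w
    · right
      rw [a, swap_apply_left, swap_apply_of_ne_of_ne hu'.1.symm hho]
      exact ⟨.inl huw, .inr hh⟩
    by_cases b : B.next x = h
    · right
      rw [b, swap_apply_right]
      refine ⟨.inr hh, ?_⟩
      by_cases c : w = u
      · rw [c, swap_apply_left]
        exact .inr hoff
      · rw [swap_apply_of_ne_of_ne c hw'.2]
        exact .inl huw
    rw [swap_apply_of_ne_of_ne a b]
    by_cases c : B.next x = u
    · right
      rw [c, swap_apply_left]
      exact ⟨.inl (SameCycle.refl _ _), .inr hoff⟩
    by_cases d : B.next x = o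
    · right
      rw [d, swap_apply_right]
      exact ⟨.inr hoff, .inl (SameCycle.refl _ _)⟩
    left
    rw [swap_apply_of_ne_of_ne c d]
  · have hrot : (B.insertEdge h k u).rot = swap u o * (swap w h * B.rot) := by
      rw [rot_eq, hnext, insertEdge_opp, mul_assoc, mul_assoc, ← rot_eq]
    have v1 : ¬ B.rot.SameCycle w h := fun hs =>
      hw'.1 (hs.symm.eq_of_left hB.rot_left).symm
    have v2 : ¬ (swap w h * B.rot).SameCycle u o := fun hs => by
      refine hu'.2 (hs.symm.eq_of_left ?_).symm
      rw [IsFixedPt, Perm.mul_apply, hB.rot_right ho, swap_apply_of_ne_of_ne hw'.2.symm hho.symm]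
    have c1 := card_cycles_swap_mul v1
    have c2 := card_cycles_swap_mul v2
    rw [← hrot] at c2
    have f1 : ¬ B.next.SameCycle w h := hB.not_sameCycle hw hh
    have c3 := card_cycles_swap_mul f1
    have c4 := card_cycles_swap_mul huo
    have e4 : swap u o * (B.insertEdge h k u).next = swap w h * B.next := by
      -- Undoing the second transposition leaves the graph with one end attached, whose faces were
      -- counted by joining the isolated face to that of `w`.
      rw [hnext, ← mul_assoc, ← mul_assoc, swap_mul_self, one_mul]
    rw [e4] at c4
    have d1 := card_vertex_core hB ho
    have d2 := card_face_core hB ho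
    have d3 := card_edge_core hB ho
    simp only [Vertex, Face, Edge, insertEdge_opp] at *
    omega

/-- Removing a leaf removes one vertex and one edge and keeps the number of faces. -/
theorem isPlane_core_of_insertLeaf [Finite D] (hB : B.IsIsolated h) (ho : B.opp h = o)
    {u : D} (hu : B.Off h u) (hG : (B.insertLeaf h u).IsPlane) : (core hB ho).IsPlane := by
  have hho : h ≠ o := fun e => B.opp_ne h (ho.trans e.symm)
  obtain ⟨hc, he⟩ := hG
  have hu' := (off_eq ho u).1 hu
  have hh : ¬ B.Off h h := fun e => e.1 rfl
  refine ⟨connected_core hB ho hc rfl hu (fun x => ?_), ?_⟩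
  · rw [insertLeaf_next, Perm.mul_apply]
    by_cases a : B.next x = u
    · right
      rw [a, swap_apply_left]
      exact ⟨.inl (SameCycle.refl _ _), .inr hh⟩
    by_cases b : B.next x = h
    · right
      rw [b, swap_apply_right]
      exact ⟨.inr hh, .inl (SameCycle.refl _ _)⟩
    left
    rw [swap_apply_of_ne_of_ne a b]
  · have hrot : (B.insertLeaf h u).rot = swap u h * B.rot := by
      rw [rot_eq, insertLeaf_next, insertLeaf_opp, mul_assoc, ← rot_eq]
    have v1 : ¬ B.rot.SameCycle u h := fun hs =>
      hu'.1 (hs.symm.eq_of_left hB.rot_left).symm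
    have c1 := card_cycles_swap_mul v1
    rw [← hrot] at c1
    have f1 : ¬ B.next.SameCycle u h := hB.not_sameCycle hu hh
    have c3 := card_cycles_swap_mul f1
    rw [← insertLeaf_next] at c3
    have d1 := card_vertex_core hB ho
    have d2 := card_face_core hB ho
    have d3 := card_edge_core hB ho
    simp only [Vertex, Face, Edge, insertLeaf_opp] at *
    omega

end Core

end EmbeddedGraph

/-! ### Merging two faces by deleting an edge -/

namespace EmbeddedGraph

open Equiv Equiv.Perm Function

section Periods

variable {D : Type*}

theorem pow_minimalPeriod_apply (f : Perm D) (x : D) : (f ^ minimalPeriod f x) x = x := by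
  rw [← iterate_eq_pow, iterate_minimalPeriod]

theorem pow_apply_injOn {f : Perm D} {x : D} {i j : ℕ} (hi : i < minimalPeriod f x)
    (hj : j < minimalPeriod f x) (h : (f ^ i) x = (f ^ j) x) : i = j := by
  rw [← iterate_eq_pow, ← iterate_eq_pow] at h
  exact iterate_injOn_Iio_minimalPeriod hi hj h

theorem minimalPeriod_eq_of {f : Perm D} {x : D} {m : ℕ} (hm : 0 < m) (h : (f ^ m) x = x)
    (hne : ∀ i, 0 < i → i < m → (f ^ i) x ≠ x) : minimalPeriod f x = m := by
  have hp : IsPeriodicPt f m x := by rw [IsPeriodicPt, IsFixedPt, iterate_eq_pow, h]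
  apply le_antisymm (hp.minimalPeriod_le hm)
  by_contra hlt
  push Not at hlt
  refine hne _ (hp.minimalPeriod_pos hm) hlt (pow_minimalPeriod_apply f x)

theorem minimalPeriod_pos_perm [Finite D] (f : Perm D) (x : D) : 0 < minimalPeriod f x :=
  minimalPeriod_pos_of_mem_periodicPts (f.injective.mem_periodicPts x)

theorem sameCycle_pow (f : Perm D) (x : D) (i : ℕ) : f.SameCycle x ((f ^ i) x) :=
  ⟨i, by rw [zpow_natCast]⟩

theorem SameCycle.exists_pow_lt [Finite D] {f : Perm D} {x y : D} (h : f.SameCycle x y) :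
    ∃ i < minimalPeriod f x, (f ^ i) x = y := by
  obtain ⟨i, rfl⟩ := h.exists_nat_pow_eq
  refine ⟨i % minimalPeriod f x, Nat.mod_lt _ (minimalPeriod_pos_perm f x), ?_⟩
  rw [← iterate_eq_pow, ← iterate_eq_pow, iterate_mod_minimalPeriod_eq]

end Periods

section Delete

variable {D : Type*} [DecidableEq D]

/-- The successor of the dart `o` once its edge has been deleted, if `u` is the successor of the
opposite dart. -/
def succAt (f : Perm D) (u o : D) : D := if f o = o then u else f o

/-- `Next` after the deletion of the edge with darts `h`, `o` between two different faces, kept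
as an isolated edge. -/
def mergeNext (f : Perm D) (h o : D) : Perm D :=
  swap (succAt f (f h) o) h * swap (f h) o * f

variable {f : Perm D} {h o : D}

theorem mergeNext_of_ne {x : D} (h1 : f x ≠ f h) (h2 : f x ≠ o) (h3 : f x ≠ succAt f (f h) o)
    (h4 : f x ≠ h) : mergeNext f h o x = f x := by
  rw [mergeNext, Perm.mul_apply, Perm.mul_apply, swap_apply_of_ne_of_ne h1 h2,
    swap_apply_of_ne_of_ne h3 h4]

variable [Finite D]

/-- With `a`, `b` the perimeters of the faces of `h` and `o`, the merged face reads `f h, …, f^(a-1)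
h, f o, …, f^(b-1) o`. The second block is empty when `o` is alone in its face, and then `succAt`
closes the first block. -/
theorem mergeNext_facts (hho : ¬ f.SameCycle h o) (hu : f h ≠ h) :
    mergeNext f h o h = o ∧ mergeNext f h o o = h ∧
    (mergeNext f h o ^ (minimalPeriod f h - 1)) (f h) = succAt f (f h) o ∧
    minimalPeriod (mergeNext f h o) (f h) = minimalPeriod f h + minimalPeriod f o - 2 ∧
    (∀ v, ¬ f.SameCycle h v → ¬ f.SameCycle o v →
      minimalPeriod (mergeNext f h o) v = minimalPeriod f v) ∧
    (∀ v, v ≠ h → v ≠ o → f.SameCycle h v ∨ f.SameCycle o v →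
      (mergeNext f h o).SameCycle (f h) v) := by
  have hne : h ≠ o := fun e => hho (e ▸ SameCycle.refl _ _)
  have huo : f h ≠ o := fun e => hho (e ▸ sameCycle_apply_right.2 (SameCycle.refl _ _))
  have da := minimalPeriod_pos_perm f h
  have db := minimalPeriod_pos_perm f o
  have da1 : minimalPeriod f h ≠ 1 := fun e => hu (minimalPeriod_eq_one_iff_isFixedPt.1 e)
  have hfa := pow_minimalPeriod_apply f h
  have hfb := pow_minimalPeriod_apply f o
  set a := minimalPeriod f h with ha
  set b := minimalPeriod f o with hb
  have hw : succAt f (f h) o = f h ∧ f o = o ∧ b = 1 ∨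
      succAt f (f h) o = f o ∧ f o ≠ o ∧ 2 ≤ b := by
    unfold succAt
    split_ifs with e
    · exact .inl ⟨rfl, e, minimalPeriod_eq_one_iff_isFixedPt.2 e⟩
    · have : b ≠ 1 := fun e' => e (minimalPeriod_eq_one_iff_isFixedPt.1 e')
      exact .inr ⟨rfl, e, by omega⟩
  have hwo : succAt f (f h) o ≠ o ∧ succAt f (f h) o ≠ h := by
    rcases hw with ⟨e, -, -⟩ | ⟨e, e', -⟩ <;> rw [e]
    · exact ⟨huo, hu⟩
    · exact ⟨e', fun e => hho (e ▸ sameCycle_apply_left.2 (SameCycle.refl _ _))⟩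
  have hwsame : f.SameCycle h (succAt f (f h) o) ∨ f.SameCycle o (succAt f (f h) o) := by
    rcases hw with ⟨e, -, -⟩ | ⟨e, e', -⟩ <;> rw [e]
    · exact .inl (sameCycle_apply_right.2 (SameCycle.refl _ _))
    · exact .inr (sameCycle_apply_right.2 (SameCycle.refl _ _))
  have m1 : mergeNext f h o h = o := by
    rw [mergeNext, Perm.mul_apply, Perm.mul_apply, swap_apply_left,
      swap_apply_of_ne_of_ne hwo.1.symm hne.symm]
  have m2 : mergeNext f h o o = h := by
    rw [mergeNext, Perm.mul_apply, Perm.mul_apply]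
    rcases hw with ⟨e, e', -⟩ | ⟨e, e', -⟩
    · rw [e, e', swap_apply_right, swap_apply_left]
    · rw [e, swap_apply_of_ne_of_ne (fun e => hne (f.injective e.symm)) e', swap_apply_left]
  have m3 : ∀ x, f x = h → mergeNext f h o x = succAt f (f h) o := by
    intro x hx
    rw [mergeNext, Perm.mul_apply, Perm.mul_apply, hx, swap_apply_of_ne_of_ne hu.symm hne,
      swap_apply_right]
  have m4 : ∀ x, x ≠ o → f x = o → mergeNext f h o x = f h := by
    intro x hxo hx
    rw [mergeNext, Perm.mul_apply, Perm.mul_apply, hx, swap_apply_right]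
    rcases hw with ⟨e, e', -⟩ | ⟨e, e', -⟩
    · exact absurd (f.injective (hx.trans e'.symm)) hxo
    · rw [e, swap_apply_of_ne_of_ne (fun e => hne (f.injective e)) hu]
  set w := succAt f (f h) o with hwdef
  set ψ := mergeNext f h o with hψ
  have p1 : ∀ i, i < a - 1 → (ψ ^ i) (f h) = (f ^ (i + 1)) h := by
    intro i
    induction i with
    | zero => intro _; rw [zero_add, pow_one, pow_zero, Perm.one_apply]
    | succ i ih =>
      intro hi
      have e1 : f ((f ^ (i + 1)) h) = (f ^ (i + 1 + 1)) h := by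
        rw [pow_succ' f (i + 1), Perm.mul_apply]
      have hs := sameCycle_pow f h (i + 1 + 1)
      rw [pow_succ', Perm.mul_apply, ih (by omega), ← e1]
      apply mergeNext_of_ne
      · intro e
        have := f.injective e
        have := pow_apply_injOn (j := 0) (by omega) (by omega)
          (this.trans (by rw [pow_zero, Perm.one_apply]))
        omega
      · rw [e1]; exact fun e => hho (e ▸ hs)
      · rcases hw with ⟨e, -, -⟩ | ⟨e, -, -⟩
        · rw [← hwdef, e]
          intro e
          have := f.injective e
          have := pow_apply_injOn (j := 0) (by omega) (by omega)
            (this.trans (by rw [pow_zero, Perm.one_apply]))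
          omega
        · rw [← hwdef, e, e1]
          intro e'
          rw [e'] at hs
          exact hho (sameCycle_apply_right.1 hs)
      · rw [e1]
        intro e
        have := pow_apply_injOn (j := 0) (by omega) (by omega)
          (e.trans (by rw [pow_zero, Perm.one_apply]))
        omega
  have p2 : (ψ ^ (a - 1)) (f h) = w := by
    have e : a - 1 = (a - 2) + 1 := by omega
    rw [e, pow_succ', Perm.mul_apply, p1 _ (by omega)]
    apply m3
    rw [← Perm.mul_apply, ← pow_succ', show a - 2 + 1 + 1 = a by omega, hfa]
  have p3 : ∀ j, j < b - 1 → (ψ ^ j) w = (f ^ (j + 1)) o := by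
    intro j
    induction j with
    | zero =>
      intro hj
      rcases hw with ⟨-, -, e⟩ | ⟨e, -, -⟩
      · omega
      · rw [zero_add, pow_one, pow_zero, Perm.one_apply, e]
    | succ j ih =>
      intro hj
      have e1 : f ((f ^ (j + 1)) o) = (f ^ (j + 1 + 1)) o := by
        rw [pow_succ' f (j + 1), Perm.mul_apply]
      have hs := sameCycle_pow f o (j + 1 + 1)
      rw [pow_succ', Perm.mul_apply, ih (by omega), ← e1]
      apply mergeNext_of_ne
      · intro e
        rw [e1] at e
        rw [e] at hs
        exact hho (sameCycle_apply_right.1 hs).symm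
      · rw [e1]
        intro e
        have := pow_apply_injOn (j := 0) (by omega) (by omega)
          (e.trans (by rw [pow_zero, Perm.one_apply]))
        omega
      · rcases hw with ⟨-, -, e⟩ | ⟨e, -, -⟩
        · omega
        · rw [← hwdef, e]
          intro e'
          have := f.injective e'
          have := pow_apply_injOn (j := 0) (by omega) (by omega)
            (this.trans (by rw [pow_zero, Perm.one_apply]))
          omega
      · rw [e1]
        intro e
        rw [e] at hs
        exact hho hs.symm
  have p4 : (ψ ^ (b - 1)) w = f h := by
    rcases hw with ⟨e, -, e'⟩ | ⟨e, -, e'⟩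
    · rw [e', e]; rfl
    · have e2 : b - 1 = (b - 2) + 1 := by omega
      rw [e2, pow_succ', Perm.mul_apply, p3 _ (by omega)]
      apply m4
      · intro e
        have := pow_apply_injOn (j := 0) (by omega) (by omega)
          (e.trans (by rw [pow_zero, Perm.one_apply]))
        omega
      · rw [← Perm.mul_apply, ← pow_succ', show b - 2 + 1 + 1 = b by omega, hfb]
  have p5 : ∀ j, (ψ ^ (j + (a - 1))) (f h) = (ψ ^ j) w := fun j => by
    rw [pow_add, Perm.mul_apply, p2]
  refine ⟨m1, m2, p2, ?_, ?_, ?_⟩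
  · apply minimalPeriod_eq_of (by omega)
    · rw [show a + b - 2 = (b - 1) + (a - 1) by omega, p5, p4]
    · intro i h0 hi
      by_cases hia : i < a - 1
      · rw [p1 i hia, pow_succ', Perm.mul_apply]
        intro e
        have := f.injective e
        have := pow_apply_injOn (j := 0) (by omega) (by omega)
          (this.trans (by rw [pow_zero, Perm.one_apply]))
        omega
      · rw [show i = (i - (a - 1)) + (a - 1) by omega, p5, p3 _ (by omega)]
        intro e
        have hs := sameCycle_pow f o (i - (a - 1) + 1)
        rw [e] at hs
        exact hho (sameCycle_apply_right.1 hs).symm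
  · intro v h1 h2
    have key : ∀ i, (ψ ^ i) v = (f ^ i) v := by
      intro i
      induction i with
      | zero => rfl
      | succ i ih =>
        have hs := sameCycle_pow f v (i + 1)
        have e1 : f ((f ^ i) v) = (f ^ (i + 1)) v := by rw [pow_succ', Perm.mul_apply]
        rw [pow_succ', Perm.mul_apply, ih, ← e1]
        apply mergeNext_of_ne
        · intro e
          rw [e1] at e
          rw [e] at hs
          exact h1 (sameCycle_apply_right.1 hs).symm
        · rw [e1]
          intro e
          rw [e] at hs
          exact h2 hs.symm
        · rw [e1]
          intro e
          rw [e] at hs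
          rcases hwsame with q | q
          · exact h1 (q.trans hs.symm)
          · exact h2 (q.trans hs.symm)
        · rw [e1]
          intro e
          rw [e] at hs
          exact h1 hs.symm
    apply minimalPeriod_eq_of (minimalPeriod_pos_perm f v)
    · rw [key, pow_minimalPeriod_apply]
    · intro i h0 hi e
      rw [key] at e
      have := pow_apply_injOn (j := 0) hi (by omega) (e.trans (by rw [pow_zero, Perm.one_apply]))
      omega
  · rintro v v1 v2 (hv | hv)
    · obtain ⟨i, hi, rfl⟩ := SameCycle.exists_pow_lt hv
      obtain ⟨i, rfl⟩ := Nat.exists_eq_succ_of_ne_zero (fun e : i = 0 => v1 (by rw [e]; rfl))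
      rw [Nat.succ_eq_add_one, ← p1 i (by omega)]
      exact sameCycle_pow _ _ _
    · obtain ⟨i, hi, rfl⟩ := SameCycle.exists_pow_lt hv
      obtain ⟨i, rfl⟩ := Nat.exists_eq_succ_of_ne_zero (fun e : i = 0 => v2 (by rw [e]; rfl))
      rw [Nat.succ_eq_add_one, ← p3 i (by omega), ← p5]
      exact sameCycle_pow _ _ _

theorem insertEdge_mergeNext (G : EmbeddedGraph D) (ho : G.opp h = o)
    (hho : ¬ G.next.SameCycle h o) (hu : G.next h ≠ h) :
    (G.withNext (mergeNext G.next h o)).insertEdge h (minimalPeriod G.next h - 1) (G.next h) =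
      G := by
  obtain ⟨-, -, e, -⟩ := mergeNext_facts hho hu
  ext1
  · rw [insertEdge_next, withNext_next, e, withNext_opp, ho, mergeNext, mul_assoc, ← mul_assoc,
      ← mul_assoc, ← mul_assoc]
    rw [mul_assoc (swap (G.next h) o), swap_mul_self, mul_one, swap_mul_self, one_mul]
  · rfl

end Delete

/-! ### Transferring an inserted edge along a chain between cores -/

section Transfer

variable {D : Type*} [DecidableEq D] {h o : D}

theorem insertEdge_isomorphic {L M : EmbeddedGraph D} (e : Perm D)
    (h1 : ∀ x, e (L.next x) = M.next (e x)) (h2 : ∀ x, e (L.opp x) = M.opp (e x)) (eh : e h = h)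
    (k : ℕ) (u : D) : (L.insertEdge h k u).Isomorphic (M.insertEdge h k (e u)) := by
  have hp : ∀ x, e ((L.next ^ k) x) = (M.next ^ k) (e x) := by
    induction k with
    | zero => exact fun _ => rfl
    | succ k ih => intro x; rw [pow_succ', pow_succ', Perm.mul_apply, Perm.mul_apply, h1, ih]
  refine isomorphic_iff.2 ⟨e, fun x => ?_, h2⟩
  rw [insertEdge_next, insertEdge_next, Perm.mul_apply, Perm.mul_apply, Perm.mul_apply,
    Perm.mul_apply, apply_swap_apply e, apply_swap_apply e, h1, hp, eh, h2, eh]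

theorem insertLeaf_isomorphic {L M : EmbeddedGraph D} (e : Perm D)
    (h1 : ∀ x, e (L.next x) = M.next (e x)) (h2 : ∀ x, e (L.opp x) = M.opp (e x)) (eh : e h = h)
    (u : D) : (L.insertLeaf h u).Isomorphic (M.insertLeaf h (e u)) := by
  refine isomorphic_iff.2 ⟨e, fun x => ?_, h2⟩
  rw [insertLeaf_next, insertLeaf_next, Perm.mul_apply, Perm.mul_apply, apply_swap_apply e, h1, eh]

theorem exists_extend_isomorphism {B B' : EmbeddedGraph D} (hB : B.opp h = o)
    (hB' : B'.opp h = o) (hI : B'.IsIsolated h) {K : EmbeddedGraph (Rest h o)}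
    (hK : ∀ x, (K.opp x : D) = B.opp x) (e : Rest h o ≃ Rest h o)
    (h1 : ∀ x, e (K.next x) = (core hI hB').next (e x))
    (h2 : ∀ x, e (K.opp x) = (core hI hB').opp (e x)) :
    ∃ e' : Perm D, (∀ x, e' ((B.extend K.next).next x) = B'.next (e' x)) ∧
      (∀ x, e' ((B.extend K.next).opp x) = B'.opp (e' x)) ∧ e' h = h ∧
      ∀ x : Rest h o, e' x = e x := by
  have q1 : ofSubtype (p := fun x => x ≠ h ∧ x ≠ o) e h = h :=
    ofSubtype_apply_of_not_mem _ (by simp)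
  have q2 : ofSubtype (p := fun x => x ≠ h ∧ x ≠ o) e o = o :=
    ofSubtype_apply_of_not_mem _ (by simp)
  have q3 : ∀ x : Rest h o, ofSubtype (p := fun x => x ≠ h ∧ x ≠ o) e x = e x :=
    fun x => ofSubtype_apply_coe _ _
  have t1 : B.opp o = h := by rw [← hB, B.opp_opp]
  have t2 : B'.opp o = h := by rw [← hB', B'.opp_opp]
  refine ⟨_, fun x => ?_, fun x => ?_, q1, q3⟩
  · by_cases a : x = h
    · subst a; rw [extend_next_left, q1, q2, hI.1, hB']
    by_cases b : x = o
    · subst b; rw [extend_next_right, q1, q2, ← hB', hI.2]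
    lift x to Rest h o using ⟨a, b⟩
    rw [extend_next_apply, q3, q3, h1, core_next_apply]
  · rw [extend_opp]
    by_cases a : x = h
    · subst a; rw [hB, q1, q2, hB']
    by_cases b : x = o
    · subst b; rw [t1, q1, q2, t2]
    lift x to Rest h o using ⟨a, b⟩
    rw [← hK, q3, q3, h2, core_opp]

variable [Finite D]

/-- The chain between the cores carries the diagonal into some face of perimeter `m` of `B'`. As the
two graphs share `next` and `huniq` leaves only one such face, a final rotation puts the diagonal
where it belongs. -/
theorem obtainable_insertEdge {B B' : EmbeddedGraph D} (hB : B.opp h = o) (hB' : B'.opp h = o)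
    (hI : B.IsIsolated h) (hI' : B'.IsIsolated h)
    (hobt : (core hI' hB').ObtainableFrom (core hI hB)) (hnext : B.next = B'.next)
    {k m : ℕ} (hk : 2 ≤ k) (hkm : k ≤ m) (hmk : m ≤ 2 * k) {u : D} (hu : B.Off h u)
    (hm : minimalPeriod B.next u = m)
    (huniq : ∀ v, B.Off h v → minimalPeriod B.next v = m → B.next.SameCycle u v) :
    (B'.insertEdge h k u).ObtainableFrom (B.insertEdge h k u) := by
  obtain ⟨K, hK, hiso⟩ := hobt
  rw [off_eq hB] at hu
  lift u to Rest h o using hu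
  have hm' := (minimalPeriod_extend (B := B) (core hI hB).next u)
  rw [extend_core] at hm'
  obtain ⟨ho, u', hu', hobt⟩ := reflTransGen_carries (B := B) hK hB (core_opp hI hB) hk hkm hmk
    (hm'.symm.trans hm)
  rw [extend_core] at hobt
  obtain ⟨e, h1, h2⟩ := isomorphic_iff.1 hiso
  obtain ⟨e', g1, g2, g3, g4⟩ := exists_extend_isomorphism hB hB' hI' (by
    intro x; rw [ho]; exact core_opp hI hB x) e h1 h2
  have hiso' := insertEdge_isomorphic e' g1 g2 g3 k u'
  have hper : minimalPeriod B'.next (e' u') = m := by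
    rw [← hu', ← minimalPeriod_extend (B := B) K.next u']
    have : e' * (B.extend K.next).next * e'⁻¹ = B'.next := by
      rw [mul_inv_eq_iff_eq_mul]
      ext x
      exact g1 x
    rw [← this, minimalPeriod_conj]
  have hoff : B'.Off h (e' u') := by
    rw [g4]
    exact off_coe hB' _
  have hsame : B'.next.SameCycle (e' u') u := by
    rw [← hnext] at hper ⊢
    refine (huniq _ ?_ hper).symm
    rw [g4]
    exact off_coe hB _
  exact (hobt.trans hiso'.obtainable).trans (insertEdge_of_sameCycle hI' k hoff hsame)

theorem obtainable_insertLeaf {B B' : EmbeddedGraph D} (hB : B.opp h = o) (hB' : B'.opp h = o)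
    (hI : B.IsIsolated h) (hI' : B'.IsIsolated h)
    (hobt : (core hI' hB').ObtainableFrom (core hI hB)) (hnext : B.next = B'.next)
    (hc : ∀ x y, B.Off h x → B.Off h y → B.next.SameCycle x y) {u : D} (hu : B.Off h u) :
    (B'.insertLeaf h u).ObtainableFrom (B.insertLeaf h u) := by
  obtain ⟨K, hK, hiso⟩ := hobt
  rw [off_eq hB] at hu
  lift u to Rest h o using hu
  have hcore : ∀ x y, (core hI hB).next.SameCycle x y := by
    intro x y
    rw [core_next, sameCycle_subtypePerm]
    exact hc x y (off_coe hB x) (off_coe hB y)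
  obtain ⟨ho, -, u', hobt⟩ := reflTransGen_carriesLeaf (B := B) hK hB (core_opp hI hB) hcore u
  rw [extend_core] at hobt
  obtain ⟨e, h1, h2⟩ := isomorphic_iff.1 hiso
  obtain ⟨e', g1, g2, g3, g4⟩ := exists_extend_isomorphism hB hB' hI' (by
    intro x; rw [ho]; exact core_opp hI hB x) e h1 h2
  have hiso' := insertLeaf_isomorphic e' g1 g2 g3 u'
  have hoff : B'.Off h (e' u') := by
    rw [g4]
    exact off_coe hB' _
  have hsame : B'.next.SameCycle (e' u') u := by
    rw [← hnext]
    refine hc _ _ ?_ (off_coe hB _)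
    rw [g4]
    exact off_coe hB _
  exact (hobt.trans hiso'.obtainable).trans (insertLeaf_of_sameCycle hI' hoff hsame)

end Transfer

end EmbeddedGraph

/-! ### Isomorphism invariance of planarity -/

namespace EmbeddedGraph

open Equiv Equiv.Perm Function

section IsPlane

variable {D D' : Type*} [Finite D] [Finite D'] {G : EmbeddedGraph D} {H : EmbeddedGraph D'}

theorem card_cycles_conj (e : D ≃ D') {f : Perm D} {g : Perm D'} (h : ∀ x, e (f x) = g (e x)) :
    Nat.card (Cycles f) = Nat.card (Cycles g) := by
  have hg : g = e.permCongr f := by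
    ext x
    simp [Equiv.permCongr_apply, h]
  refine Nat.card_congr (Quotient.congr e fun x y => ?_)
  constructor
  · intro hxy
    exact SameCycle.rel (r := fun x y => g.SameCycle (e x) (e y))
      ((sameCycle_equivalence g).comap e) (fun x => by
        rw [h]
        exact sameCycle_apply_right.2 (SameCycle.refl _ _)) hxy
  · intro hxy
    have := SameCycle.rel (r := fun x y => f.SameCycle (e.symm x) (e.symm y))
      ((sameCycle_equivalence f).comap e.symm) (fun x => by
        have : e.symm (g x) = f (e.symm x) := by simp [hg, Equiv.permCongr_apply]
        rw [this]
        exact sameCycle_apply_right.2 (SameCycle.refl _ _)) hxy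
    rw [e.symm_apply_apply, e.symm_apply_apply] at this
    exact this

theorem Isomorphic.isPlane (h : G.Isomorphic H) (hG : G.IsPlane) : H.IsPlane := by
  obtain ⟨e, h1, h2⟩ := h
  obtain ⟨e', h3, h4⟩ := isomorphic_iff.1 ⟨e, h1, h2⟩
  refine ⟨(connected_iff H).2 fun r hr hn ho x y => ?_, ?_⟩
  · have := (connected_iff G).1 hG.1 (fun x y => r (e' x) (e' y)) (hr.comap e')
      (fun x => by rw [h3]; exact hn _) (fun x => by rw [h4]; exact ho _) (e'.symm x) (e'.symm y)
    simpa using this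
  · have := hG.2
    rwa [Vertex, Face, Edge, card_cycles_conj e h1, card_cycles_conj e' h3,
      card_cycles_conj e h2] at this

end IsPlane

/-! ### The dual graph -/

section FaceGraph

variable {D : Type*}

/-- The adjacency of different faces, for the graph with `Next = f` and `opp = i`. -/
def faceGraph (f i : Perm D) : SimpleGraph (Cycles f) where
  Adj A B := A ≠ B ∧ ∃ x, (Quotient.mk _ x : Cycles f) = A ∧ (Quotient.mk _ (i x) : Cycles f) = B ∨
    (Quotient.mk _ x : Cycles f) = B ∧ (Quotient.mk _ (i x) : Cycles f) = A
  symm := ⟨fun _ _ h => ⟨h.1.symm, h.2.imp fun _ h => h.symm⟩⟩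
  loopless := ⟨fun _ h => h.1 rfl⟩

theorem mk_eq_mk {f : Perm D} {x y : D} :
    (Quotient.mk _ x : Cycles f) = Quotient.mk _ y ↔ f.SameCycle x y :=
  Quotient.eq (r := SameCycle.setoid f)

theorem exists_of_faceGraph_adj {G : EmbeddedGraph D} {f : Perm D} {A B : Cycles f}
    (h : (faceGraph f G.opp).Adj A B) : ∃ x, (Quotient.mk _ x : Cycles f) = A ∧
      (Quotient.mk _ (G.opp x) : Cycles f) = B := by
  obtain ⟨-, x, hx | hx⟩ := h
  · exact ⟨x, hx⟩
  · exact ⟨G.opp x, hx.2, by rw [G.opp_opp]; exact hx.1⟩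

theorem faceGraph_reachable {G : EmbeddedGraph D} (hG : G.Connected) (x y : D) :
    (faceGraph G.next G.opp).Reachable (Quotient.mk _ x) (Quotient.mk _ y) := by
  refine (connected_iff G).1 hG (fun x y => (faceGraph G.next G.opp).Reachable
    (Quotient.mk _ x) (Quotient.mk _ y)) ⟨fun _ => .refl _, .symm, .trans⟩
    (fun x => ?_) (fun x => ?_) x y
  · rw [mk_eq_mk.2 (sameCycle_apply_right.2 (SameCycle.refl G.next x))]
  · by_cases h : (Quotient.mk _ x : Cycles G.next) = Quotient.mk _ (G.opp x)
    · rw [h]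
    · exact SimpleGraph.Adj.reachable ⟨h, x, .inl ⟨rfl, rfl⟩⟩

end FaceGraph

/-! ### Making two faces adjacent -/

section Adjacency

variable {D : Type*} [DecidableEq D]

theorem card_cycles_attachBefore [Finite D] {f : Perm D} {q x : D} (hx : f x = x) (hq : q ≠ x) :
    Nat.card (Cycles (attachBefore f q x)) + 1 = Nat.card (Cycles f) := by
  refine card_cycles_swap_mul fun h => hq ?_
  obtain ⟨i, hi⟩ := h.symm
  rw [zpow_apply_eq_self_of_apply_eq_self hx] at hi
  exact hi.symm

theorem card_cycles_detach [Finite D] {f : Perm D} {x : D} (hx : f x ≠ x) :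
    Nat.card (Cycles (detach f x)) = Nat.card (Cycles f) + 1 := by
  rw [← card_cycles_attachBefore (detach_self f x) hx]
  congr 3
  rw [attachBefore, detach, swap_comm, ← mul_assoc, swap_mul_self, one_mul]

/-- The number of faces is invariant under conjugation. At the vertices two darts are detached, each
adding a cycle, and reattached, each removing one. For connectedness, an invariant relation of the
tilted graph relates all darts of the two faces concerned, and outside these faces nothing has
changed. -/
theorem isPlane_conjNext_edgeConj [Finite D] {G : EmbeddedGraph D} (hG : G.IsPlane) {h o : D}
    (ho : G.opp h = o) (hho : ¬ G.next.SameCycle h o) (h1 : G.next h ≠ h) (h2 : G.next o ≠ o) :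
    (G.conjNext (edgeConj G.next h o)).IsPlane := by
  have oh : o ≠ h := fun e => hho (e ▸ SameCycle.refl _ _)
  have oo : G.opp o = h := by rw [← ho, G.opp_opp]
  have e1 : G.next o ≠ h := fun e => hho (SameCycle.symm ⟨1, by simpa using e⟩)
  have e2 : G.next h ≠ o := fun e => hho ⟨1, by simpa using e⟩
  set s := edgeConj G.next h o with hs
  set f := G.next with hf
  obtain ⟨s1, s2, s3, s4⟩ := edgeConj_facts oh e1 e2 h2 h1
  have hsx : ∀ x, (s * f * s⁻¹) (s x) = s (f x) := fun x => by simp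
  refine ⟨(connected_iff _).2 fun r hr hn hop => ?_, ?_⟩
  · rw [conjNext_next] at hn
    rw [conjNext_opp] at hop
    have hsn : ∀ x, r (s x) (s (f x)) := fun x => by rw [← hsx]; exact hn _
    have hc := hr.comap s
    have ra : ∀ x, f.SameCycle h x → r (s h) (s x) := fun x => SameCycle.rel hc hsn
    have rb : ∀ x, f.SameCycle o x → r (s o) (s x) := fun x => SameCycle.rel hc hsn
    have ih : ∀ y, f.SameCycle y (f⁻¹ y) := fun y => sameCycle_symm_apply_right.2 (SameCycle.refl _ _)
    have r1 : r h o := ho ▸ hop h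
    have r2 : r h (s h) := by
      have := ra _ (ih h)
      rw [s3] at this
      exact hr.symm this
    have r3 : r h (s o) := by
      have := rb _ (ih o)
      rw [s4] at this
      exact hr.trans r1 (hr.symm this)
    have key : ∀ x, f.SameCycle h x ∨ f.SameCycle o x → r h x := by
      intro x hx
      by_cases x1 : x = h
      · rw [x1]; exact hr.refl _
      by_cases x2 : x = o
      · rw [x2]; exact r1
      by_cases x3 : x = f⁻¹ h
      · rw [x3, ← s2]; exact r3
      by_cases x4 : x = f⁻¹ o
      · rw [x4, ← s1]; exact r2
      rw [← edgeConj_apply_of_ne x1 x2 x3 x4]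
      exact hx.elim (fun hx => hr.trans r2 (ra _ hx)) (fun hx => hr.trans r3 (rb _ hx))
    have out : ∀ x, ¬ (f.SameCycle h x ∨ f.SameCycle o x) → s x = x := by
      intro x hx
      refine edgeConj_apply_of_ne ?_ ?_ ?_ ?_ <;> rintro rfl <;> apply hx
      exacts [.inl (SameCycle.refl _ _), .inr (SameCycle.refl _ _), .inl (ih _), .inr (ih _)]
    refine (connected_iff G).1 hG.1 r hr (fun x => ?_) hop
    by_cases hx : f.SameCycle h x ∨ f.SameCycle o x
    · exact hr.trans (hr.symm (key x hx)) (key _ (by rwa [sameCycle_apply_right,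
        sameCycle_apply_right]))
    · have := hsn x
      rwa [out x hx, out (f x) (by rwa [sameCycle_apply_right, sameCycle_apply_right])] at this
  · have hgen : G.IsGeneral h := (isGeneral_iff G h).2 ⟨by rwa [ho], by rwa [ho], by rwa [ho], h1⟩
    have hsh := shiftEdge_eq G h hgen
    have hr : (G.conjNext s).rot = (G.shiftEdge h).rot := by rw [hsh, hs, ← ho]; rfl
    have hv : Nat.card (Cycles (G.conjNext s).rot) = Nat.card (Cycles G.rot) := by
      rw [hr, shiftEdge, withRot, ho]
      have hd : detach (detach G.rot h) o o = o := detach_self _ _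
      have hd' : detach (detach G.rot h) o h = h := by
        rw [detach, mul_apply, detach_self, swap_apply_of_ne_of_ne oh.symm]
        intro e
        have := (detach G.rot h).injective (e.symm.trans (detach_self _ _).symm)
        exact oh this
      have p1 : G.next.symm h ≠ h := fun e => h1 ((Equiv.symm_apply_eq _).1 e).symm
      have p2 : G.next.symm o ≠ o := fun e => h2 ((Equiv.symm_apply_eq _).1 e).symm
      have p3 : o ≠ G.next.symm h := fun e => e1 ((Equiv.symm_apply_eq _).1 e.symm).symm
      have q1 : G.rot h ≠ h := by rwa [rot_apply, ho]
      have q2 : detach G.rot h o ≠ o := by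
        rw [detach, mul_apply, rot_apply G o, oo]
        intro e
        rcases eq_or_ne (G.next h) (G.rot h) with e' | e'
        · rw [e', swap_apply_right] at e
          exact oh e.symm
        · rw [swap_apply_of_ne_of_ne h1 e'] at e
          exact e2 e
      have c1 := card_cycles_detach q1
      have c2 := card_cycles_detach q2
      have c3 := card_cycles_attachBefore hd' p1
      have c4 := card_cycles_attachBefore (f := attachBefore (detach (detach G.rot h) o)
        (G.next.symm h) h) (q := G.next.symm o) (x := o) (by
          rw [attachBefore, mul_apply, hd, swap_apply_of_ne_of_ne p3 oh]) p2
      show Nat.card (Cycles (attachBefore (attachBefore (detach (detach G.rot h) o)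
        (G.next.symm h) h) (G.next.symm o) o)) = _
      omega
    have hfc : Nat.card (Cycles (G.conjNext s).next) = Nat.card (Cycles G.next) :=
      (card_cycles_conj s fun x => by rw [conjNext_next, hsx]).symm
    have := hG.2
    rw [Vertex, Face, Edge] at this ⊢
    rw [hv, hfc, conjNext_opp]
    exact this

/-- Turning the edge `x`, `o` between two faces, followed by a relabelling of the darts that
restores `Next`. -/
theorem exists_turn [Finite D] {G : EmbeddedGraph D} (hG : G.IsPlane) {x o : D}
    (ho : G.opp x = o) (hxo : ¬ G.next.SameCycle x o) (h1 : G.next x ≠ x) (h2 : G.next o ≠ o) :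
    ∃ G' : EmbeddedGraph D, G'.ObtainableFrom G ∧ G'.next = G.next ∧ G'.IsPlane ∧
      (∀ z, edgeConj G.next x o (G'.opp z) = G.opp (edgeConj G.next x o z)) := by
  have oh : o ≠ x := fun e => hxo (e ▸ SameCycle.refl _ _)
  have e1 : G.next o ≠ x := fun e => hxo (SameCycle.symm ⟨1, by simpa using e⟩)
  have e2 : G.next x ≠ o := fun e => hxo ⟨1, by simpa using e⟩
  have hp := isPlane_conjNext_edgeConj hG ho hxo h1 h2
  set s := edgeConj G.next x o with hs
  have ht : Tilting G (G.conjNext s) := by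
    have := tilting_edge G x (by rwa [ho]) (by rwa [ho]) (by rwa [ho]) h1
    rwa [ho] at this
  have hi := isomorphic_map (G.conjNext s) s⁻¹
  refine ⟨(G.conjNext s).map s⁻¹, ht.obtainable.trans hi.obtainable, ?_, hi.isPlane hp, ?_⟩
  · ext z
    have : ((G.conjNext s).map s⁻¹).next z = s⁻¹ ((G.conjNext s).next (s z)) := by
      simp [next, map]
    rw [this, conjNext_next]
    simp
  · intro z
    simp [map]

/-- One step of turning the edge `x`, `o`, towards the dart `z` of the face of `o`. -/
theorem exists_turn_towards [Finite D] {f : Perm D} {G : EmbeddedGraph D} {x o z : D}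
    (hG : G.IsPlane) (hf : G.next = f) (ho : G.opp x = o) (hxo : ¬ f.SameCycle x o) (hx : f x ≠ x)
    (hz : f.SameCycle o z) (h1 : ¬ f.SameCycle x (G.opp z)) (h2 : ¬ f.SameCycle o (G.opp z)) :
    ∃ G' : EmbeddedGraph D, G'.ObtainableFrom G ∧ G'.next = f ∧ G'.IsPlane ∧
      (f⁻¹ o = z → G'.opp x = G.opp z) ∧
      (f⁻¹ o ≠ z → G'.opp (f⁻¹ x) = f⁻¹ o ∧ G'.opp z = G.opp z) ∧
      ∀ w, ¬ f.SameCycle x w → ¬ f.SameCycle o w → ¬ f.SameCycle x (G.opp w) →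
        ¬ f.SameCycle o (G.opp w) → G'.opp w = G.opp w := by
  subst hf
  set f := G.next
  have oh : o ≠ x := fun e => hxo (e ▸ SameCycle.refl _ _)
  have oo : G.opp o = x := by rw [← ho, G.opp_opp]
  have hzo : z ≠ o := fun e => h1 (by rw [e, oo])
  have fo : f o ≠ o := by
    intro e
    obtain ⟨i, hi⟩ := hz
    rw [zpow_apply_eq_self_of_apply_eq_self e] at hi
    exact hzo hi.symm
  have e1 : f o ≠ x := fun e => hxo (SameCycle.symm ⟨1, by simpa using e⟩)
  have e2 : f x ≠ o := fun e => hxo ⟨1, by simpa using e⟩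
  obtain ⟨G', hob, hn, hp, hs⟩ := exists_turn hG ho hxo hx fo
  obtain ⟨s1, -, s3, s4⟩ := edgeConj_facts oh e1 e2 fo hx
  set s := edgeConj f x o
  have ih : ∀ y, f.SameCycle y (f⁻¹ y) := fun y =>
    sameCycle_symm_apply_right.2 (SameCycle.refl _ _)
  have out : ∀ w, ¬ f.SameCycle x w → ¬ f.SameCycle o w → s w = w := by
    intro w hw hw'
    refine edgeConj_apply_of_ne ?_ ?_ ?_ ?_ <;> rintro rfl
    exacts [hw (SameCycle.refl _ _), hw' (SameCycle.refl _ _), hw (ih _), hw' (ih _)]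
  refine ⟨G', hob, hn, hp, fun e => s.injective ?_, fun e => ⟨s.injective ?_, s.injective ?_⟩,
    fun w w1 w2 w3 w4 => s.injective ?_⟩
  -- The renaming puts `x` in the place of `z = f⁻¹ o`, so `x` inherits the neighbour of `z` in the
  -- third face.
  · rw [hs, s1, e, out _ h1 h2]
  · rw [hs, s3, ho, s4]
  · rw [hs, out _ h1 h2, edgeConj_apply_of_ne _ hzo _ e.symm]
    · rintro rfl
      exact hxo hz.symm
    · rintro rfl
      exact hxo ((ih x).trans hz.symm)
  · rw [hs, out _ w1 w2, out _ w3 w4]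

/-- An edge between two faces can be turned until its second end meets the side `z` of the second
face that is shared with a third face. -/
theorem exists_turn_until [Finite D] {f : Perm D} (j : ℕ) : ∀ {G : EmbeddedGraph D} {x o z : D},
    G.IsPlane → G.next = f → G.opp x = o → ¬ f.SameCycle x o → f x ≠ x →
    (f⁻¹ ^ (j + 1)) o = z → ¬ f.SameCycle x (G.opp z) → ¬ f.SameCycle o (G.opp z) →
    ∃ G' : EmbeddedGraph D, G'.ObtainableFrom G ∧ G'.next = f ∧ G'.IsPlane ∧
      (∃ x', f.SameCycle x x' ∧ f.SameCycle (G.opp z) (G'.opp x')) ∧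
      ∀ w, ¬ f.SameCycle x w → ¬ f.SameCycle o w → ¬ f.SameCycle x (G.opp w) →
        ¬ f.SameCycle o (G.opp w) → G'.opp w = G.opp w := by
  induction j with
  | zero =>
    intro G x o z hG hf ho hxo hx hz h1 h2
    have hz' : f⁻¹ o = z := by simpa using hz
    obtain ⟨G', hob, hn, hp, h3, -, h4⟩ := exists_turn_towards hG hf ho hxo hx
      (hz' ▸ sameCycle_symm_apply_right.2 (SameCycle.refl _ _)) h1 h2
    exact ⟨G', hob, hn, hp, ⟨x, SameCycle.refl _ _, by rw [h3 hz']⟩, h4⟩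
  | succ j ih =>
    intro G x o z hG hf ho hxo hx hz h1 h2
    have hc : f.SameCycle o z := ⟨-(j + 1 + 1 : ℕ), by rw [← hz, zpow_neg, zpow_natCast, inv_pow]⟩
    obtain ⟨G', hob, hn, hp, h3, h4, h5⟩ := exists_turn_towards hG hf ho hxo hx hc h1 h2
    by_cases e : f⁻¹ o = z
    · exact ⟨G', hob, hn, hp, ⟨x, SameCycle.refl _ _, by rw [h3 e]⟩, h5⟩
    · obtain ⟨h6, h7⟩ := h4 e
      have c1 : ∀ y w, f.SameCycle (f⁻¹ y) w ↔ f.SameCycle y w := fun y w =>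
        sameCycle_symm_apply_left
      have c2 : ∀ y w, f.SameCycle y (f⁻¹ w) ↔ f.SameCycle y w := fun y w =>
        sameCycle_symm_apply_right
      -- The turned edge is now `f⁻¹ x`, `f⁻¹ o`, one step closer to `z`, whose opposite is
      -- unchanged.
      obtain ⟨G'', hob', hn', hp', ⟨x', hx', hx2⟩, h8⟩ := ih (z := z) hp hn h6
        (by rwa [c1, c2]) (by
          rw [apply_inv_self]
          exact fun e => hx ((Equiv.eq_symm_apply f).1 e))
        (by rw [← hz, pow_succ _ (j + 1)]; rfl) (by rwa [h7, c1]) (by rwa [h7, c1])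
      refine ⟨G'', hob.trans hob', hn', hp', ⟨x', (c1 _ _).1 hx', h7 ▸ hx2⟩,
        fun w w1 w2 w3 w4 => ?_⟩
      have h9 := h5 w w1 w2 w3 w4
      rw [h8 w (by rwa [c1]) (by rwa [c1]) (by rwa [h9, c1]) (by rwa [h9, c1]), h9]

/-- If the path starts with `A, F, F'`, an edge between `A` and `F` is turned until it joins `A` to
`F'`, which shortens the path by one. The path being simple, its later edges meet neither `A` nor
`F` and survive the turning. -/
theorem exists_adjacent_of_path [Finite D] {f : Perm D} (n : ℕ) : ∀ {G : EmbeddedGraph D}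
    {A B : Cycles f} (p : (faceGraph f G.opp).Walk A B), p.IsPath → p.length = n + 1 →
    G.IsPlane → G.next = f → (∀ x, (Quotient.mk _ x : Cycles f) = A → f x ≠ x) →
    ∃ G' : EmbeddedGraph D, G'.ObtainableFrom G ∧ G'.next = f ∧ G'.IsPlane ∧
      ∃ x, (Quotient.mk _ x : Cycles f) = A ∧ (Quotient.mk _ (G'.opp x) : Cycles f) = B := by
  induction n with
  | zero =>
    intro G A B p hp hl hG hf hA
    subst hf
    exact ⟨G, .refl G, rfl, hG, exists_of_faceGraph_adj (SimpleGraph.Walk.adj_of_length_eq_one hl)⟩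
  | succ n ih =>
    intro G A B p hp hl hG hf hA
    cases p with
    | nil => simp at hl
    | @cons _ F _ hAF q =>
    cases q with
    | nil => simp at hl
    | @cons _ F' _ hFF q =>
    simp only [SimpleGraph.Walk.cons_isPath_iff, SimpleGraph.Walk.support_cons,
      List.mem_cons, not_or] at hp
    obtain ⟨⟨hq, hFq⟩, hAF', hAq⟩ := hp
    obtain ⟨x, rfl, rfl⟩ := exists_of_faceGraph_adj hAF
    obtain ⟨z, hz, rfl⟩ := exists_of_faceGraph_adj hFF
    have hxz : (Quotient.mk _ x : Cycles f) ≠ Quotient.mk _ (G.opp z) := fun e =>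
      hAq (by rw [e]; exact q.start_mem_support)
    have hoz : (Quotient.mk _ (G.opp x) : Cycles f) ≠ Quotient.mk _ (G.opp z) := fun e =>
      hFq (by rw [e]; exact q.start_mem_support)
    -- A positive exponent is available because a full turn around the face can be taken; the
    -- turning lemma makes at least one step.
    obtain ⟨j, hj⟩ : ∃ j : ℕ, (f⁻¹ ^ (j + 1)) (G.opp x) = z := by
      obtain ⟨i, hi, -, hi2⟩ := (sameCycle_inv.2 (mk_eq_mk.1 hz.symm)).exists_pow_eq''
      exact ⟨i - 1, by rwa [Nat.sub_add_cancel hi]⟩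
    obtain ⟨G', hob, hn, hp, ⟨x', hx', hx2⟩, h8⟩ := exists_turn_until j hG hf rfl
      (mk_eq_mk.not.1 hAF.1) (hA x rfl) hj (mk_eq_mk.not.1 hxz) (mk_eq_mk.not.1 hoz)
    have hadj : ∀ C E, (faceGraph f G.opp).Adj C E → C ∈ q.support → E ∈ q.support →
        (faceGraph f G'.opp).Adj C E := by
      intro C E hCE hC hE
      obtain ⟨w, rfl, rfl⟩ := exists_of_faceGraph_adj hCE
      have := h8 w (fun e => hAq (mk_eq_mk.2 e ▸ hC)) (fun e => hFq (mk_eq_mk.2 e ▸ hC))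
        (fun e => hAq (mk_eq_mk.2 e ▸ hE)) (fun e => hFq (mk_eq_mk.2 e ▸ hE))
      exact ⟨hCE.1, w, .inl ⟨rfl, by rw [this]⟩⟩
    have hq' : ∀ e ∈ q.edges, e ∈ (faceGraph f G'.opp).edgeSet := by
      intro e
      induction e with
      | _ C E =>
      intro he
      exact hadj C E (q.adj_of_mem_edges he) (q.fst_mem_support_of_mem_edges he)
        (q.snd_mem_support_of_mem_edges he)
    have hadj' : (faceGraph f G'.opp).Adj (Quotient.mk _ x) (Quotient.mk _ (G.opp z)) :=
      ⟨hxz, x', .inl ⟨mk_eq_mk.2 hx'.symm, mk_eq_mk.2 hx2.symm⟩⟩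
    obtain ⟨G'', hob', hn', hp', h9⟩ := ih (.cons hadj' (q.transfer _ hq'))
      ((SimpleGraph.Walk.cons_isPath_iff _ _).2 ⟨hq.transfer hq', by
        rwa [SimpleGraph.Walk.support_transfer]⟩) (by
        simp only [SimpleGraph.Walk.length_cons, SimpleGraph.Walk.length_transfer] at hl ⊢
        omega) hp hn hA
    exact ⟨G'', hob.trans hob', hn', hp', h9⟩

/-- By tilting, a face that is not bounded by a loop can be made adjacent to any other face. -/
theorem exists_adjacent [Finite D] {G : EmbeddedGraph D} (hG : G.IsPlane) {a b : D}
    (hab : ¬ G.next.SameCycle a b) (ha : G.next a ≠ a) :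
    ∃ G' : EmbeddedGraph D, G'.ObtainableFrom G ∧ G'.next = G.next ∧ G'.IsPlane ∧
      ∃ x, G.next.SameCycle a x ∧ G.next.SameCycle b (G'.opp x) := by
  classical
  obtain ⟨p, hp⟩ := (faceGraph_reachable hG.1 a b).exists_isPath
  have hl : p.length ≠ 0 := fun e => hab (mk_eq_mk.1 (SimpleGraph.Walk.eq_of_length_eq_zero e))
  obtain ⟨n, hn⟩ := Nat.exists_eq_succ_of_ne_zero hl
  obtain ⟨G', hob, hn', hp', x, hx, hx'⟩ := exists_adjacent_of_path n p hp hn hG rfl (by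
    intro x hx e
    obtain ⟨i, hi⟩ := mk_eq_mk.1 hx
    rw [zpow_apply_eq_self_of_apply_eq_self e] at hi
    exact ha (hi ▸ e))
  exact ⟨G', hob, hn', hp', x, (mk_eq_mk.1 hx).symm, (mk_eq_mk.1 hx').symm⟩

omit [DecidableEq D] in
/-- The relabelling of one cycle of `f` by a power of `f`. -/
theorem exists_commute_of_sameCycle [Finite D] {f : Perm D} {x y : D} (h : f.SameCycle x y) :
    ∃ r : Perm D, (∀ z, r (f z) = f (r z)) ∧ r x = y ∧ ∀ z, ¬ f.SameCycle x z → r z = z := by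
  classical
  obtain ⟨i, rfl⟩ := h
  have hc : Commute (f.cycleOf x) f := by
    ext z
    simp only [mul_apply, cycleOf_apply, sameCycle_apply_right]
    split_ifs <;> rfl
  refine ⟨f.cycleOf x ^ i, fun z => ?_, cycleOf_zpow_apply_self f x i, fun z hz => ?_⟩
  · exact DFunLike.congr_fun (hc.zpow_left i).eq z
  · exact zpow_apply_eq_self_of_apply_eq_self (cycleOf_apply_of_not_sameCycle hz) i

/-- Two darts in different faces can be moved inside their faces. -/
theorem exists_opp_eq [Finite D] {G : EmbeddedGraph D} (hG : G.IsPlane) {x h o : D}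
    (hx : G.next.SameCycle h x) (ho : G.next.SameCycle o (G.opp x)) (hho : ¬ G.next.SameCycle h o) :
    ∃ G' : EmbeddedGraph D, G'.ObtainableFrom G ∧ G'.next = G.next ∧ G'.IsPlane ∧
      G'.opp h = o := by
  obtain ⟨r, hr, r1, r2⟩ := exists_commute_of_sameCycle hx.symm
  obtain ⟨s, hs, s1, s2⟩ := exists_commute_of_sameCycle ho.symm
  have hi := isomorphic_map G (s * r)
  refine ⟨G.map (s * r), hi.obtainable, ?_, hi.isPlane hG, ?_⟩
  · have : (G.map (s * r)).next * (s * r) = G.next * (s * r) := by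
      ext z
      have : ((G.map (s * r)).next * (s * r)) z = (s * r) (G.next z) := by
        simp [next, map]
      rw [this, mul_apply, hr, hs]
      rfl
    exact mul_right_cancel this
  · have e1 : (s * r) x = h := by
      rw [mul_apply, r1]
      exact s2 _ fun e => hho ((ho.trans e).symm)
    have e2 : (s * r) (G.opp x) = o := by
      rw [mul_apply, r2, s1]
      exact fun e => hho (hx.trans (e.trans ho.symm))
    rw [← e1, ← e2]
    simp [map]


end Adjacency

end EmbeddedGraph

/-! ### Faces of perimeter at most two, and trees -/

namespace EmbeddedGraph

open Equiv Equiv.Perm Function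

section Dihedral

variable {D : Type*} [Finite D]

theorem minimalPeriod_eq_natCard (f : Perm D) (x : D) :
    minimalPeriod f x = Nat.card {y // f.SameCycle x y} := by
  have hb : Bijective (fun i : Fin (minimalPeriod f x) =>
      (⟨(f ^ (i : ℕ)) x, sameCycle_pow f x i⟩ : {y // f.SameCycle x y})) := by
    refine ⟨fun i j hij => Fin.ext (pow_apply_injOn i.2 j.2 (Subtype.ext_iff.1 hij)),
      fun ⟨y, hy⟩ => ?_⟩
    obtain ⟨i, hi, rfl⟩ := SameCycle.exists_pow_lt hy
    exact ⟨⟨i, hi⟩, rfl⟩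
  rw [← Nat.card_congr (Equiv.ofBijective _ hb), Nat.card_fin]

omit [Finite D] in
theorem zpow_apply_eq_iff (f : Perm D) (x : D) (i j : ℤ) :
    (f ^ i) x = (f ^ j) x ↔ (minimalPeriod f x : ℤ) ∣ i - j := by
  have := MulAction.zpow_smul_eq_iff_minimalPeriod_dvd (a := f) (b := x) (n := i - j)
  rw [← show minimalPeriod (fun y => f • y) x = minimalPeriod f x from rfl, ← this, sub_eq_neg_add,
    zpow_add, zpow_neg]
  exact Perm.inv_eq_iff_eq.symm

/-- Two rotations inverted by the same involution `f` are conjugate under the centralizer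
of `f`. -/
theorem exists_equiv_of_inverted {f r s : Perm D} (hf : ∀ x, f (f x) = x)
    (hr : ∀ x, r (f x) = f (r⁻¹ x)) (hs : ∀ x, s (f x) = f (s⁻¹ x)) {a b : D}
    (hra : ∀ x, r.SameCycle a x ∨ r.SameCycle (f a) x)
    (hab : minimalPeriod r a = minimalPeriod s b)
    (hfa : (f a = a ∧ f b = b) ∨ (¬ r.SameCycle a (f a) ∧ ¬ s.SameCycle b (f b))) :
    ∃ e : Perm D, (∀ x, e (f x) = f (e x)) ∧ ∀ x, e (r x) = s (e x) := by
  have inv : ∀ {r : Perm D}, (∀ x, r (f x) = f (r⁻¹ x)) → ∀ (j : ℤ) x,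
      f ((r ^ j) x) = (r ^ (-j)) (f x) := by
    intro r hr j x
    have h1 : f * r * f⁻¹ = r⁻¹ := by
      ext y
      rw [mul_apply, mul_apply, Perm.inv_eq_iff_eq.2 (hf y).symm, hr, hf]
    rw [zpow_neg, ← inv_zpow, ← h1, conj_zpow]
    simp
  -- Every dart is `r^j a` or `f (r^j a)`. A coincidence between the two kinds is a congruence on
  -- the exponents if `f a = a`, and never happens if `f a` is in another cycle; so the coincidences
  -- are the same for `s` and `b`.
  have hcross : ∀ i j : ℤ, (r ^ i) a = f ((r ^ j) a) ↔ (s ^ i) b = f ((s ^ j) b) := by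
    intro i j
    rw [inv hr, inv hs]
    rcases hfa with ⟨h1, h2⟩ | ⟨h1, h2⟩
    · rw [h1, h2, zpow_apply_eq_iff, zpow_apply_eq_iff, hab]
    · constructor
      · intro e
        exact (h1 ⟨j + i, by rw [zpow_add, mul_apply, e, zpow_neg]; simp⟩).elim
      · intro e
        exact (h2 ⟨j + i, by rw [zpow_add, mul_apply, e, zpow_neg]; simp⟩).elim
  have hsame : ∀ i j : ℤ, (r ^ i) a = (r ^ j) a ↔ (s ^ i) b = (s ^ j) b := by
    intro i j
    rw [zpow_apply_eq_iff, zpow_apply_eq_iff, hab]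
  have hex : ∀ x, ∃ y, ∃ j : ℤ, (x = (r ^ j) a ∧ y = (s ^ j) b) ∨
      (x = f ((r ^ j) a) ∧ y = f ((s ^ j) b)) := by
    intro x
    rcases hra x with ⟨j, hj⟩ | ⟨j, hj⟩
    · exact ⟨_, j, .inl ⟨hj.symm, rfl⟩⟩
    · exact ⟨_, -j, .inr ⟨by rw [inv hr, neg_neg, hj], rfl⟩⟩
  choose e he using hex
  have huniq : ∀ x x' y y' (i j : ℤ), ((x = (r ^ i) a ∧ y = (s ^ i) b) ∨
      (x = f ((r ^ i) a) ∧ y = f ((s ^ i) b))) → ((x' = (r ^ j) a ∧ y' = (s ^ j) b) ∨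
      (x' = f ((r ^ j) a) ∧ y' = f ((s ^ j) b))) → (x = x' ↔ y = y') := by
    rintro x x' y y' i j (⟨rfl, rfl⟩ | ⟨rfl, rfl⟩) (⟨rfl, rfl⟩ | ⟨rfl, rfl⟩)
    · exact hsame i j
    · exact hcross i j
    · rw [eq_comm, hcross, eq_comm]
    · rw [f.injective.eq_iff, f.injective.eq_iff]
      exact hsame i j
  have hinj : Injective e := fun x y hxy => by
    obtain ⟨i, hi⟩ := he x
    obtain ⟨j, hj⟩ := he y
    exact (huniq _ _ _ _ i j hi hj).2 hxy
  refine ⟨Equiv.ofBijective e (Finite.injective_iff_bijective.1 hinj), fun x => ?_, fun x => ?_⟩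
  · obtain ⟨i, hi⟩ := he x
    obtain ⟨j, hj⟩ := he (f x)
    refine (huniq (f x) (f x) (e (f x)) (f (e x)) j i hj ?_).1 rfl
    rcases hi with ⟨h1, h2⟩ | ⟨h1, h2⟩
    · exact .inr ⟨congrArg f h1, congrArg f h2⟩
    · exact .inl ⟨by rw [h1, hf], by rw [h2, hf]⟩
  · obtain ⟨i, hi⟩ := he x
    obtain ⟨j, hj⟩ := he (r x)
    rcases hi with ⟨h1, h2⟩ | ⟨h1, h2⟩
    · refine (huniq (r x) (r x) (e (r x)) (s (e x)) j (1 + i) hj (.inl ⟨?_, ?_⟩)).1 rfl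
      · rw [h1, zpow_one_add]; rfl
      · rw [h2, zpow_one_add]; rfl
    · refine (huniq (r x) (r x) (e (r x)) (s (e x)) j (-1 + i) hj (.inr ⟨?_, ?_⟩)).1 rfl
      · rw [h1, zpow_add, zpow_neg_one, hr]; rfl
      · rw [h2, zpow_add, zpow_neg_one, hs]; rfl

variable {G H : EmbeddedGraph D}

theorem two_mul_card_edge (G : EmbeddedGraph D) : 2 * Nat.card G.Edge = Nat.card D :=
  two_mul_card_cycles_eq G.opp_ne G.opp_opp

omit [Finite D] in
theorem card_cycles_eq_one {f : Perm D} {x : D} (h : ∀ y, f.SameCycle x y) :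
    Nat.card (Cycles f) = 1 := by
  have : Unique (Cycles f) :=
    { default := Quotient.mk _ x
      uniq := fun y => Quotient.inductionOn y fun y => mk_eq_mk.2 (h y).symm }
  exact Nat.card_unique

-- Here `rot` is a product of two involutions, `next` and `opp`, so each of them inverts it.
omit [Finite D] in
theorem rot_opposite (hf : ∀ x, G.next (G.next x) = x) (x : D) :
    G.rot (G.next x) = G.next (G.rot⁻¹ x) := by
  apply G.next.injective
  rw [hf, rot_apply, hf, Perm.eq_inv_iff_eq, rot_apply, G.opp_opp, hf]

theorem sameCycle_next_next (hf : ∀ x, G.next (G.next x) = x) (x y : D) :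
    G.rot.SameCycle x y → G.rot.SameCycle (G.next x) (G.next y) :=
  SameCycle.rel ((sameCycle_equivalence _).comap G.next) fun x => by
    have := rot_opposite hf (G.rot x)
    rw [inv_apply_self] at this
    exact SameCycle.symm ⟨1, by simpa using this⟩

theorem sameCycle_rot_or (hG : G.Connected) (hf : ∀ x, G.next (G.next x) = x) (a x : D) :
    G.rot.SameCycle a x ∨ G.rot.SameCycle (G.next a) x := by
  have h1 := sameCycle_next_next hf
  set P : D → Prop := fun x => G.rot.SameCycle a x ∨ G.rot.SameCycle (G.next a) x
  have h2 : ∀ x, P x → P (G.next x) := by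
    rintro x (h | h)
    · exact .inr (h1 _ _ h)
    · exact .inl (by simpa only [hf] using h1 _ _ h)
  have h3 : ∀ x, P x → P (G.opp x) := by
    intro x hx
    have : G.opp x = G.next (G.rot x) := by rw [rot_apply, hf]
    rw [this]
    apply h2
    simpa only [P, sameCycle_apply_right] using hx
  refine ((connected_iff G).1 hG (fun x y => P x ↔ P y) ⟨fun _ => Iff.rfl, Iff.symm, Iff.trans⟩
    (fun x => ⟨h2 x, fun h => hf x ▸ h2 _ h⟩) (fun x => ⟨h3 x, fun h => G.opp_opp x ▸ h3 _ h⟩)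
    a x).1 (.inl (SameCycle.refl _ _))

theorem minimalPeriod_rot_of_fixed (hG : G.Connected) (hf : ∀ x, G.next (G.next x) = x) {a : D}
    (ha : G.next a = a) : minimalPeriod G.rot a = Nat.card D := by
  rw [minimalPeriod_eq_natCard]
  refine Nat.card_congr (Equiv.subtypeUnivEquiv fun x => ?_)
  have := sameCycle_rot_or hG hf a x
  rwa [ha, or_self] at this

/-- Without fixed points there are as many faces as edges, so Euler's formula forces two vertices.
They are exchanged by `next` and thus carry half of the darts each. -/
theorem minimalPeriod_rot_of_forall_ne (hG : G.IsPlane) (hf : ∀ x, G.next (G.next x) = x)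
    (hne : ∀ x, G.next x ≠ x) (a : D) :
    ¬ G.rot.SameCycle a (G.next a) ∧ 2 * minimalPeriod G.rot a = Nat.card D := by
  have hc := sameCycle_rot_or hG.1 hf a
  have hV : ¬ G.rot.SameCycle a (G.next a) := by
    intro h
    have h1 : Nat.card G.Vertex = 1 := card_cycles_eq_one fun x => (hc x).elim id h.trans
    have h2 : 2 * Nat.card G.Face = _ := two_mul_card_cycles_eq hne hf
    have h3 := two_mul_card_edge G
    have := hG.2
    omega
  refine ⟨hV, ?_⟩
  have h1 := sameCycle_next_next hf
  have e1 : minimalPeriod G.rot (G.next a) = minimalPeriod G.rot a := by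
    rw [minimalPeriod_eq_natCard, minimalPeriod_eq_natCard]
    exact Nat.card_congr (G.next.subtypeEquiv fun x => ⟨fun h => by
      simpa only [hf] using h1 _ _ h, fun h => by simpa only [hf] using h1 _ _ h⟩)
  have e2 : Nat.card {y // ¬ G.rot.SameCycle a y} = minimalPeriod G.rot (G.next a) := by
    rw [minimalPeriod_eq_natCard]
    exact Nat.card_congr (Equiv.subtypeEquivRight fun x =>
      ⟨(hc x).resolve_left, fun h h' => hV (h'.trans h.symm)⟩)
  classical
  rw [← Nat.card_congr (Equiv.sumCompl (G.rot.SameCycle a)), Nat.card_sum, e2, e1,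
    ← minimalPeriod_eq_natCard]
  omega

/-- A transitive dihedral action with these generators is determined by the period of the rotation
and by whether a base dart is fixed by `next`; both are the same for the two graphs. -/
theorem isomorphic_of_next_involutive (hG : G.IsPlane) (hH : H.IsPlane) (hn : G.next = H.next)
    (hf : ∀ x, G.next (G.next x) = x) : G.Isomorphic H := by
  have hf' : ∀ x, H.next (H.next x) = x := hn ▸ hf
  have main : ∀ a, minimalPeriod G.rot a = minimalPeriod H.rot a →
    ((G.next a = a ∧ G.next a = a) ∨
      (¬ G.rot.SameCycle a (G.next a) ∧ ¬ H.rot.SameCycle a (G.next a))) → G.Isomorphic H := by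
    intro a h1 h2
    obtain ⟨e, e1, e2⟩ := exists_equiv_of_inverted hf (rot_opposite hf)
      (by rw [hn]; exact rot_opposite hf') (sameCycle_rot_or hG.1 hf a) h1 h2
    refine ⟨e, e2, fun x => ?_⟩
    have o1 : ∀ x, G.opp x = G.next (G.rot x) := fun x => by rw [rot_apply, hf]
    have o2 : ∀ x, H.opp x = G.next (H.rot x) := fun x => by rw [rot_apply, hn, hf']
    rw [o1, o2, e1, e2]
  by_cases hx : ∃ a, G.next a = a
  · obtain ⟨a, ha⟩ := hx
    refine main a ?_ (.inl ⟨ha, ha⟩)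
    rw [minimalPeriod_rot_of_fixed hG.1 hf ha, minimalPeriod_rot_of_fixed hH.1 hf' (hn ▸ ha)]
  · push Not at hx
    rcases isEmpty_or_nonempty D with hD | ⟨⟨a⟩⟩
    · exact ⟨Equiv.refl _, fun x => isEmptyElim x, fun x => isEmptyElim x⟩
    have h1 := minimalPeriod_rot_of_forall_ne hG hf hx a
    have h2 := minimalPeriod_rot_of_forall_ne hH hf' (hn ▸ hx) a
    exact main a (by omega) (.inr ⟨h1.1, hn ▸ h2.1⟩)

/-- With one face there is one vertex more than edges. If every vertex had degree at least 2, there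
would be at most as many vertices as edges. -/
theorem exists_leaf (hG : G.IsPlane) {a : D} (ha : ∀ x, G.next.SameCycle a x) :
    ∃ h, G.next h = G.opp h := by
  by_contra! hne
  have h1 : Nat.card G.Face = 1 := card_cycles_eq_one ha
  have h2 : 2 * Nat.card G.Vertex ≤ _ := two_mul_card_cycles_le (f := G.rot) fun x hx => by
    apply hne (G.opp x)
    rw [← rot_apply, hx, G.opp_opp]
  have h3 := two_mul_card_edge G
  have := hG.2
  omega

end Dihedral

end EmbeddedGraph

/-! ### The induction on the number of darts -/

namespace EmbeddedGraph

open Equiv Equiv.Perm Function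

section Induction

theorem obtainable_of_common_leaf {D : Type*} [Finite D] [DecidableEq D] {G H : EmbeddedGraph D}
    {h o : D} (hG : G.IsPlane) (hH : H.IsPlane) (hn : G.next = H.next) (h1 : G.opp h = o)
    (h2 : H.opp h = o) (hl : G.next h = o) (hoh : G.next o ≠ h) (hc : ∀ x, G.next.SameCycle h x)
    (ih : ∀ K L : EmbeddedGraph (Rest h o), K.IsPlane → L.IsPlane → K.next = L.next →
      L.ObtainableFrom K) : H.ObtainableFrom G := by
  have oh : o ≠ h := h1 ▸ G.opp_ne h
  set f := G.next with hf
  have uo : f o ≠ o := fun e => oh (f.injective (e.trans hl.symm))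
  set u := f o with hu
  set p := swap u h * f with hp
  have ph : p h = o := by rw [hp, mul_apply, hl, swap_apply_of_ne_of_ne uo.symm oh]
  have po : p o = h := by rw [hp, mul_apply, ← hu, swap_apply_left]
  have key : ∀ K : EmbeddedGraph D, K.next = f → K.opp h = o → K.IsPlane →
      (K.withNext p).IsIsolated h ∧ (K.withNext p).opp h = o ∧ (K.withNext p).Off h u ∧
        (K.withNext p).insertLeaf h u = K := by
    intro K hK hKo hKp
    refine ⟨⟨?_, ?_⟩, hKo, ⟨hoh, ?_⟩, ?_⟩
    · rw [withNext_next, withNext_opp, hKo, ph]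
    · rw [withNext_next, withNext_opp, hKo, po]
    · rwa [withNext_opp, hKo]
    · rw [insertLeaf, withNext_next, withNext_withNext, hp, ← mul_assoc, swap_mul_self, one_mul,
        ← hK, withNext_self]
  obtain ⟨I, O, U, E⟩ := key G rfl h1 hG
  obtain ⟨I', O', U', E'⟩ := key H hn.symm h2 hH
  have hob := ih (core I O) (core I' O') (isPlane_core_of_insertLeaf I O U (E.symm ▸ hG))
    (isPlane_core_of_insertLeaf I' O' U' (E'.symm ▸ hH)) (by
    ext x
    rw [core_next_apply, core_next_apply, withNext_next, withNext_next])
  -- Skipping the two darts of the leaf, the walk around the single face is a walk along `p`, so the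
  -- smaller graph again has one face.
  have hP : ∀ (n : ℕ), (f ^ n) u = h ∨ (f ^ n) u = o ∨ p.SameCycle u ((f ^ n) u) := by
    intro n
    induction n with
    | zero => exact .inr (.inr (SameCycle.refl _ _))
    | succ n ih =>
      rw [pow_succ', mul_apply]
      rcases ih with h3 | h3 | h3
      · rw [h3, hl]; exact .inr (.inl rfl)
      · rw [h3, ← hu]; exact .inr (.inr (SameCycle.refl _ _))
      · by_cases h4 : f ((f ^ n) u) = h
        · exact .inl h4
        · by_cases h5 : f ((f ^ n) u) = u
          · rw [h5]; exact .inr (.inr (SameCycle.refl _ _))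
          · refine .inr (.inr ?_)
            have : p ((f ^ n) u) = f ((f ^ n) u) := by
              rw [hp, mul_apply, swap_apply_of_ne_of_ne h5 h4]
            rw [← this, sameCycle_apply_right]
            exact h3
  have hQ : ∀ x, (G.withNext p).Off h x → p.SameCycle u x := by
    intro x hx
    rw [off_eq O] at hx
    obtain ⟨n, -, rfl⟩ := SameCycle.exists_pow_lt ((hc u).symm.trans (hc x))
    have := hP n
    tauto
  have := obtainable_insertLeaf O O' I I' hob (by rw [withNext_next, withNext_next]) (fun x y hx hy => by
    rw [withNext_next]
    exact (hQ x hx).symm.trans (hQ y hy)) U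
  rwa [E, E'] at this

theorem obtainable_of_common_edge {D : Type*} [Finite D] [DecidableEq D] {G H : EmbeddedGraph D}
    {h o : D} (hG : G.IsPlane) (hH : H.IsPlane) (hn : G.next = H.next) (h1 : G.opp h = o)
    (h2 : H.opp h = o) (hho : ¬ G.next.SameCycle h o) (h3 : 3 ≤ minimalPeriod G.next h)
    (hle : minimalPeriod G.next o ≤ minimalPeriod G.next h)
    (hmax : ∀ x, ¬ G.next.SameCycle h x → minimalPeriod G.next x ≤ minimalPeriod G.next o)
    (ih : ∀ K L : EmbeddedGraph (Rest h o), K.IsPlane → L.IsPlane → K.next = L.next →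
      L.ObtainableFrom K) : H.ObtainableFrom G := by
  set f := G.next with hf
  have hu : f h ≠ h := fun e => by
    have : minimalPeriod f h ≤ 1 := IsPeriodicPt.minimalPeriod_le one_pos e
    omega
  obtain ⟨m1, m2, m3, m4, m5, m6⟩ := mergeNext_facts hho hu
  have hoo := minimalPeriod_pos_perm f o
  set p := mergeNext f h o with hp
  have key : ∀ K : EmbeddedGraph D, K.next = f → K.opp h = o → K.IsPlane →
      (K.withNext p).IsIsolated h ∧ (K.withNext p).opp h = o ∧ (K.withNext p).Off h (f h) ∧
        (K.withNext p).insertEdge h (minimalPeriod f h - 1) (f h) = K := by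
    intro K hK hKo hKp
    refine ⟨⟨?_, ?_⟩, hKo, ⟨hu, ?_⟩, ?_⟩
    · rw [withNext_next, withNext_opp, hKo, m1]
    · rw [withNext_next, withNext_opp, hKo, m2]
    · rw [withNext_opp, hKo]
      exact fun e => hho ⟨1, by simpa using e⟩
    · have := insertEdge_mergeNext K hKo (by rwa [hK]) (by rwa [hK])
      rwa [hK] at this
  have hho' : ¬ f.SameCycle (f h) o := by rwa [sameCycle_apply_left]
  obtain ⟨I, O, U, E⟩ := key G rfl h1 hG
  obtain ⟨I', O', U', E'⟩ := key H hn.symm h2 hH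
  have hob := ih (core I O) (core I' O')
    (isPlane_core_of_insertEdge I O U (E.symm ▸ hG) (by rw [E]; exact hho'))
    (isPlane_core_of_insertEdge I' O' U' (E'.symm ▸ hH) (by rw [E', ← hn]; exact hho')) (by
      ext x
      rw [core_next_apply, core_next_apply, withNext_next, withNext_next])
  -- With perimeters a ≥ b, a ≥ 3, take k = a - 1 and m = a + b - 2: then k ≥ 2, k ≤ m because b ≥
  -- 1, and m ≤ 2k because b ≤ a. The other faces have perimeter at most b < m, so the merged face
  -- is the only one of perimeter m.
  have := obtainable_insertEdge O O' I I' hob (by rw [withNext_next, withNext_next]) (k := minimalPeriod f h - 1)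
    (m := minimalPeriod f h + minimalPeriod f o - 2) (by omega) (by omega) (by omega) U
    (by rwa [withNext_next])
    (fun v hv hvm => by
      rw [withNext_next] at hvm ⊢
      rw [off_eq O] at hv
      by_cases hc : f.SameCycle h v ∨ f.SameCycle o v
      · exact m6 v hv.1 hv.2 hc
      · rw [not_or] at hc
        rw [m5 v hc.1 hc.2] at hvm
        have := hmax v hc.1
        omega)
  rwa [E, E'] at this

theorem obtainable_of_next_eq (n : ℕ) : ∀ {D : Type*} [Finite D] [DecidableEq D]
    {G H : EmbeddedGraph D}, Nat.card D = n → G.IsPlane → H.IsPlane → G.next = H.next →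
    H.ObtainableFrom G := by
  induction n using Nat.strong_induction_on with
  | _ n ih =>
  intro D _ _ G H hD hG hH hn
  have ih' : ∀ h o : D, ∀ K L : EmbeddedGraph (Rest h o), K.IsPlane → L.IsPlane → K.next = L.next →
      L.ObtainableFrom K := by
    intro h o K L
    exact ih (Nat.card (Rest h o)) (hD ▸ Finite.card_subtype_lt (x := h) (by simp)) rfl
  by_cases hf : ∀ x, G.next (G.next x) = x
  · exact (isomorphic_of_next_involutive hG hH hn hf).obtainable
  push Not at hf
  obtain ⟨a, ha⟩ := hf
  by_cases hc : ∀ x, G.next.SameCycle a x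
  · obtain ⟨h, h1⟩ := exists_leaf hG hc
    obtain ⟨g, h2⟩ := exists_leaf hH (hn ▸ hc)
    -- A power of `next` moves the leaf of `H` onto that of `G`. It commutes with `next`, so
    -- relabelling by it changes only `opp`.
    obtain ⟨i, hi⟩ := (hc g).symm.trans (hc h)
    have hi' := isomorphic_map H (G.next ^ i)
    have hmn : (H.map (G.next ^ i)).next = G.next := by
      have : (H.map (G.next ^ i)).next = G.next ^ i * H.next * (G.next ^ i)⁻¹ := by
        ext x
        simp [next, map]
      rw [this, ← hn, ← (Commute.zpow_self G.next i).symm.eq, mul_inv_cancel_right]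
    have hmo : (H.map (G.next ^ i)).opp h = G.opp h := by
      rw [← hi]
      have : (H.map (G.next ^ i)).opp ((G.next ^ i) g) = (G.next ^ i) (H.opp g) := by simp [map]
      rw [this, ← h2, ← hn, hi, ← h1, ← mul_apply, (Commute.zpow_self G.next i).eq, mul_apply, hi]
    refine (obtainable_of_common_leaf hG (hi'.isPlane hH) hmn.symm rfl hmo h1 (fun e => ?_) (fun x => (hc h).symm.trans (hc x)) (ih' _ _)).trans hi'.obtainable.symm
    -- If the leaf were the whole graph, `next` would have order 2 at `h`, hence at `a`, contrary to
    -- the choice of `a`.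
    obtain ⟨j, rfl⟩ := (hc h).symm
    have hcomm : ∀ x, G.next ((G.next ^ j) x) = (G.next ^ j) (G.next x) := fun x =>
      DFunLike.congr_fun (Commute.zpow_self G.next j).symm.eq x
    rw [hcomm, hcomm, h1, e] at ha
    exact ha rfl
  · push Not at hc
    obtain ⟨b, hb⟩ := hc
    have : Nonempty D := ⟨a⟩
    obtain ⟨h, hh⟩ := Finite.exists_max (fun x => minimalPeriod G.next x)
    have h3 : 3 ≤ minimalPeriod G.next h := by
      refine le_trans ?_ (hh a)
      have h0 := minimalPeriod_pos_perm G.next a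
      by_contra! hlt
      have h1 := pow_minimalPeriod_apply G.next a
      obtain h2 | h2 : minimalPeriod G.next a = 1 ∨ minimalPeriod G.next a = 2 := by omega
      · rw [h2, pow_one] at h1
        exact ha (by rw [h1, h1])
      · rw [h2] at h1
        exact ha h1
    have hfh : G.next h ≠ h := fun e => by
      have : minimalPeriod G.next h ≤ 1 := IsPeriodicPt.minimalPeriod_le one_pos e
      omega
    have : Nonempty {x // ¬ G.next.SameCycle h x} := by
      by_cases hha : G.next.SameCycle h a
      · exact ⟨b, fun e => hb (hha.symm.trans e)⟩
      · exact ⟨a, hha⟩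
    obtain ⟨⟨o, hho⟩, ho⟩ := Finite.exists_max
      (fun x : {x // ¬ G.next.SameCycle h x} => minimalPeriod G.next x)
    -- The darts `h` and `o` depend only on `next`, so both graphs can be brought to have these same
    -- darts as the two sides of one edge.
    have key : ∀ K : EmbeddedGraph D, K.IsPlane → K.next = G.next → ∃ K' : EmbeddedGraph D,
        K'.ObtainableFrom K ∧ K'.next = G.next ∧ K'.IsPlane ∧ K'.opp h = o := by
      intro K hK hKn
      obtain ⟨K', b1, b2, b3, x, b4, b5⟩ := exists_adjacent hK (hKn.symm ▸ hho) (hKn.symm ▸ hfh)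
      obtain ⟨K'', d1, d2, d3, d4⟩ := exists_opp_eq (G := K') b3 (b2.symm ▸ b4) (b2.symm ▸ b5)
        (by rwa [b2, hKn])
      exact ⟨K'', b1.trans d1, d2.trans (b2.trans hKn), d3, d4⟩
    obtain ⟨G', g1, g2, g3, g4⟩ := key G hG rfl
    obtain ⟨H', k1, k2, k3, k4⟩ := key H hH hn.symm
    refine (g1.trans (obtainable_of_common_edge g3 k3 (g2.trans k2.symm) g4 k4 ?_ ?_ ?_ ?_
      (ih' _ _))).trans k1.symm
    all_goals rw [g2]
    exacts [hho, h3, hh o, fun x hx => ho ⟨x, hx⟩]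

end Induction

end EmbeddedGraph

/-! ### From equal perimeters to equal `next` -/

namespace EmbeddedGraph

open Equiv Equiv.Perm Function

section Perimeters

variable {D D' : Type*} {G : EmbeddedGraph D} {H : EmbeddedGraph D'}

/-- Equal multisets have equal multiplicities, that is, fibres of equal size, which are matched one
by one. -/
theorem exists_equiv_of_map_univ_eq {α β γ : Type*} [Fintype α] [Fintype β] {p : α → γ} {q : β → γ}
    (h : (Finset.univ : Finset α).val.map p = (Finset.univ : Finset β).val.map q) :
    ∃ e : α ≃ β, ∀ a, q (e a) = p a := by
  classical
  have hc : ∀ c, Fintype.card {a // p a = c} = Fintype.card {b // q b = c} := by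
    intro c
    have := congrArg (Multiset.count c) h
    rw [Multiset.count_map, Multiset.count_map] at this
    rw [Fintype.card_subtype, Fintype.card_subtype]
    simpa only [Finset.card_def, Finset.filter_val, eq_comm] using this
  exact ⟨Equiv.ofFiberEquiv fun c => Fintype.equivOfCardEq (hc c), Equiv.ofFiberEquiv_map _⟩

theorem perimeter_mk [Finite D] (G : EmbeddedGraph D) (x : D) :
    G.perimeter (Quotient.mk _ x) = minimalPeriod G.next x := by
  rw [minimalPeriod_eq_natCard, perimeter]
  exact Nat.card_congr (Equiv.subtypeEquivRight fun y => mk_eq_mk.trans sameCycle_comm)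

/-- Permutations whose cycles correspond, with the same lengths, are conjugate. -/
theorem exists_equiv_of_cycles {f : Perm D} {g : Perm D'} (s : Cycles f ≃ Cycles g)
    (h : ∀ F, minimalPeriod g (s F).out = minimalPeriod f F.out) :
    ∃ e : D ≃ D', ∀ x, e (f x) = g (e x) := by
  have hi : ∀ x, ∃ i : ℤ, (f ^ i) (Quotient.mk (SameCycle.setoid f) x).out = x := fun x =>
    mk_eq_mk.1 (Quotient.out_eq (Quotient.mk (SameCycle.setoid f) x))
  have key : ∀ (F : Cycles f) (i j : ℤ), (f ^ i) F.out = (f ^ j) F.out ↔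
      (g ^ i) (s F).out = (g ^ j) (s F).out := fun F i j => by
    rw [zpow_apply_eq_iff, zpow_apply_eq_iff, h]
  choose i hi using hi
  -- Each dart is written as a power of `f` applied to the chosen representative of its cycle; the
  -- same power is applied to the representative of the matching cycle. Equal periods make the
  -- choice of exponent immaterial.
  set e : D → D' := fun x => (g ^ i x) (s (Quotient.mk _ x)).out with he
  have he' : ∀ (F : Cycles f) (j : ℤ), e ((f ^ j) F.out) = (g ^ j) (s F).out := by
    intro F j
    have hF : (Quotient.mk _ ((f ^ j) F.out) : Cycles f) = F := by
      conv_rhs => rw [← F.out_eq]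
      exact mk_eq_mk.2 (SameCycle.symm ⟨j, rfl⟩)
    have := hi ((f ^ j) F.out)
    rw [hF, key] at this
    rw [he]
    simp only [hF, this]
  have hmk : ∀ x, (Quotient.mk _ (e x) : Cycles g) = s (Quotient.mk _ x) := by
    intro x
    conv_rhs => rw [← (s (Quotient.mk _ x)).out_eq]
    exact mk_eq_mk.2 (SameCycle.symm ⟨i x, rfl⟩)
  refine ⟨Equiv.ofBijective e ⟨fun x y hxy => ?_, fun y => ?_⟩, fun x => ?_⟩
  · have hF : (Quotient.mk _ x : Cycles f) = Quotient.mk _ y := s.injective (by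
      rw [← hmk, ← hmk, hxy])
    have hx := hi x
    have hy := hi y
    rw [← hF] at hy
    have := he' (Quotient.mk _ x) (i x)
    rw [hx, hxy, ← hy, he', ← key, hx, hy] at this
    exact this.symm
  · obtain ⟨j, hj⟩ : g.SameCycle (Quotient.mk (SameCycle.setoid g) y).out y :=
      mk_eq_mk.1 (Quotient.out_eq (Quotient.mk (SameCycle.setoid g) y))
    refine ⟨(f ^ j) (s.symm (Quotient.mk _ y)).out, ?_⟩
    rw [he', s.apply_symm_apply, hj]
  · show e (f x) = g (e x)
    have hx := hi x
    rw [← hx, he', ← mul_apply, ← zpow_one_add, he', zpow_one_add, mul_apply]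

end Perimeters

end EmbeddedGraph

theorem mainTheorem8 {D₁ D₂ : Type*} [Fintype D₁] [DecidableEq D₁] [Fintype D₂] [DecidableEq D₂]
    (Γ₁ : EmbeddedGraph D₁) (Γ₂ : EmbeddedGraph D₂) (h₁ : Γ₁.IsPlane) (h₂ : Γ₂.IsPlane)
    (hp : Γ₁.perimeters = Γ₂.perimeters) : Γ₁.ChainEquivalent Γ₂ := by
  classical
  obtain ⟨s, hs⟩ := EmbeddedGraph.exists_equiv_of_map_univ_eq hp
  obtain ⟨e, he⟩ := EmbeddedGraph.exists_equiv_of_cycles s fun F => by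
    rw [← EmbeddedGraph.perimeter_mk, ← EmbeddedGraph.perimeter_mk, Quotient.out_eq,
      Quotient.out_eq, hs]
  have hi := EmbeddedGraph.isomorphic_map Γ₁ e
  have hn : (Γ₁.map e).next = Γ₂.next := by
    ext x
    obtain ⟨x, rfl⟩ := e.surjective x
    rw [← he]
    simp [EmbeddedGraph.next, EmbeddedGraph.map]
  have h : Γ₂.ObtainableFrom Γ₁ := hi.obtainable.trans
    (EmbeddedGraph.obtainable_of_next_eq _ rfl (hi.isPlane h₁) h₂ hn)
  exact ⟨h, h.symm⟩
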